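/- Let $X$ be a closed connected Riemann surface, that is, a closed smooth oriented surface $S$ with a fixed reference complex structure, with canonical bundle $K$; in local holomorphic coordinates $z$ write $\partial=\partial_z$, $\bar\partial=\partial_{\bar z}$, and $\alpha=\alpha_1\,dz+\alpha_2\,d\bar z$ for a 1-form $\alpha$. Let $n\ge 2$ and let $(E,\Phi,g)$ be an $\mathrm{SL}_n(\mathbb{C})$-Fock bundle over $S$: $E$ is a smooth complex vector bundle of rank $n$ with a fixed volume form, $g$ is a smooth non-degenerate symmetric complex bilinear pairing on $E$, and $\Phi\in\Omega^1(S,\mathfrak{sl}(E))$ is $g$-self-adjoint with $\Phi\wedge\Phi=0$ and $\Phi(v)$ nilpotent of rank $n-1$ for every nonzero real tangent vector $v$. Let $h$ be a hermitian metric on $E$ such that $\Phi$ is positive: at every point, for every $\xi\in\mathfrak{sl}(E)$ with $[\Phi,\xi]=a\,dz+b\,d\bar z\neq 0$ one has $\operatorname{tr}(a^*a)-\operatorname{tr}(b^*b)>0$, where $*$ is the $h$-adjoint. Let $\mu=(\mu_k)_{2\le k\le n}$, $\mu_k\in\Gamma(K^{1-k}\otimes\bar K)$, be the higher Beltrami differentials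 of the higher complex structure induced by $\Phi$: locally, the ideal of all polynomials $Q\in\mathbb{C}[p,\bar p]$ with $Q(\Phi_1,\Phi_2)=0$ is $\langle p^n,\,-\bar p+\mu_2p+\mu_3p^2+\dots+\mu_np^{n-1}\rangle$. Let $d_A$ be a connection on $E$ which preserves the volume form, is unitary for $h$, and is $\Phi$-compatible, i.e. $d_A\Phi=0$. Let $A^{-\sigma}=\tfrac12(d_A-\sigma(d_A))$, where $\sigma(d_A)$ is the $g$-dual connection, determined by $d\,g(s,t)=g(\sigma(d_A)s,t)+g(s,d_At)$, and let $t_k=\operatorname{tr}\big(\Phi_1^{k-1}A_1^{-\sigma}\big)\in\Gamma(K^k)$, $2\le k\le n$, be the covector data of $d_A$. Then $d_A$ is the only volume-preserving unitary $\Phi$-compatible connection with covector data $t=(t_k)_{2\le k\le n}$, and the following are equivalent: (i) the $\mu$-holomorphicity condition $$(-\bar\partial+\mu_2\partial+k\,\partial\mu_2)\,t_k+\sum_{l=1}^{n-k}\big((l+k)\,\partial\mu_{l+2}+(l+1)\,\mu_{l+2}\,\partial\big)t_{k+l}=0$$ holds for all $k\in\{2,\dots,n\}$ in all local holomorphic coordinates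 of $X$; (ii) the curvature satisfies $F(A)\in\mathrm{Im}(\mathrm{ad}_\Phi)\subset\Omega^2(S,\mathfrak{sl}(E))$, i.e. $F(A)=[\Phi\wedge\eta]$ for some $\eta\in\Omega^1(S,\mathfrak{sl}(E))$. -/

import Mathlib

open scoped Manifold ContDiff Bundle ComplexConjugate

noncomputable section

namespace FockBundles

/-! ### Real-smooth sections, vector fields and endomorphism-valued forms

`S` is a surface with charts in `ℂ`; its smooth structure is the one for the real model `𝓘(ℝ, ℂ)`.
`E` is a complex vector bundle of rank `n` over `S`. -/

section Basic

variable {S : Type*} [TopologicalSpace S] [ChartedSpace ℂ S]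

/-- Smooth (real) vector fields on the surface. -/
def IsSmoothField [IsManifold 𝓘(ℝ, ℂ) ∞ S] (X : ∀ x : S, TangentSpace 𝓘(ℝ, ℂ) x) : Prop :=
  ContMDiff 𝓘(ℝ, ℂ) 𝓘(ℝ, ℂ).tangent ∞
    (fun x => (⟨x, X x⟩ : TangentBundle 𝓘(ℝ, ℂ) S))

/-- Smooth complex-valued functions on the surface. -/
def IsSmoothFun (f : S → ℂ) : Prop := ContMDiff 𝓘(ℝ, ℂ) 𝓘(ℝ, ℂ) ∞ f

/-- Smooth sections of `E`. -/
def IsSmoothSection (n : ℕ) {E : S → Type*} [TopologicalSpace (Bundle.TotalSpace (Fin n → ℂ) E)]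
    [∀ x, TopologicalSpace (E x)] [FiberBundle (Fin n → ℂ) E] (s : ∀ x, E x) : Prop :=
  ContMDiff 𝓘(ℝ, ℂ) (𝓘(ℝ, ℂ).prod 𝓘(ℝ, Fin n → ℂ)) ∞
    (fun x => Bundle.TotalSpace.mk' (Fin n → ℂ) x (s x))

/-- (Not necessarily smooth) one-forms on `S` with values in `End E`. -/
abbrev EndForm (E : S → Type*) [∀ x, AddCommGroup (E x)] [∀ x, Module ℂ (E x)] : Type _ :=
  ∀ x : S, TangentSpace 𝓘(ℝ, ℂ) x →ₗ[ℝ] Module.End ℂ (E x)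

/-- An `End E`-valued one-form is smooth if it maps smooth vector fields and smooth sections to
smooth sections. -/
def EndForm.IsSmooth (n : ℕ) {E : S → Type*}
    [TopologicalSpace (Bundle.TotalSpace (Fin n → ℂ) E)]
    [∀ x, AddCommGroup (E x)] [∀ x, Module ℂ (E x)] [∀ x, TopologicalSpace (E x)]
    [FiberBundle (Fin n → ℂ) E] [IsManifold 𝓘(ℝ, ℂ) ∞ S] (α : EndForm E) : Prop :=
  ∀ (X : ∀ x : S, TangentSpace 𝓘(ℝ, ℂ) x) (s : ∀ x, E x), IsSmoothField X →
    IsSmoothSection n s → IsSmoothSection n (fun x => α x (X x) (s x))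

/-- The two-form `[α ∧ β]`, evaluated on two tangent vectors. -/
def EndForm.bracketWedge {E : S → Type*} [∀ x, AddCommGroup (E x)] [∀ x, Module ℂ (E x)]
    (α β : EndForm E) (x : S) (v w : TangentSpace 𝓘(ℝ, ℂ) x) : Module.End ℂ (E x) :=
  ⁅α x v, β x w⁆ - ⁅α x w, β x v⁆

/-- Real tangent vectors in the local coordinate `c`: the vector at `c⁻¹(z)` which is represented
by `u ∈ ℂ = ℝ²`. So `u = 1` gives `∂_x` and `u = i` gives `∂_y`, where `z = x + iy`. -/
def coordVec (c : OpenPartialHomeomorph S ℂ) (z u : ℂ) : TangentSpace 𝓘(ℝ, ℂ) (c.symm z) :=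
  mfderiv 𝓘(ℝ, ℂ) 𝓘(ℝ, ℂ) c.symm z u

/-- The coefficient `α₁` of `α = α₁ dz + α₂ dz̄` in the local coordinate `c`, at the point `z`. -/
def EndForm.dzCoeff {E : S → Type*} [∀ x, AddCommGroup (E x)] [∀ x, Module ℂ (E x)]
    (α : EndForm E) (c : OpenPartialHomeomorph S ℂ) (z : ℂ) : Module.End ℂ (E (c.symm z)) :=
  (1 / 2 : ℂ) •
    (α (c.symm z) (coordVec c z 1) - Complex.I • α (c.symm z) (coordVec c z Complex.I))

/-- The coefficient `α₂` of `α = α₁ dz + α₂ dz̄` in the local coordinate `c`, at the point `z`. -/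
def EndForm.dzbarCoeff {E : S → Type*} [∀ x, AddCommGroup (E x)] [∀ x, Module ℂ (E x)]
    (α : EndForm E) (c : OpenPartialHomeomorph S ℂ) (z : ℂ) : Module.End ℂ (E (c.symm z)) :=
  (1 / 2 : ℂ) •
    (α (c.symm z) (coordVec c z 1) + Complex.I • α (c.symm z) (coordVec c z Complex.I))

end Basic

/-- `∂f/∂z`. -/
def dz (f : ℂ → ℂ) (z : ℂ) : ℂ :=
  (1 / 2 : ℂ) * (fderiv ℝ f z 1 - Complex.I * fderiv ℝ f z Complex.I)

/-- `∂f/∂z̄`. -/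
def dzbar (f : ℂ → ℂ) (z : ℂ) : ℂ :=
  (1 / 2 : ℂ) * (fderiv ℝ f z 1 + Complex.I * fderiv ℝ f z Complex.I)

/-! ### Fock bundles and hermitian metrics -/

/-- Principal nilpotent endomorphisms of an `n`-dimensional space: nilpotent of rank `n - 1`. -/
def IsPrincipalNilpotent (n : ℕ) {V : Type*} [AddCommGroup V] [Module ℂ V]
    (f : Module.End ℂ V) : Prop :=
  IsNilpotent f ∧ Module.finrank ℂ (LinearMap.range f) + 1 = n

section Bundles

variable {S : Type*} [TopologicalSpace S] [ChartedSpace ℂ S] [IsManifold 𝓘(ℝ, ℂ) ∞ S]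

/-- An `SL_n(ℂ)`-Fock bundle with underlying smooth complex vector bundle `E` of rank `n`: a
volume form, a symmetric pairing and a Fock field. Only the real smooth structure of `S` is used.
The pairing need not have determinant one with respect to the volume form. (The Fock field takes
values in `sl(E)` since nilpotent endomorphisms are trace-free.) -/
structure FockBundle (n : ℕ) (E : S → Type*)
    [TopologicalSpace (Bundle.TotalSpace (Fin n → ℂ) E)]
    [∀ x, AddCommGroup (E x)] [∀ x, Module ℂ (E x)] [∀ x, TopologicalSpace (E x)]
    [FiberBundle (Fin n → ℂ) E] where
  /-- the volume form `ν` -/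
  vol : ∀ x, E x [⋀^Fin n]→ₗ[ℂ] ℂ
  vol_ne_zero : ∀ x, vol x ≠ 0
  vol_smooth : ∀ s : Fin n → ∀ x, E x, (∀ i, IsSmoothSection n (s i)) →
    IsSmoothFun (fun x => vol x (fun i => s i x))
  /-- the symmetric pairing `g` -/
  pairing : ∀ x, LinearMap.BilinForm ℂ (E x)
  pairing_symm : ∀ x u v, pairing x u v = pairing x v u
  pairing_nondegenerate : ∀ x, (pairing x).Nondegenerate
  pairing_smooth : ∀ s t : ∀ x, E x, IsSmoothSection n s → IsSmoothSection n t →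
    IsSmoothFun (fun x => pairing x (s x) (t x))
  /-- the Fock field `Φ` -/
  field : EndForm E
  field_smooth : field.IsSmooth n
  /-- `Φ ∧ Φ = 0` -/
  field_commute : ∀ x v w, field x v * field x w = field x w * field x v
  field_nilpotent : ∀ (x : S) (v : TangentSpace 𝓘(ℝ, ℂ) x), v ≠ 0 →
    IsPrincipalNilpotent n (field x v)
  field_selfAdjoint : ∀ x v a b, pairing x (field x v a) b = pairing x a (field x v b)

/-- A smooth hermitian metric on `E`, conjugate-linear in the first variable. It need not be
normalised with respect to the volume form. -/
structure HermitianMetric (n : ℕ) (E : S → Type*)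
    [TopologicalSpace (Bundle.TotalSpace (Fin n → ℂ) E)]
    [∀ x, AddCommGroup (E x)] [∀ x, Module ℂ (E x)] [∀ x, TopologicalSpace (E x)]
    [FiberBundle (Fin n → ℂ) E] where
  form : ∀ x, E x →ₗ⋆[ℂ] E x →ₗ[ℂ] ℂ
  conj_symm : ∀ x u v, form x v u = conj (form x u v)
  pos : ∀ x v, v ≠ 0 → 0 < (form x v v).re
  smooth : ∀ s t : ∀ x, E x, IsSmoothSection n s → IsSmoothSection n t →
    IsSmoothFun (fun x => form x (s x) (t x))

variable {n : ℕ} {E : S → Type*} [TopologicalSpace (Bundle.TotalSpace (Fin n → ℂ) E)]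
  [∀ x, AddCommGroup (E x)] [∀ x, Module ℂ (E x)] [∀ x, TopologicalSpace (E x)]
  [FiberBundle (Fin n → ℂ) E]

/-- `f'` is the `h`-adjoint of the endomorphism `f` of the fibre over `x`. -/
def HermitianMetric.IsAdjoint (h : HermitianMetric n E) {x : S} (f' f : Module.End ℂ (E x)) : Prop :=
  ∀ u v, h.form x (f' u) v = h.form x u (f v)

/-- Positivity of `Φ`: on the subbundle `Im(ad_Φ) ⊂ sl(E) ⊗ T*S` the pseudo-hermitian form
`⟨α, β⟩ dz̄ ∧ dz = tr(α* ∧ β)` is positive definite. For `α = a dz + b dz̄` one has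
`⟨α, α⟩ = tr(a* a) - tr(b* b)`; here `α = [Φ, ξ]`, so `a = [Φ₁, ξ]` and `b = [Φ₂, ξ]`. -/
def FockBundle.IsPositive (P : FockBundle n E) (h : HermitianMetric n E) : Prop :=
  ∀ c ∈ atlas ℂ S, ∀ z ∈ c.target, ∀ ξ : Module.End ℂ (E (c.symm z)),
    LinearMap.trace ℂ _ ξ = 0 →
    ¬ (⁅P.field.dzCoeff c z, ξ⁆ = 0 ∧ ⁅P.field.dzbarCoeff c z, ξ⁆ = 0) →
    ∃ a' b' : Module.End ℂ (E (c.symm z)),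
      h.IsAdjoint a' ⁅P.field.dzCoeff c z, ξ⁆ ∧ h.IsAdjoint b' ⁅P.field.dzbarCoeff c z, ξ⁆ ∧
      0 < (LinearMap.trace ℂ _ (a' * ⁅P.field.dzCoeff c z, ξ⁆)
            - LinearMap.trace ℂ _ (b' * ⁅P.field.dzbarCoeff c z, ξ⁆)).re

/-! ### Connections -/

variable [∀ x, IsTopologicalAddGroup (E x)] [∀ x, ContinuousSMul ℝ (E x)]
  [VectorBundle ℝ (Fin n → ℂ) E]

/-- Smooth complex connections `d_A` on `E` preserving the volume form of the Fock bundle.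
`A.cov s x v` is the covariant derivative at `x` of the section `s` in the direction `v`. -/
structure SLConnection (P : FockBundle n E) where
  cov : CovariantDerivative 𝓘(ℝ, ℂ) (Fin n → ℂ) E
  smooth : ∀ (X : ∀ x : S, TangentSpace 𝓘(ℝ, ℂ) x) (s : ∀ x, E x), IsSmoothField X →
    IsSmoothSection n s → IsSmoothSection n (fun x => cov s x (X x))
  map_smul : ∀ (a : ℂ) (s : ∀ x, E x), IsSmoothSection n s → ∀ x v,
    cov (fun y => a • s y) x v = a • cov s x v
  vol_parallel : ∀ s : Fin n → ∀ x, E x, (∀ i, IsSmoothSection n (s i)) → ∀ x v,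
    mvfderiv 𝓘(ℝ, ℂ) (fun y => P.vol y (fun i => s i y)) x v =
      ∑ i, P.vol x (Function.update (fun j => s j x) i (cov (s i) x v))

variable {P : FockBundle n E}

/-- `d_A` is unitary: `d h(s, t) = h(d_A s, t) + h(s, d_A t)`. -/
def SLConnection.IsUnitary (A : SLConnection P) (h : HermitianMetric n E) : Prop :=
  ∀ s t : ∀ x, E x, IsSmoothSection n s → IsSmoothSection n t → ∀ x v,
    mvfderiv 𝓘(ℝ, ℂ) (fun y => h.form y (s y) (t y)) x v =
      h.form x (A.cov s x v) (t x) + h.form x (s x) (A.cov t x v)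

/-- The covariant exterior derivative `(d_A α)(X, Y) s` of an `End E`-valued one-form `α`, i.e.
`(∇_X (α(Y)) - ∇_Y (α(X)) - α([X, Y])) s`, where `∇_X (α(Y)) s = ∇_X (α(Y) s) - α(Y) ∇_X s`. -/
def SLConnection.dForm (A : SLConnection P) (α : EndForm E)
    (X Y : ∀ x : S, TangentSpace 𝓘(ℝ, ℂ) x) (s : ∀ x, E x) (x : S) : E x :=
  (A.cov (fun y => α y (Y y) (s y)) x (X x) - α x (Y x) (A.cov s x (X x)))
    - (A.cov (fun y => α y (X y) (s y)) x (Y x) - α x (X x) (A.cov s x (Y x)))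
    - α x (VectorField.mlieBracket 𝓘(ℝ, ℂ) X Y x) (s x)

/-- `d_A` is `Φ`-compatible: `d_A Φ = 0`. -/
def SLConnection.IsCompatible (A : SLConnection P) : Prop :=
  ∀ (X Y : ∀ x : S, TangentSpace 𝓘(ℝ, ℂ) x) (s : ∀ x, E x), IsSmoothField X → IsSmoothField Y →
    IsSmoothSection n s → ∀ x, A.dForm P.field X Y s x = 0

/-- The curvature `F(A)(X, Y) s = ∇_X ∇_Y s - ∇_Y ∇_X s - ∇_[X, Y] s`. -/
def SLConnection.curvature (A : SLConnection P)
    (X Y : ∀ x : S, TangentSpace 𝓘(ℝ, ℂ) x) (s : ∀ x, E x) (x : S) : E x :=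
  A.cov (fun y => A.cov s y (Y y)) x (X x) - A.cov (fun y => A.cov s y (X y)) x (Y x)
    - A.cov s x (VectorField.mlieBracket 𝓘(ℝ, ℂ) X Y x)

/-- `F(A) ∈ Im(ad_Φ) ⊂ Ω²(S, sl(E))`: there is `η ∈ Ω¹(S, sl(E))` with `F(A) = [Φ ∧ η]`. -/
def SLConnection.CurvatureInImage (A : SLConnection P) : Prop :=
  ∃ η : EndForm E, η.IsSmooth n ∧ (∀ x v, LinearMap.trace ℂ _ (η x v) = 0) ∧
    ∀ (X Y : ∀ x : S, TangentSpace 𝓘(ℝ, ℂ) x) (s : ∀ x, E x), IsSmoothField X →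
      IsSmoothField Y → IsSmoothSection n s → ∀ x,
      A.curvature X Y s x = P.field.bracketWedge η x (X x) (Y x) (s x)

/-- `B` is the `σ`-anti-invariant part `A^{-σ} = ½ (d_A - σ(d_A))` of `d_A`. On endomorphisms,
`σ(f) = - f^{*g}`; on connections, `σ(d_A)` is the `g`-dual connection, which is determined by
`d g(s, t) = g(σ(d_A) s, t) + g(s, d_A t)`. -/
def SLConnection.IsAntiInvariantPart (A : SLConnection P) (B : EndForm E) : Prop :=
  ∀ s t : ∀ x, E x, IsSmoothSection n s → IsSmoothSection n t → ∀ x v,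
    P.pairing x (B x v (s x)) (t x) =
      (1 / 2 : ℂ) * (P.pairing x (A.cov s x v) (t x) -
        (mvfderiv 𝓘(ℝ, ℂ) (fun y => P.pairing y (s y) (t y)) x v
          - P.pairing x (s x) (A.cov t x v)))

/-- The covector data `t_k = tr (Φ₁^{k-1} B₁)` in the local coordinate `c`. -/
def FockBundle.covectorData (P : FockBundle n E) (B : EndForm E)
    (c : OpenPartialHomeomorph S ℂ) (k : ℕ) (z : ℂ) : ℂ :=
  LinearMap.trace ℂ _ (P.field.dzCoeff c z ^ (k - 1) * B.dzCoeff c z)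

end Bundles

/-! ### Higher complex structures -/

/-- A higher complex structure of order `n` on a surface with a reference complex structure, given
by its higher Beltrami differentials `μ_k ∈ Γ(K^{1-k} ⊗ K̄)`, `2 ≤ k ≤ n`: `μ c k` is the
coefficient function of `μ_k` in the local coordinate `c`. -/
structure HigherComplexStructure (S : Type*) [TopologicalSpace S] [ChartedSpace ℂ S] (n : ℕ) where
  μ : OpenPartialHomeomorph S ℂ → ℕ → ℂ → ℂ
  smooth : ∀ c ∈ atlas ℂ S, ∀ k ∈ Finset.Icc 2 n, ContDiffOn ℝ ∞ (μ c k) c.target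
  transform : ∀ c ∈ atlas ℂ S, ∀ c' ∈ atlas ℂ S, ∀ k ∈ Finset.Icc 2 n,
    ∀ z ∈ (c.symm.trans c').source,
      μ c k z * deriv (c' ∘ c.symm) z ^ (k - 1) =
        μ c' k (c' (c.symm z)) * conj (deriv (c' ∘ c.symm) z)

/-- The ideal `⟨p^n, -p̄ + μ_2 p + μ_3 p² + … + μ_n p^{n-1}⟩` of
`Sym(T^ℂ_x S) = ℂ[p, p̄]`, where `p = ∂_z` (variable `0`) and `p̄ = ∂_z̄` (variable `1`). -/
def HigherComplexStructure.ideal {S : Type*} [TopologicalSpace S] [ChartedSpace ℂ S] {n : ℕ}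
    (J : HigherComplexStructure S n) (c : OpenPartialHomeomorph S ℂ) (z : ℂ) :
    Ideal (MvPolynomial (Fin 2) ℂ) :=
  Ideal.span {MvPolynomial.X 0 ^ n,
    -MvPolynomial.X 1 +
      ∑ k ∈ Finset.Icc 2 n, MvPolynomial.C (J.μ c k z) * MvPolynomial.X 0 ^ (k - 1)}

/-- The value `Q(a, b) = ∑ Q_{ij} aⁱ bʲ` of a polynomial in two variables. -/
def evalPair {V : Type*} [AddCommGroup V] [Module ℂ V] (a b : Module.End ℂ V)
    (Q : MvPolynomial (Fin 2) ℂ) : Module.End ℂ V :=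
  ∑ m ∈ Q.support, Q.coeff m • (a ^ m 0 * b ^ m 1)

/-- `J` is the higher complex structure induced by the Fock bundle: its ideal is the kernel of
`Sym(T^ℂ S) → End E`, `v_1 ⋯ v_k ↦ Φ(v_1) ⋯ Φ(v_k)`. -/
def FockBundle.Induces {S : Type*} [TopologicalSpace S] [ChartedSpace ℂ S]
    [IsManifold 𝓘(ℝ, ℂ) ∞ S] {n : ℕ} {E : S → Type*}
    [TopologicalSpace (Bundle.TotalSpace (Fin n → ℂ) E)]
    [∀ x, AddCommGroup (E x)] [∀ x, Module ℂ (E x)] [∀ x, TopologicalSpace (E x)]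
    [FiberBundle (Fin n → ℂ) E] (P : FockBundle n E) (J : HigherComplexStructure S n) : Prop :=
  ∀ c ∈ atlas ℂ S, ∀ z ∈ c.target, ∀ Q : MvPolynomial (Fin 2) ℂ,
    Q ∈ J.ideal c z ↔ evalPair (P.field.dzCoeff c z) (P.field.dzbarCoeff c z) Q = 0

/-- The `μ`-holomorphicity condition for `t = (t_k)_{2 ≤ k ≤ n}`, where `t c k` is the coefficient
function of `t_k ∈ Γ(K^k)` in the local coordinate `c`. -/
def HigherComplexStructure.IsMuHolomorphic {S : Type*} [TopologicalSpace S] [ChartedSpace ℂ S]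
    {n : ℕ} (J : HigherComplexStructure S n)
    (t : OpenPartialHomeomorph S ℂ → ℕ → ℂ → ℂ) : Prop :=
  ∀ c ∈ atlas ℂ S, ∀ z ∈ c.target, ∀ k ∈ Finset.Icc 2 n,
    (-dzbar (t c k) z + J.μ c 2 z * dz (t c k) z + k * dz (J.μ c 2) z * t c k z)
      + ∑ l ∈ Finset.Icc 1 (n - k),
        (((l : ℂ) + k) * dz (J.μ c (l + 2)) z * t c (k + l) z
          + ((l : ℂ) + 1) * J.μ c (l + 2) z * dz (t c (k + l)) z) = 0

end FockBundles

end

/-!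
Two mechanisms carry the proof: traces against powers of `Φ₁`, and positivity of `Φ`.

**Adapted frames.** The ideal of the higher complex structure shows that `Φ₁^n = 0 ≠ Φ₁^(n-1)`, so a
cyclic vector of `Φ₁` generates a smooth local frame `e, Φ₁ e, …, Φ₁^(n-1) e`
(`exists_adaptedFrame`), in which `Φ₁` is the constant Jordan block `N` and `Φ₂ = ∑ μ_m N^(m-1)`.
Writing the connection form as `A₁ dz + A₂ dz̄`, compatibility reads
`[A₂, N] = ∑ ∂μ_m N^(m-1) + [A₁, Φ₂]` (`compatible_matrix`). Given `A₁`, this equation determines `A₂`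
up to the centralizer of `N`, that is, up to polynomials in `N`, which are trace-orthogonal to all
positive powers of `N`. Hence, for `k ≥ 1`, it gives `tr (N^k A₂)` and `tr (N^k [A₁, A₂])` as
combinations of the functions `tr (N^j A₁)` (`trace_identities`). Since `N` is `g`-symmetric and
constant, these functions are the covector data: `t_k = tr (N^(k-1) A₁)` (`covectorData_eq`).

**The equivalence.** With these identities, `tr (N^(k-1) F)` for the curvature
`F = ∂A₂ - ∂̄A₁ + [A₁, A₂]` is exactly the left-hand side of the `μ`-holomorphicity condition for
`t_k` (`muHolomorphic_expression_eq`). If `F = [Φ ∧ η]`, all these traces vanish, because `Φ₁`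
commutes with `Φ`. Conversely, the image of `ad_N` is the trace-orthogonal complement of the
centralizer of `N`, so if the traces vanish (the one for `k = 1` does because the volume form is
parallel), a fixed linear map solves `[Φ₁, ξ] = F`. Then `F(A) = [Φ ∧ ξ dz̄]` locally, and a
partition of unity glues the forms `ξ dz̄`.

**Uniqueness.** The difference `β` of two unitary compatible connections with the same covector data
satisfies `[Φ ∧ β] = 0` and `tr (Φ₁^k β₁) = 0` for all `k`, so that `β₁ = [Φ₁, ξ]`. The form
`Z = β₂ - [Φ₂, ξ]` then commutes with `Φ₁`, and as `β` is skew-hermitian the cross terms in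
`⟨[Φ, ξ], [Φ, ξ]⟩` vanish, leaving `-tr (Z* Z) ≤ 0`. By positivity of `Φ` this forces `[Φ, ξ] = 0`,
hence `β = 0` (`eq_zero_of_skew_of_positive`).
-/

set_option linter.unusedSectionVars false

noncomputable section

namespace FockBundles

open Filter Topology

/-! ### The nilpotent Jordan block -/

section JordanBlock

/-- The derivative of `N ↦ N ^ p` in the direction `A`, that is,
`∑_{c < p} N ^ c * A * N ^ (p - 1 - c)`, defined recursively. -/
def powVariation {R : Type*} [Ring R] (N A : R) : ℕ → R
  | 0 => 0
  | p + 1 => powVariation N A p * N + N ^ p * A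

/-- Telescoping: `[∑ N ^ c A N ^ (p - 1 - c), N] = [A, N ^ p]`. -/
lemma powVariation_commutator {R : Type*} [Ring R] (N A : R) (p : ℕ) :
    powVariation N A p * N - N * powVariation N A p = A * N ^ p - N ^ p * A := by
  induction p with
  | zero => simp [powVariation]
  | succ p ih =>
    have h : N * powVariation N A p = powVariation N A p * N - (A * N ^ p - N ^ p * A) := by
      rw [← ih]; abel
    simp only [powVariation, mul_add, ← mul_assoc, h, pow_succ', (pow_mul_comm' N p).symm]
    simp only [add_mul, sub_mul, mul_assoc, pow_mul_comm']
    abel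

/-- Leibniz rule for the derivation `[Q, ·]` on powers of `N`. -/
lemma commutator_pow {R : Type*} [Ring R] (N Q : R) (p : ℕ) :
    Q * N ^ p - N ^ p * Q = powVariation N (Q * N - N * Q) p := by
  induction p with
  | zero => simp [powVariation]
  | succ p ih =>
    simp only [powVariation, ← ih, pow_succ]
    noncomm_ring

lemma powVariation_of_commute {R : Type*} [Ring R] {N V : R} (h : Commute N V) (p : ℕ) :
    powVariation N V p = p • (N ^ (p - 1) * V) := by
  induction p with
  | zero => simp [powVariation]
  | succ p ih =>
    rcases p with _ | p
    · simp [powVariation]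
    · rw [powVariation, ih, Nat.add_sub_cancel, Nat.add_sub_cancel, smul_mul_assoc, mul_assoc,
        ← h.eq, ← mul_assoc, ← pow_succ, ← succ_nsmul]

variable {n : ℕ}

lemma trace_pow_mul_powVariation (N A : Matrix (Fin n) (Fin n) ℂ) (p k : ℕ) :
    (N ^ k * powVariation N A p).trace = p * (N ^ (k + (p - 1)) * A).trace := by
  induction p generalizing k with
  | zero => simp [powVariation]
  | succ p ih =>
    have h1 : (N ^ k * (powVariation N A p * N)).trace =
        (N ^ (k + 1) * powVariation N A p).trace := by
      rw [← mul_assoc, Matrix.trace_mul_comm, ← mul_assoc, ← pow_succ']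
    rw [powVariation, mul_add, Matrix.trace_add, h1, ih, ← mul_assoc, ← pow_add]
    rcases p with _ | p
    · simp
    · rw [Nat.add_sub_cancel, Nat.add_sub_cancel, show k + 1 + p = k + (p + 1) by ring]
      push_cast; ring

/-- The second variation of the trace of powers is symmetric; this is the resulting cancellation. -/
lemma trace_pow_mul_commutator_powVariation (N A : Matrix (Fin n) (Fin n) ℂ) (p k : ℕ) :
    (N ^ k * (A * powVariation N A p - powVariation N A p * A)).trace = 0 := by
  induction p generalizing k with
  | zero => simp [powVariation]
  | succ p ih =>
    have h := powVariation_commutator N A p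
    have h1 : powVariation N A p * N = N * powVariation N A p + (A * N ^ p - N ^ p * A) := by
      rw [← h]; abel
    have h2 : (N ^ k * (A * (powVariation N A p * N))).trace
        = (N ^ (k + 1) * (A * powVariation N A p)).trace := by
      rw [← mul_assoc A, ← mul_assoc, Matrix.trace_mul_comm, ← mul_assoc, ← pow_succ']
    have h3 := ih (k + 1)
    rw [mul_sub, Matrix.trace_sub] at h3
    rw [powVariation, mul_add, mul_sub, mul_add, add_mul, mul_add, Matrix.trace_sub,
      Matrix.trace_add, h2, h1, add_mul, sub_mul, mul_add, mul_sub]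
    have e1 : N ^ k * (N * powVariation N A p * A) = N ^ (k + 1) * (powVariation N A p * A) := by
      rw [pow_succ]; simp only [mul_assoc]
    have e2 : N ^ k * (A * N ^ p * A) = N ^ k * (A * (N ^ p * A)) := by simp only [mul_assoc]
    rw [e1, e2, Matrix.trace_add, Matrix.trace_add, Matrix.trace_sub]
    linear_combination h3

/-- The nilpotent Jordan block `e_j ↦ e_{j+1}`. -/
def shift (n : ℕ) : Matrix (Fin n) (Fin n) ℂ := fun i j => if (i : ℕ) = j + 1 then 1 else 0

lemma shift_pow_apply (k : ℕ) (i j : Fin n) :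
    (shift n ^ k) i j = if (i : ℕ) = j + k then 1 else 0 := by
  induction k generalizing i j with
  | zero => simp [Matrix.one_apply, Fin.ext_iff]
  | succ k ih =>
    rw [pow_succ, Matrix.mul_apply]
    simp only [ih, shift]
    by_cases hj : (j : ℕ) + 1 < n
    · rw [Finset.sum_eq_single ⟨j + 1, hj⟩]
      · simp; congr 1; simp; omega
      · intro b _ hb
        rw [if_neg (c := (b : ℕ) = j + 1), mul_zero]
        exact fun h => hb (Fin.ext h)
      · simp
    · rw [if_neg (by omega)]
      refine Finset.sum_eq_zero fun b _ => ?_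
      rw [if_neg (c := (b : ℕ) = j + 1) (by omega), mul_zero]

lemma shift_pow_eq_zero {k : ℕ} (hk : n ≤ k) : shift n ^ k = 0 := by
  ext i j
  rw [shift_pow_apply, if_neg (by omega)]; rfl

lemma isNilpotent_shift : IsNilpotent (shift n) := ⟨n, shift_pow_eq_zero le_rfl⟩

lemma trace_pow_mul_of_commute {N X : Matrix (Fin n) (Fin n) ℂ} (hN : IsNilpotent N)
    (h : Commute N X) {k : ℕ} (hk : 1 ≤ k) : (N ^ k * X).trace = 0 := by
  have h1 : IsNilpotent (N ^ k * X) :=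
    (h.pow_left k).isNilpotent_mul_right (hN.pow_of_pos (by omega))
  exact (Matrix.isNilpotent_trace_of_isNilpotent h1).eq_zero

/-- The grading element, with `[H, N] = N` for the Jordan block `N`. -/
lemma exists_grading : ∃ H : Matrix (Fin n) (Fin n) ℂ, H * shift n - shift n * H = shift n := by
  refine ⟨Matrix.diagonal fun i => ((i : ℕ) : ℂ), ?_⟩
  ext i j
  rw [Matrix.sub_apply, Matrix.diagonal_mul, Matrix.mul_diagonal]
  simp only [shift]
  split_ifs with h
  · rw [h]; push_cast; ring
  · simp

/-- If `[H, N] = N`, then `H` is trace-orthogonal to the positive powers of `N`. -/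
lemma trace_pow_mul_grading {N H : Matrix (Fin n) (Fin n) ℂ} (h : H * N - N * H = N) {k : ℕ}
    (hk : 1 ≤ k) : (N ^ k * H).trace = 0 := by
  have h1 : H * N ^ k - N ^ k * H = k • N ^ k := by
    rw [commutator_pow, h, powVariation_of_commute (Commute.refl N), ← pow_succ,
      Nat.sub_add_cancel hk]
  have h2 : ((H * N ^ k - N ^ k * H) * H).trace = 0 := by
    rw [sub_mul, Matrix.trace_sub, mul_assoc, Matrix.trace_mul_comm, sub_self]
  rw [h1, smul_mul_assoc, Matrix.trace_smul, nsmul_eq_mul] at h2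
  exact (mul_eq_zero.1 h2).resolve_left (by exact_mod_cast (by omega : k ≠ 0))

/-- A solution `Q` of `[Q, N] = ∑ ν_m N ^ (m - 1)` is, up to the centralizer of `N`, a combination
of the `N ^ (m - 2) H` with `H` the grading element. -/
lemma trace_shift_pow_mul_eq_zero {Q : Matrix (Fin n) (Fin n) ℂ} {s : Finset ℕ}
    (hs : ∀ m ∈ s, 2 ≤ m) {ν : ℕ → ℂ}
    (h : Q * shift n - shift n * Q = ∑ m ∈ s, ν m • shift n ^ (m - 1)) {k : ℕ} (hk : 1 ≤ k) :
    (shift n ^ k * Q).trace = 0 := by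
  obtain ⟨H, hH⟩ := exists_grading (n := n)
  set N := shift n
  set D := ∑ m ∈ s, ν m • (N ^ (m - 2) * H) with hD
  have hDN : D * N - N * D = ∑ m ∈ s, ν m • N ^ (m - 1) := by
    rw [hD, Finset.sum_mul, Finset.mul_sum, ← Finset.sum_sub_distrib]
    refine Finset.sum_congr rfl fun m hm => ?_
    rw [smul_mul_assoc, mul_smul_comm, ← smul_sub]
    congr 1
    rw [mul_assoc, ← mul_assoc N, ← pow_mul_comm', mul_assoc (N ^ (m - 2)), ← mul_sub, hH,
      ← pow_succ]
    congr 1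
    have := hs m hm
    omega
  have hc : Commute N (Q - D) := by
    have : Q * N - N * Q - (D * N - N * D) = 0 := by rw [h, hDN, sub_self]
    refine (sub_eq_zero.1 ?_ : N * (Q - D) = (Q - D) * N)
    rw [mul_sub, sub_mul, ← neg_eq_zero, ← this]; abel
  have h1 := trace_pow_mul_of_commute isNilpotent_shift hc hk
  rw [mul_sub, Matrix.trace_sub] at h1
  have h2 : (N ^ k * D).trace = 0 := by
    rw [hD, Finset.mul_sum, Matrix.trace_sum]
    refine Finset.sum_eq_zero fun m _ => ?_
    rw [mul_smul_comm, Matrix.trace_smul, ← mul_assoc, ← pow_add,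
      trace_pow_mul_grading hH (by omega), smul_zero]
  rw [h2, sub_zero] at h1
  exact h1

/-- The trace identities for the pair of coefficients `A₁, A₂` of a compatible connection in a frame
in which `Φ₁` is the Jordan block `N` and `Φ₂ = ∑ μ_m N ^ (m - 1)`; here `ν_m = ∂μ_m`. -/
lemma trace_identities {A₁ A₂ : Matrix (Fin n) (Fin n) ℂ} {s : Finset ℕ}
    (hs : ∀ m ∈ s, 2 ≤ m) {μ ν : ℕ → ℂ}
    (h : A₂ * shift n - shift n * A₂ = (∑ m ∈ s, ν m • shift n ^ (m - 1)) +
      (A₁ * (∑ m ∈ s, μ m • shift n ^ (m - 1)) - (∑ m ∈ s, μ m • shift n ^ (m - 1)) * A₁))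
    {k : ℕ} (hk : 1 ≤ k) :
    (shift n ^ k * A₂).trace
        = ∑ m ∈ s, ((m : ℂ) - 1) * μ m * (shift n ^ (k + (m - 2)) * A₁).trace ∧
      (shift n ^ k * (A₁ * A₂ - A₂ * A₁)).trace
        = ∑ m ∈ s, (k : ℂ) * ν m * (shift n ^ (k + (m - 2)) * A₁).trace := by
  set N := shift n
  set T := ∑ m ∈ s, μ m • powVariation N A₁ (m - 1) with hT
  have hTN : T * N - N * T = A₁ * (∑ m ∈ s, μ m • N ^ (m - 1)) -
      (∑ m ∈ s, μ m • N ^ (m - 1)) * A₁ := by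
    rw [hT, Finset.sum_mul, Finset.mul_sum, ← Finset.sum_sub_distrib, Finset.mul_sum,
      Finset.sum_mul, ← Finset.sum_sub_distrib]
    refine Finset.sum_congr rfl fun m _ => ?_
    rw [smul_mul_assoc, mul_smul_comm, ← smul_sub, powVariation_commutator, mul_smul_comm,
      smul_mul_assoc, smul_sub]
  obtain ⟨Q, hQ⟩ : ∃ Q, Q = A₂ - T := ⟨_, rfl⟩
  have hA : A₂ = T + Q := by rw [hQ]; abel
  have hQN : Q * N - N * Q = ∑ m ∈ s, ν m • N ^ (m - 1) := by
    rw [hQ, sub_mul, mul_sub]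
    rw [← hTN] at h
    rw [sub_sub_sub_comm, h]; abel
  have hcast : ∀ m ∈ s, ((m - 1 : ℕ) : ℂ) = (m : ℂ) - 1 := fun m hm => by
    have := hs m hm
    push_cast [Nat.cast_sub (show 1 ≤ m by omega)]; ring
  constructor
  · rw [hA, mul_add, Matrix.trace_add, trace_shift_pow_mul_eq_zero hs hQN hk, add_zero, hT,
      Finset.mul_sum, Matrix.trace_sum]
    refine Finset.sum_congr rfl fun m hm => ?_
    rw [mul_smul_comm, Matrix.trace_smul, trace_pow_mul_powVariation, smul_eq_mul, hcast m hm,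
      show m - 1 - 1 = m - 2 by omega]
    ring
  · have h1 : (N ^ k * (A₁ * T - T * A₁)).trace = 0 := by
      rw [hT, Finset.mul_sum, Finset.sum_mul, ← Finset.sum_sub_distrib, Finset.mul_sum,
        Matrix.trace_sum]
      refine Finset.sum_eq_zero fun m _ => ?_
      rw [mul_smul_comm, smul_mul_assoc, ← smul_sub, mul_smul_comm, Matrix.trace_smul,
        trace_pow_mul_commutator_powVariation, smul_zero]
    have h2 : (N ^ k * (A₁ * Q - Q * A₁)).trace = ((Q * N ^ k - N ^ k * Q) * A₁).trace := by
      rw [mul_sub, sub_mul, Matrix.trace_sub, Matrix.trace_sub, ← mul_assoc, Matrix.trace_mul_comm,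
        mul_assoc, mul_assoc]
    have h3 : Commute N (∑ m ∈ s, ν m • N ^ (m - 1)) :=
      Commute.sum_right _ _ _ fun m _ => ((Commute.refl N).pow_right _).smul_right _
    have h4 : A₁ * A₂ - A₂ * A₁ = (A₁ * T - T * A₁) + (A₁ * Q - Q * A₁) := by
      rw [hA]; noncomm_ring
    rw [h4, mul_add, Matrix.trace_add, h1, zero_add, h2, commutator_pow, hQN,
      powVariation_of_commute h3, smul_mul_assoc, Matrix.trace_smul, Finset.mul_sum, Finset.sum_mul,
      Matrix.trace_sum, Finset.smul_sum]
    refine Finset.sum_congr rfl fun m hm => ?_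
    rw [mul_smul_comm, smul_mul_assoc, Matrix.trace_smul, ← pow_add, nsmul_eq_mul, smul_eq_mul,
      mul_assoc]
    have := hs m hm
    rw [show k - 1 + (m - 1) = k + (m - 2) by omega]

lemma eq_zero_of_commute_shift {X : Matrix (Fin n) (Fin n) ℂ} (hn : 0 < n)
    (h : Commute (shift n) X) (h0 : ∀ i, X i ⟨0, hn⟩ = 0) : X = 0 := by
  ext i j
  have h1 : (X * shift n ^ (j : ℕ)) i ⟨0, hn⟩ = X i j := by
    rw [Matrix.mul_apply, Finset.sum_eq_single j]
    · simp [shift_pow_apply]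
    · intro b _ hb
      rw [shift_pow_apply, if_neg, mul_zero]
      simpa [Fin.ext_iff] using hb
    · simp
  rw [← h1, ← (h.pow_left j).eq, Matrix.mul_apply]
  simp [h0]

/-- The centralizer of the Jordan block consists of its polynomials. -/
lemma eq_sum_shift_pow_of_commute {X : Matrix (Fin n) (Fin n) ℂ} (h : Commute (shift n) X) :
    ∃ p : Fin n → ℂ, X = ∑ k, p k • shift n ^ (k : ℕ) := by
  rcases Nat.eq_zero_or_pos n with rfl | hn
  · exact ⟨0, Subsingleton.elim _ _⟩
  refine ⟨fun k => X k ⟨0, hn⟩, sub_eq_zero.1 (eq_zero_of_commute_shift hn ?_ ?_)⟩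
  · exact h.sub_right (Commute.sum_right _ _ _ fun m _ =>
      ((Commute.refl _).pow_right _).smul_right _)
  · intro i
    rw [Matrix.sub_apply, Matrix.sum_apply, Finset.sum_eq_single i]
    · simp [shift_pow_apply]
    · intro b _ hb
      rw [Matrix.smul_apply, shift_pow_apply, if_neg, smul_zero]
      simpa [Fin.ext_iff, eq_comm] using hb
    · simp

/-- The adjoint action of the Jordan block. -/
def adShift (n : ℕ) : Matrix (Fin n) (Fin n) ℂ →ₗ[ℂ] Matrix (Fin n) (Fin n) ℂ :=
  LinearMap.mulLeft ℂ (shift n) - LinearMap.mulRight ℂ (shift n)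

lemma adShift_apply (X : Matrix (Fin n) (Fin n) ℂ) : adShift n X = shift n * X - X * shift n := rfl

/-- The image of `ad_N` is the trace-orthogonal complement of the centralizer of `N`. -/
lemma mem_range_adShift {F : Matrix (Fin n) (Fin n) ℂ}
    (h : ∀ k, (shift n ^ k * F).trace = 0) : F ∈ LinearMap.range (adShift n) := by
  by_contra hF
  obtain ⟨f, hf0, hf⟩ := Submodule.exists_le_ker_of_notMem hF
  obtain ⟨X, hX⟩ : ∃ X : Matrix (Fin n) (Fin n) ℂ, ∀ Y, f Y = (X * Y).trace := by
    refine ⟨fun i j => f (Matrix.single j i 1), fun Y => ?_⟩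
    conv_lhs => rw [Matrix.matrix_eq_sum_single Y]
    simp only [map_sum, Matrix.trace, Matrix.diag]
    rw [Finset.sum_comm]
    refine Finset.sum_congr rfl fun i _ => Finset.sum_congr rfl fun j _ => ?_
    rw [← mul_one (Y j i), ← smul_eq_mul (Y j i), ← Matrix.smul_single, map_smul, smul_eq_mul]
    exact mul_comm _ _
  have hc : Commute (shift n) X := by
    have h1 : ∀ Y, ((X * shift n - shift n * X) * Y).trace = 0 := fun Y => by
      have : f (adShift n Y) = 0 := hf ⟨Y, rfl⟩
      rw [hX, adShift_apply, mul_sub, Matrix.trace_sub, ← mul_assoc, ← mul_assoc,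
        Matrix.trace_mul_comm (X * Y), ← mul_assoc] at this
      rw [sub_mul, Matrix.trace_sub, this]
    exact (sub_eq_zero.1 (Matrix.ext_iff_trace_mul_right.2 fun Y => by
      rw [h1, zero_mul, Matrix.trace_zero])).symm
  obtain ⟨p, rfl⟩ := eq_sum_shift_pow_of_commute hc
  refine hf0 ?_
  rw [hX, Finset.sum_mul, Matrix.trace_sum]
  refine Finset.sum_eq_zero fun k _ => ?_
  rw [smul_mul_assoc, Matrix.trace_smul, h, smul_zero]

/-- A linear choice of trace-free solutions `X` of `[N, X] = F`. -/
lemma exists_adShift_inverse (n : ℕ) :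
    ∃ R : Matrix (Fin n) (Fin n) ℂ →ₗ[ℂ] Matrix (Fin n) (Fin n) ℂ, (∀ F, (R F).trace = 0) ∧
      ∀ F, (∀ k, (shift n ^ k * F).trace = 0) → shift n * R F - R F * shift n = F := by
  obtain ⟨g, hg⟩ := (adShift n).rangeRestrict.exists_rightInverse_of_surjective
    (LinearMap.range_rangeRestrict _)
  obtain ⟨q, hq⟩ := (LinearMap.range (adShift n)).subtype.exists_leftInverse_of_injective
    (Submodule.ker_subtype _)
  let R₀ := g.comp q
  have hR₀ : ∀ F, (∀ k, (shift n ^ k * F).trace = 0) → shift n * R₀ F - R₀ F * shift n = F := by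
    intro F hF
    have h1 : q F = ⟨F, mem_range_adShift hF⟩ := LinearMap.congr_fun hq ⟨F, mem_range_adShift hF⟩
    have h2 : ((adShift n).rangeRestrict (g (q F)) : Matrix (Fin n) (Fin n) ℂ) = q F :=
      congrArg Subtype.val (LinearMap.congr_fun hg (q F))
    rw [h1] at h2
    exact (congrArg (fun Y => adShift n (g Y)) h1).trans h2
  refine ⟨R₀ - ((n : ℂ)⁻¹ • (Matrix.traceLinearMap (Fin n) ℂ ℂ).comp R₀).smulRight 1, fun F => ?_,
    fun F hF => ?_⟩
  · rcases Nat.eq_zero_or_pos n with rfl | hn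
    · simp [Matrix.trace]
    · have : (n : ℂ) ≠ 0 := by exact_mod_cast hn.ne'
      simp only [LinearMap.sub_apply, LinearMap.smulRight_apply, LinearMap.smul_apply,
        LinearMap.comp_apply, Matrix.traceLinearMap_apply, Matrix.trace_sub, Matrix.trace_smul,
        Matrix.trace_one, Fintype.card_fin, smul_eq_mul]
      field_simp
      ring
  · simp only [LinearMap.sub_apply, LinearMap.smulRight_apply, mul_sub, sub_mul, mul_smul_comm,
      smul_mul_assoc, mul_one, one_mul]
    rw [sub_sub_sub_cancel_right, hR₀ F hF]

/-- The matrix form of the relation between a connection `A`, the Gram matrix `G` of the pairing,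
its derivative `G'`, and the anti-invariant part `B`: as `N` is `G`- and `G'`-self-adjoint, the
`σ`-invariant part of `A` does not contribute to the traces. -/
lemma trace_pow_mul_antiInvariant {N A B G G' : Matrix (Fin n) (Fin n) ℂ} (hN : IsNilpotent N)
    (hG : IsUnit G.det) (hGN : G * N = N.transpose * G) (hG'N : G' * N = N.transpose * G')
    (hB : B.transpose * G = (1 / 2 : ℂ) • (A.transpose * G - (G' - G * A))) {k : ℕ} (hk : 1 ≤ k) :
    (N ^ k * B).trace = (N ^ k * A).trace := by
  have hi : G⁻¹ * N.transpose = N * G⁻¹ := by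
    calc G⁻¹ * N.transpose = G⁻¹ * (N.transpose * G) * G⁻¹ := by
          rw [mul_assoc, mul_assoc, Matrix.mul_nonsing_inv _ hG, mul_one]
      _ = N * G⁻¹ := by rw [← hGN, ← mul_assoc, Matrix.nonsing_inv_mul _ hG, one_mul]
  have hik : G⁻¹ * N.transpose ^ k = N ^ k * G⁻¹ :=
    (show SemiconjBy G⁻¹ N.transpose N from hi).pow_right k
  have hB' : B.transpose = (1 / 2 : ℂ) • (A.transpose - G' * G⁻¹ + G * A * G⁻¹) := by
    calc B.transpose = B.transpose * G * G⁻¹ := by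
          rw [mul_assoc, Matrix.mul_nonsing_inv _ hG, mul_one]
      _ = _ := by
          rw [hB, smul_mul_assoc, sub_mul, sub_mul, mul_assoc _ G, Matrix.mul_nonsing_inv _ hG,
            mul_one]
          congr 1; abel
  have hc : Commute N.transpose (G' * G⁻¹) := by
    change N.transpose * (G' * G⁻¹) = G' * G⁻¹ * N.transpose
    rw [mul_assoc, hi, ← mul_assoc, ← mul_assoc, hG'N]
  have hNt : IsNilpotent N.transpose := by
    obtain ⟨m, hm⟩ := hN
    exact ⟨m, by rw [← Matrix.transpose_pow, hm, Matrix.transpose_zero]⟩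
  have h0 := trace_pow_mul_of_commute hNt hc hk
  have h1 : (N.transpose ^ k * A.transpose).trace = (N ^ k * A).trace := by
    rw [← Matrix.transpose_pow, ← Matrix.transpose_mul, Matrix.trace_transpose,
      Matrix.trace_mul_comm]
  have h2 : (N.transpose ^ k * (G * A * G⁻¹)).trace = (N ^ k * A).trace := by
    rw [Matrix.trace_mul_comm, mul_assoc, hik, Matrix.trace_mul_comm, mul_assoc,
      ← mul_assoc G⁻¹, Matrix.nonsing_inv_mul _ hG, one_mul]
  rw [← Matrix.trace_transpose, Matrix.transpose_mul, Matrix.trace_mul_comm, Matrix.transpose_pow,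
    hB', mul_smul_comm, Matrix.trace_smul, mul_add, mul_sub, Matrix.trace_add, Matrix.trace_sub, h0,
    h1, h2, smul_eq_mul]
  ring

end JordanBlock

/-! ### Pointwise consequences of positivity -/

section Hermitian

variable {V : Type*} [AddCommGroup V] [Module ℂ V] [FiniteDimensional ℂ V]

/-- Traces can be computed in a basis which is orthonormal for a positive hermitian form. -/
lemma exists_basis_trace_eq (h : V →ₗ⋆[ℂ] V →ₗ[ℂ] ℂ) (hs : ∀ u v, h v u = conj (h u v))
    (hp : ∀ v, v ≠ 0 → 0 < (h v v).re) :
    ∃ b : Fin (Module.finrank ℂ V) → V, ∀ f : Module.End ℂ V,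
      LinearMap.trace ℂ V f = ∑ i, h (b i) (f (b i)) := by
  let core : InnerProductSpace.Core ℂ V :=
    { inner := fun u v => h u v
      conj_inner_symm := fun u v => (hs v u).symm
      re_inner_nonneg := fun v => by
        rcases eq_or_ne v 0 with rfl | hv
        · simp
        · exact (hp v hv).le
      add_left := fun u v w => by simp
      smul_left := fun u v r => by simp
      definite := fun v hv => by
        by_contra hne
        exact (hp v hne).ne' (by simp [show h v v = 0 from hv]) }
  let _ : NormedAddCommGroup V := core.toNormedAddCommGroup
  let _ : InnerProductSpace ℂ V := InnerProductSpace.ofCore core.toCore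
  refine ⟨stdOrthonormalBasis ℂ V, fun f => ?_⟩
  rw [LinearMap.trace_eq_sum_inner f (stdOrthonormalBasis ℂ V)]
  rfl

/-- The trace of an adjoint is the complex conjugate of the trace. -/
lemma trace_adjoint {h : V →ₗ⋆[ℂ] V →ₗ[ℂ] ℂ} (hs : ∀ u v, h v u = conj (h u v))
    (hp : ∀ v, v ≠ 0 → 0 < (h v v).re) {f f' : Module.End ℂ V}
    (hf : ∀ u v, h (f' u) v = h u (f v)) :
    LinearMap.trace ℂ V f' = conj (LinearMap.trace ℂ V f) := by
  obtain ⟨b, hb⟩ := exists_basis_trace_eq h hs hp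
  rw [hb, hb, map_sum]
  refine Finset.sum_congr rfl fun i _ => ?_
  rw [← hf, ← hs]

lemma trace_adjoint_mul_self_nonneg {h : V →ₗ⋆[ℂ] V →ₗ[ℂ] ℂ} (hs : ∀ u v, h v u = conj (h u v))
    (hp : ∀ v, v ≠ 0 → 0 < (h v v).re) {f f' : Module.End ℂ V}
    (hf : ∀ u v, h (f' u) v = h u (f v)) :
    0 ≤ (LinearMap.trace ℂ V (f' * f)).re := by
  obtain ⟨b, hb⟩ := exists_basis_trace_eq h hs hp
  rw [hb, Complex.re_sum]
  refine Finset.sum_nonneg fun i _ => ?_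
  rw [Module.End.mul_apply, hs, hf, ← hs]
  rcases eq_or_ne (f (b i)) 0 with h0 | h0
  · simp [h0]
  · exact (hp _ h0).le

/-- A skew-hermitian form `β = β₁ dz + β₂ dz̄` with `[Φ ∧ β] = 0` and `β₁ = [Φ₁, ξ]` vanishes if `Φ`
is positive: for `Z = β₂ - [Φ₂, ξ]`, which commutes with `Φ₁`, one finds
`⟨[Φ, ξ], [Φ, ξ]⟩ = - tr (Z* Z) ≤ 0`. -/
lemma eq_zero_of_skew_of_positive {h : V →ₗ⋆[ℂ] V →ₗ[ℂ] ℂ} (hs : ∀ u v, h v u = conj (h u v))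
    (hp : ∀ v, v ≠ 0 → 0 < (h v v).re) {φ₁ φ₂ ξ β₁ β₂ : Module.End ℂ V}
    (hφ : φ₁ * φ₂ = φ₂ * φ₁) (hξ : ⁅φ₁, ξ⁆ = β₁) (hskew : ∀ u v, h (β₁ u) v = -h u (β₂ v))
    (hβ : ⁅β₁, φ₂⁆ = ⁅β₂, φ₁⁆)
    (hpos : ¬ (⁅φ₁, ξ⁆ = 0 ∧ ⁅φ₂, ξ⁆ = 0) →
      ∃ a' b' : Module.End ℂ V, (∀ u v, h (a' u) v = h u (⁅φ₁, ξ⁆ v)) ∧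
        (∀ u v, h (b' u) v = h u (⁅φ₂, ξ⁆ v)) ∧
        0 < (LinearMap.trace ℂ V (a' * ⁅φ₁, ξ⁆) - LinearMap.trace ℂ V (b' * ⁅φ₂, ξ⁆)).re) :
    β₁ = 0 ∧ β₂ = 0 := by
  have nondeg : ∀ x, (∀ v, h x v = 0) → x = 0 := fun x hx => by
    by_contra hne
    exact (hp x hne).ne' (by simp [hx])
  have hskew' : ∀ u v, h (β₂ u) v = -h u (β₁ v) := fun u v => by
    rw [hs, hs _ u, hskew, map_neg, neg_neg]
  have h1 : β₁ = 0 := by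
    by_contra hne
    obtain ⟨a', b', ha, hb, hab⟩ := hpos (fun h0 => hne (hξ ▸ h0.1))
    obtain ⟨Z, hZ⟩ : ∃ Z, Z = β₂ - ⁅φ₂, ξ⁆ := ⟨_, rfl⟩
    have hb2 : ⁅φ₂, ξ⁆ = β₂ - Z := by rw [hZ]; abel
    have hZc : φ₁ * Z = Z * φ₁ := by
      have e : φ₁ * Z - Z * φ₁ = -(⁅β₂, φ₁⁆ - ⁅β₁, φ₂⁆)
          - ((φ₁ * φ₂ - φ₂ * φ₁) * ξ - ξ * (φ₁ * φ₂ - φ₂ * φ₁)) := by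
        rw [hZ, ← hξ]; simp only [Ring.lie_def]; noncomm_ring
      rw [hβ, hφ] at e
      exact sub_eq_zero.1 (by simpa using e)
    have hβZ : LinearMap.trace ℂ V (β₁ * Z) = 0 := by
      rw [← hξ, Ring.lie_def, sub_mul, map_sub, mul_assoc, LinearMap.trace_mul_comm, mul_assoc,
        mul_assoc, hZc, sub_self]
    have ha' : a' = -β₂ := by
      ext u
      refine sub_eq_zero.1 (nondeg _ fun v => ?_)
      rw [map_sub, LinearMap.sub_apply, ha, hξ, LinearMap.neg_apply, map_neg, LinearMap.neg_apply,
        hskew', neg_neg, sub_self]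
    have hZ' : ∀ u v, h ((-β₁ - b') u) v = h u (Z v) := fun u v => by
      rw [LinearMap.sub_apply, map_sub, LinearMap.sub_apply, hb, LinearMap.neg_apply, map_neg,
        LinearMap.neg_apply, hskew, hZ, LinearMap.sub_apply, map_sub, neg_neg]
    have hZβ : LinearMap.trace ℂ V ((-β₁ - b') * β₂) = 0 := by
      have hadj : ∀ u v, h (((-β₁ - b') * β₂) u) v = h u ((-β₁ * Z) v) := fun u v => by
        rw [Module.End.mul_apply, hZ', hskew', Module.End.mul_apply, LinearMap.neg_apply, map_neg]
      rw [trace_adjoint hs hp hadj, neg_mul, map_neg, hβZ]; simp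
    have hnn := trace_adjoint_mul_self_nonneg hs hp hZ'
    have hb' : b' = -β₁ - (-β₁ - b') := by abel
    have key : LinearMap.trace ℂ V (a' * ⁅φ₁, ξ⁆) - LinearMap.trace ℂ V (b' * ⁅φ₂, ξ⁆)
        = -LinearMap.trace ℂ V ((-β₁ - b') * Z) := by
      have e : a' * β₁ - b' * (β₂ - Z)
          = (β₁ * β₂ - β₂ * β₁) + (-β₁ - b') * β₂ - (-β₁ - b') * Z - β₁ * Z := by
        rw [ha']; noncomm_ring
      rw [hξ, hb2, ← map_sub, e, map_sub, map_sub, map_add, map_sub, LinearMap.trace_mul_comm,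
        hZβ, hβZ]
      ring
    rw [key, Complex.neg_re] at hab
    linarith
  refine ⟨h1, ?_⟩
  ext u
  refine nondeg _ fun v => ?_
  rw [hskew', h1]; simp

end Hermitian

/-! ### The Fock field in terms of the higher Beltrami differentials -/

section Polynomials

variable {V : Type*} [AddCommGroup V] [Module ℂ V]

lemma evalPair_eq_sum (a b : Module.End ℂ V) {Q : MvPolynomial (Fin 2) ℂ}
    {T : Finset (Fin 2 →₀ ℕ)} (hT : Q.support ⊆ T) :
    evalPair a b Q = ∑ m ∈ T, Q.coeff m • (a ^ m 0 * b ^ m 1) :=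
  Finset.sum_subset hT fun m _ hm => by
    rw [MvPolynomial.notMem_support_iff.1 hm, zero_smul]

lemma evalPair_add (a b : Module.End ℂ V) (Q Q' : MvPolynomial (Fin 2) ℂ) :
    evalPair a b (Q + Q') = evalPair a b Q + evalPair a b Q' := by
  classical
  rw [evalPair_eq_sum a b (MvPolynomial.support_add (p := Q) (q := Q')),
    evalPair_eq_sum a b (T := Q.support ∪ Q'.support) Finset.subset_union_left,
    evalPair_eq_sum a b (T := Q.support ∪ Q'.support) Finset.subset_union_right,
    ← Finset.sum_add_distrib]
  exact Finset.sum_congr rfl fun m _ => by rw [MvPolynomial.coeff_add, add_smul]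

lemma evalPair_monomial (a b : Module.End ℂ V) (m : Fin 2 →₀ ℕ) (r : ℂ) :
    evalPair a b (MvPolynomial.monomial m r) = r • (a ^ m 0 * b ^ m 1) := by
  rw [evalPair_eq_sum a b MvPolynomial.support_monomial_subset, Finset.sum_singleton,
    MvPolynomial.coeff_monomial, if_pos rfl]

lemma evalPair_sum (a b : Module.End ℂ V) {ι : Type*} (s : Finset ι)
    (Q : ι → MvPolynomial (Fin 2) ℂ) :
    evalPair a b (∑ i ∈ s, Q i) = ∑ i ∈ s, evalPair a b (Q i) :=
  map_sum (AddMonoidHom.mk' (evalPair a b) (evalPair_add a b)) _ _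

lemma evalPair_C_mul_X_pow (a b : Module.End ℂ V) (r : ℂ) (k : ℕ) :
    evalPair a b (MvPolynomial.C r * MvPolynomial.X 0 ^ k) = r • a ^ k := by
  rw [MvPolynomial.C_mul_X_pow_eq_monomial, evalPair_monomial]
  simp

variable {S : Type*} [TopologicalSpace S] [ChartedSpace ℂ S] {n : ℕ}

lemma HigherComplexStructure.X_pow_notMem_ideal (J : HigherComplexStructure S n)
    (c : OpenPartialHomeomorph S ℂ) (z : ℂ) {k : ℕ} (hk : k < n) :
    (MvPolynomial.X 0 : MvPolynomial (Fin 2) ℂ) ^ k ∉ J.ideal c z := by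
  intro h
  -- Substitution of `∑ μ_k p ^ (k - 1)` for `p̄` reduces the claim to `ℂ[p]`.
  let φ : MvPolynomial (Fin 2) ℂ →ₐ[ℂ] Polynomial ℂ :=
    MvPolynomial.aeval ![Polynomial.X, ∑ k ∈ Finset.Icc 2 n, Polynomial.C (J.μ c k z) *
      Polynomial.X ^ (k - 1)]
  have hle : J.ideal c z ≤ (Ideal.span {(Polynomial.X : Polynomial ℂ) ^ n}).comap φ := by
    rw [HigherComplexStructure.ideal, Ideal.span_le]
    rintro Q (rfl | rfl)
    · simp [φ]
    · simp [φ, ← Polynomial.algebraMap_eq]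
  have h1 := hle h
  rw [Ideal.mem_comap, Ideal.mem_span_singleton] at h1
  simp only [φ, map_pow, MvPolynomial.aeval_X, Matrix.cons_val_zero] at h1
  have h2 := (pow_dvd_pow_iff (Polynomial.X_ne_zero (R := ℂ)) Polynomial.not_isUnit_X).1 h1
  omega

variable [IsManifold 𝓘(ℝ, ℂ) ∞ S] {E : S → Type*}
  [TopologicalSpace (Bundle.TotalSpace (Fin n → ℂ) E)]
  [∀ x, AddCommGroup (E x)] [∀ x, Module ℂ (E x)] [∀ x, TopologicalSpace (E x)]
  [FiberBundle (Fin n → ℂ) E] {P : FockBundle n E} {J : HigherComplexStructure S n}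
  {c : OpenPartialHomeomorph S ℂ} {z : ℂ}

lemma FockBundle.Induces.dzCoeff_pow_eq_zero (hJ : P.Induces J) (hc : c ∈ atlas ℂ S)
    (hz : z ∈ c.target) : P.field.dzCoeff c z ^ n = 0 := by
  have h1 := (hJ c hc z hz (MvPolynomial.X 0 ^ n)).1 (Ideal.subset_span (by simp))
  rw [MvPolynomial.X_pow_eq_monomial, evalPair_monomial] at h1
  simpa using h1

lemma FockBundle.Induces.dzCoeff_pow_ne_zero (hJ : P.Induces J) (hc : c ∈ atlas ℂ S)
    (hz : z ∈ c.target) {k : ℕ} (hk : k < n) : P.field.dzCoeff c z ^ k ≠ 0 := by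
  intro h
  refine J.X_pow_notMem_ideal c z hk ((hJ c hc z hz _).2 ?_)
  rw [MvPolynomial.X_pow_eq_monomial, evalPair_monomial]
  simpa using h

lemma FockBundle.Induces.dzbarCoeff_eq (hJ : P.Induces J) (hc : c ∈ atlas ℂ S)
    (hz : z ∈ c.target) :
    P.field.dzbarCoeff c z = ∑ k ∈ Finset.Icc 2 n, J.μ c k z • P.field.dzCoeff c z ^ (k - 1) := by
  have h1 := (hJ c hc z hz _).1 (Ideal.subset_span (Set.mem_insert_of_mem _ rfl))
  have h2 : -(MvPolynomial.X 1 : MvPolynomial (Fin 2) ℂ)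
      = MvPolynomial.monomial (Finsupp.single 1 1) (-1) := by
    rw [← MvPolynomial.C_mul_X_eq_monomial]; simp
  rw [evalPair_add, evalPair_sum, h2, evalPair_monomial] at h1
  simp only [evalPair_C_mul_X_pow] at h1
  rw [neg_one_smul] at h1
  simpa [neg_add_eq_zero] using h1

end Polynomials

/-! ### Extension of local sections and vector fields -/

section Toolbox

variable {S : Type*} [TopologicalSpace S] [ChartedSpace ℂ S] {c : OpenPartialHomeomorph S ℂ}

lemma coordVec_add (z u w : ℂ) : coordVec c z (u + w) = coordVec c z u + coordVec c z w :=
  map_add (mfderiv 𝓘(ℝ, ℂ) 𝓘(ℝ, ℂ) c.symm z) u w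

lemma coordVec_smul (z : ℂ) (r : ℝ) (u : ℂ) : coordVec c z (r • u) = r • coordVec c z u :=
  map_smul (mfderiv 𝓘(ℝ, ℂ) 𝓘(ℝ, ℂ) c.symm z) r u

lemma coordVec_eq (z u : ℂ) :
    coordVec c z u = u.re • coordVec c z 1 + u.im • coordVec c z Complex.I := by
  rw [← coordVec_smul, ← coordVec_smul, ← coordVec_add]
  congr 1
  apply Complex.ext <;> simp

variable [IsManifold 𝓘(ℝ, ℂ) ∞ S]

lemma exists_cutoff [T2Space S] {x₀ : S} {u : Set S} (hu : u ∈ 𝓝 x₀) :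
    ∃ χ : S → ℝ, ContMDiff 𝓘(ℝ, ℂ) 𝓘(ℝ, ℝ) ∞ χ ∧ tsupport χ ⊆ u ∧ ∀ᶠ x in 𝓝 x₀, χ x = 1 := by
  obtain ⟨f, -, hf⟩ := (SmoothBumpFunction.nhds_basis_tsupport (I := 𝓘(ℝ, ℂ)) x₀).mem_iff.1 hu
  exact ⟨f, f.contMDiff, hf, f.eventuallyEq_one⟩

/-- A section which is smooth near a point agrees near this point with a global smooth section. -/
lemma exists_contMDiff_eventually_eq [T2Space S] {F : Type*} [NormedAddCommGroup F]
    [NormedSpace ℝ F] {V : S → Type*} [TopologicalSpace (Bundle.TotalSpace F V)]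
    [∀ x, TopologicalSpace (V x)] [FiberBundle F V] [∀ x, AddCommGroup (V x)]
    [∀ x, Module ℝ (V x)] [VectorBundle ℝ F V] {s : ∀ x, V x} {x₀ : S} {u : Set S} (hu : u ∈ 𝓝 x₀)
    (hs : ContMDiffOn 𝓘(ℝ, ℂ) (𝓘(ℝ, ℂ).prod 𝓘(ℝ, F)) ∞
      (fun x => Bundle.TotalSpace.mk' F x (s x)) u) :
    ∃ s' : ∀ x, V x, ContMDiff 𝓘(ℝ, ℂ) (𝓘(ℝ, ℂ).prod 𝓘(ℝ, F)) ∞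
      (fun x => Bundle.TotalSpace.mk' F x (s' x)) ∧ ∀ᶠ x in 𝓝 x₀, s' x = s x := by
  obtain ⟨χ, hχ, hχu, hχ1⟩ := exists_cutoff (interior_mem_nhds.2 hu)
  refine ⟨χ • s, (hχ.contMDiffOn).smul_section_of_tsupport isOpen_interior hχu
    (hs.mono interior_subset), ?_⟩
  filter_upwards [hχ1] with x hx
  simp [hx]

lemma exists_isSmoothFun_eventually_eq [T2Space S] {f : S → ℂ} {x₀ : S} {u : Set S}
    (hu : u ∈ 𝓝 x₀) (hf : ContMDiffOn 𝓘(ℝ, ℂ) 𝓘(ℝ, ℂ) ∞ f u) :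
    ∃ f' : S → ℂ, IsSmoothFun f' ∧ ∀ᶠ x in 𝓝 x₀, f' x = f x := by
  obtain ⟨χ, hχ, hχu, hχ1⟩ := exists_cutoff (interior_mem_nhds.2 hu)
  refine ⟨χ • f, contMDiff_of_tsupport fun x hx => ?_, ?_⟩
  · have hx' : x ∈ interior u := hχu (closure_mono (Function.support_smul_subset_left χ f) hx)
    exact hχ.contMDiffAt.smul (hf.contMDiffAt (mem_interior_iff_mem_nhds.1 hx'))
  · filter_upwards [hχ1] with x hx
    simp [hx]

/-! ### Coordinate vector fields -/

lemma mdifferentiable_of_mem (hc : c ∈ atlas ℂ S) : c.MDifferentiable 𝓘(ℝ, ℂ) 𝓘(ℝ, ℂ) :=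
  have : IsManifold 𝓘(ℝ, ℂ) 1 S := IsManifold.of_le (n := ∞) (by norm_cast)
  mdifferentiable_of_mem_atlas hc

/-- The coordinates of a tangent vector, inverse to `coordVec`. -/
def vecCoord (c : OpenPartialHomeomorph S ℂ) (z : ℂ) (v : TangentSpace 𝓘(ℝ, ℂ) (c.symm z)) : ℂ :=
  mfderiv 𝓘(ℝ, ℂ) 𝓘(ℝ, ℂ) c (c.symm z) v

lemma coordVec_vecCoord (hc : c ∈ atlas ℂ S) {z : ℂ} (hz : z ∈ c.target)
    (v : TangentSpace 𝓘(ℝ, ℂ) (c.symm z)) : coordVec c z (vecCoord c z v) = v := by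
  have h := (mdifferentiable_of_mem hc).symm_comp_deriv (c.map_target hz)
  have h' := congrArg (fun L => L v) h
  rw [c.right_inv hz] at h'
  exact h'

lemma vecCoord_coordVec (hc : c ∈ atlas ℂ S) {z : ℂ} (hz : z ∈ c.target) (u : ℂ) :
    vecCoord c z (coordVec c z u) = u :=
  congrArg (fun L => L u) ((mdifferentiable_of_mem hc).comp_symm_deriv hz)

lemma contMDiffAt_chart (hc : c ∈ atlas ℂ S) {x : S} (hx : x ∈ c.source) :
    ContMDiffAt 𝓘(ℝ, ℂ) 𝓘(ℝ, ℂ) ∞ c x :=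
  contMDiffAt_of_mem_maximalAtlas (IsManifold.subset_maximalAtlas hc) hx

lemma contMDiffAt_chart_symm (hc : c ∈ atlas ℂ S) {z : ℂ} (hz : z ∈ c.target) :
    ContMDiffAt 𝓘(ℝ, ℂ) 𝓘(ℝ, ℂ) ∞ c.symm z :=
  contMDiffAt_symm_of_mem_maximalAtlas (IsManifold.subset_maximalAtlas hc) hz

lemma inverse_mfderiv_symm (hc : c ∈ atlas ℂ S) {z : ℂ} (hz : z ∈ c.target) :
    (mfderiv 𝓘(ℝ, ℂ) 𝓘(ℝ, ℂ) c.symm z).IsInvertible ∧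
    (mfderiv 𝓘(ℝ, ℂ) 𝓘(ℝ, ℂ) c.symm z).inverse = mfderiv 𝓘(ℝ, ℂ) 𝓘(ℝ, ℂ) c (c.symm z) := by
  have h1 : (mfderiv 𝓘(ℝ, ℂ) 𝓘(ℝ, ℂ) c.symm z).comp (mfderiv 𝓘(ℝ, ℂ) 𝓘(ℝ, ℂ) c (c.symm z)) =
      ContinuousLinearMap.id ℝ _ := by
    ext v; exact coordVec_vecCoord hc hz v
  have h2 : (mfderiv 𝓘(ℝ, ℂ) 𝓘(ℝ, ℂ) c (c.symm z)).comp (mfderiv 𝓘(ℝ, ℂ) 𝓘(ℝ, ℂ) c.symm z) =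
      ContinuousLinearMap.id ℝ _ := (mdifferentiable_of_mem hc).comp_symm_deriv hz
  exact ⟨ContinuousLinearMap.IsInvertible.of_inverse h1 h2, ContinuousLinearMap.inverse_eq h1 h2⟩

/-- Coordinate vector fields extend from a neighbourhood of a point to global smooth fields. -/
lemma exists_field_eq_coordVec [T2Space S] (hc : c ∈ atlas ℂ S) {z : ℂ} (hz : z ∈ c.target)
    (u : ℂ) : ∃ X : ∀ x : S, TangentSpace 𝓘(ℝ, ℂ) x, IsSmoothField X ∧
      ∀ᶠ w in 𝓝 z, X (c.symm w) = coordVec c w u := by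
  have hs : c.source ∈ 𝓝 (c.symm z) := c.open_source.mem_nhds (c.map_target hz)
  have hinv : ∀ x ∈ c.source, (mfderiv 𝓘(ℝ, ℂ) 𝓘(ℝ, ℂ) c x).IsInvertible ∧
      (mfderiv 𝓘(ℝ, ℂ) 𝓘(ℝ, ℂ) c x).inverse = mfderiv 𝓘(ℝ, ℂ) 𝓘(ℝ, ℂ) c.symm (c x) := by
    intro x hx
    have h1 := (mdifferentiable_of_mem hc).symm_comp_deriv hx
    have h2 := (mdifferentiable_of_mem hc).comp_symm_deriv (c.map_source hx)
    rw [c.left_inv hx] at h2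
    exact ⟨ContinuousLinearMap.IsInvertible.of_inverse h2 h1, ContinuousLinearMap.inverse_eq h2 h1⟩
  obtain ⟨X, hX, hXe⟩ := exists_contMDiff_eventually_eq (F := ℂ) (V := TangentSpace 𝓘(ℝ, ℂ)) hs
    (s := VectorField.mpullback 𝓘(ℝ, ℂ) 𝓘(ℝ, ℂ) c
      (fun y => (u : TangentSpace 𝓘(ℝ, ℂ) y))) (by
      intro x hx
      refine ContMDiffAt.contMDiffWithinAt ?_
      refine ContMDiffAt.mpullback_vectorField_preimage (n := ∞) ?_ (contMDiffAt_chart hc hx)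
        (hinv x hx).1 le_rfl
      exact contMDiffAt_vectorSpace_iff_contDiffAt.2 contDiffAt_const)
  refine ⟨X, hX, ?_⟩
  have hcont := (c.continuousAt_symm hz).eventually hXe
  filter_upwards [hcont, c.open_target.mem_nhds hz] with w hw hwt
  rw [hw]
  refine (congrArg (fun L : ℂ →L[ℝ] ℂ => L u) (hinv _ (c.map_target hwt)).2).trans ?_
  exact congrArg (fun y => (mfderiv 𝓘(ℝ, ℂ) 𝓘(ℝ, ℂ) c.symm y : ℂ →L[ℝ] ℂ) u) (c.right_inv hwt)

/-- The coordinate representation of a smooth vector field is smooth. -/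
lemma contDiffAt_vecCoord (hc : c ∈ atlas ℂ S) {z : ℂ} (hz : z ∈ c.target)
    {X : ∀ x : S, TangentSpace 𝓘(ℝ, ℂ) x} (hX : IsSmoothField X) :
    ContDiffAt ℝ ∞ (fun w => vecCoord c w (X (c.symm w))) z := by
  have h1 := ContMDiffAt.mpullback_vectorField_preimage (m := ∞) (n := ∞) (hX (c.symm z))
    (contMDiffAt_chart_symm hc hz) (inverse_mfderiv_symm hc hz).1 le_rfl
  refine (contMDiffAt_vectorSpace_iff_contDiffAt.1 h1).congr_of_eventuallyEq ?_
  filter_upwards [c.open_target.mem_nhds hz] with w hw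
  rw [VectorField.mpullback_apply, (inverse_mfderiv_symm hc hw).2]
  rfl

lemma mlieBracket_eq_coordVec (hc : c ∈ atlas ℂ S) {z : ℂ} (hz : z ∈ c.target)
    {X Y : ∀ x : S, TangentSpace 𝓘(ℝ, ℂ) x} (hX : IsSmoothField X) (hY : IsSmoothField Y) :
    VectorField.mlieBracket 𝓘(ℝ, ℂ) X Y (c.symm z) = coordVec c z
      (fderiv ℝ (fun w => vecCoord c w (Y (c.symm w))) z (vecCoord c z (X (c.symm z)))
        - fderiv ℝ (fun w => vecCoord c w (X (c.symm w))) z (vecCoord c z (Y (c.symm z)))) := by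
  have hmin : minSmoothness ℝ 2 ≤ (∞ : WithTop ℕ∞) := by
    rw [minSmoothness_of_isRCLikeNormedField]; norm_cast
  have : IsManifold 𝓘(ℝ, ℂ) (minSmoothness ℝ 2) S :=
    IsManifold.of_le (n := ∞) hmin
  have h := VectorField.mpullback_mlieBracket (n := ∞) (f := c.symm) (x₀ := z)
    ((hX (c.symm z)).mdifferentiableAt (by simp)) ((hY (c.symm z)).mdifferentiableAt (by simp))
    (contMDiffAt_chart_symm hc hz) hmin
  have e : ∀ X : ∀ x : S, TangentSpace 𝓘(ℝ, ℂ) x,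
      VectorField.mpullback 𝓘(ℝ, ℂ) 𝓘(ℝ, ℂ) c.symm X =ᶠ[𝓝 z]
        fun w => vecCoord c w (X (c.symm w)) := fun X => by
    filter_upwards [c.open_target.mem_nhds hz] with w hw
    rw [VectorField.mpullback_apply, (inverse_mfderiv_symm hc hw).2]
    rfl
  have hL : ∀ V W : ∀ w : ℂ, TangentSpace 𝓘(ℝ, ℂ) w, VectorField.mlieBracket 𝓘(ℝ, ℂ) V W z =
      VectorField.lieBracket ℝ V W z := fun V W => by
    rw [← VectorField.mlieBracketWithin_univ, VectorField.mlieBracketWithin_eq_lieBracketWithin]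
    exact congrFun VectorField.lieBracketWithin_univ z
  have h1 := (e X).mlieBracket_vectorField_eq (e Y)
  have h2 : vecCoord c z (VectorField.mlieBracket 𝓘(ℝ, ℂ) X Y (c.symm z)) =
      VectorField.mpullback 𝓘(ℝ, ℂ) 𝓘(ℝ, ℂ) c.symm (VectorField.mlieBracket 𝓘(ℝ, ℂ) X Y) z :=
    (congrArg (fun L : ℂ →L[ℝ] ℂ => L (VectorField.mlieBracket 𝓘(ℝ, ℂ) X Y (c.symm z)))
      (inverse_mfderiv_symm hc hz).2).symm
  rw [← coordVec_vecCoord hc hz (VectorField.mlieBracket 𝓘(ℝ, ℂ) X Y (c.symm z))]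
  exact congrArg (coordVec c z) (h2.trans (h.trans (h1.trans (hL _ _))))

/-! ### Smooth functions in coordinates -/

lemma IsSmoothFun.contDiffAt_comp_symm {f : S → ℂ} (hf : IsSmoothFun f) (hc : c ∈ atlas ℂ S)
    {z : ℂ} (hz : z ∈ c.target) : ContDiffAt ℝ ∞ (fun w => f (c.symm w)) z :=
  ((hf (c.symm z)).comp z (contMDiffAt_chart_symm hc hz)).contDiffAt

lemma mvfderiv_coordVec {f : S → ℂ} (hf : IsSmoothFun f) (hc : c ∈ atlas ℂ S)
    {z : ℂ} (hz : z ∈ c.target) (u : ℂ) :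
    mvfderiv 𝓘(ℝ, ℂ) f (c.symm z) (coordVec c z u) = fderiv ℝ (fun w => f (c.symm w)) z u := by
  have h := mfderiv_comp z ((hf (c.symm z)).mdifferentiableAt (by simp))
    ((contMDiffAt_chart_symm hc hz).mdifferentiableAt (by simp))
  rw [← mfderiv_eq_fderiv]
  exact (congrArg (fun L => L u) h).symm

lemma isSmoothFun_of_charts {f : S → ℂ} (h : ∀ x : S, ∃ c ∈ atlas ℂ S, x ∈ c.source ∧
    ContDiffAt ℝ ∞ (fun w => f (c.symm w)) (c x)) : IsSmoothFun f := by
  intro x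
  obtain ⟨c, hc, hx, hf⟩ := h x
  refine (ContMDiffAt.comp x (I' := 𝓘(ℝ, ℂ)) hf.contMDiffAt
    (contMDiffAt_chart hc hx)).congr_of_eventuallyEq ?_
  filter_upwards [c.open_source.mem_nhds hx] with y hy
  simp [c.left_inv hy]

lemma isSmoothFun_mvfderiv {f : S → ℂ} (hf : IsSmoothFun f)
    {X : ∀ x : S, TangentSpace 𝓘(ℝ, ℂ) x} (hX : IsSmoothField X) :
    IsSmoothFun (fun x => mvfderiv 𝓘(ℝ, ℂ) f x (X x)) := by
  refine isSmoothFun_of_charts fun x => ⟨chartAt ℂ x, chart_mem_atlas ℂ x, mem_chart_source ℂ x, ?_⟩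
  have hc := chart_mem_atlas ℂ x
  have hz := mem_chart_target ℂ x
  have h1 := (hf.contDiffAt_comp_symm hc hz).fderiv_right (m := ∞) le_rfl
  refine (h1.clm_apply (contDiffAt_vecCoord hc hz hX)).congr_of_eventuallyEq ?_
  filter_upwards [(chartAt ℂ x).open_target.mem_nhds hz] with w hw
  rw [← mvfderiv_coordVec hf hc hw, coordVec_vecCoord hc hw]

/-- The function `z̄`, extended from a neighbourhood of a point. -/
lemma exists_isSmoothFun_conj_coord [T2Space S] (hc : c ∈ atlas ℂ S) {z : ℂ} (hz : z ∈ c.target) :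
    ∃ f : S → ℂ, IsSmoothFun f ∧ ∀ᶠ w in 𝓝 z, ∀ u,
      mvfderiv 𝓘(ℝ, ℂ) f (c.symm w) (coordVec c w u) = conj u := by
  obtain ⟨f, hf, hfe⟩ := exists_isSmoothFun_eventually_eq (f := fun x => conj (c x))
    (c.open_source.mem_nhds (c.map_target hz)) (fun x hx =>
      (ContMDiffAt.comp x (I' := 𝓘(ℝ, ℂ)) Complex.conjCLE.contDiff.contMDiff.contMDiffAt
        (contMDiffAt_chart hc hx)).contMDiffWithinAt)
  refine ⟨f, hf, ?_⟩
  have h1 : ∀ᶠ w in 𝓝 z, f (c.symm w) = conj w := by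
    filter_upwards [(c.continuousAt_symm hz).eventually hfe, c.open_target.mem_nhds hz]
      with w hw hwt
    rw [hw, c.right_inv hwt]
  filter_upwards [h1.eventually_nhds, c.open_target.mem_nhds hz] with w hw hwt u
  rw [mvfderiv_coordVec hf hc hwt, EventuallyEq.fderiv_eq hw]
  exact congrArg (fun L => L u) (Complex.conjCLE : ℂ ≃L[ℝ] ℂ).toContinuousLinearMap.fderiv

end Toolbox

/-! ### Smooth sections -/

section Sections

variable {S : Type*} [TopologicalSpace S] [ChartedSpace ℂ S] [IsManifold 𝓘(ℝ, ℂ) ∞ S]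
  {n : ℕ} {E : S → Type*} [TopologicalSpace (Bundle.TotalSpace (Fin n → ℂ) E)]
  [∀ x, AddCommGroup (E x)] [∀ x, Module ℂ (E x)] [∀ x, TopologicalSpace (E x)]
  [FiberBundle (Fin n → ℂ) E] [VectorBundle ℂ (Fin n → ℂ) E] [VectorBundle ℝ (Fin n → ℂ) E]

lemma IsSmoothFun.mul {f f' : S → ℂ} (hf : IsSmoothFun f) (hf' : IsSmoothFun f') :
    IsSmoothFun (fun x => f x * f' x) :=
  (contDiff_mul (𝕜 := ℝ) (𝔸 := ℂ) (n := ∞)).contMDiff.comp (hf.prodMk_space hf')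

lemma isSmoothFun_const (a : ℂ) : IsSmoothFun (fun _ : S => a) := contMDiff_const

lemma IsSmoothFun.sum {ι : Type*} {s : Finset ι} {f : ι → S → ℂ}
    (hf : ∀ i ∈ s, IsSmoothFun (f i)) : IsSmoothFun (fun x => ∑ i ∈ s, f i x) :=
  contMDiff_finsetSum (I := 𝓘(ℝ, ℂ)) hf

lemma IsSmoothSection.add {s t : ∀ x, E x} (hs : IsSmoothSection n s) (ht : IsSmoothSection n t) :
    IsSmoothSection n (fun x => s x + t x) := ContMDiff.add_section hs ht

lemma IsSmoothSection.sub {s t : ∀ x, E x} (hs : IsSmoothSection n s) (ht : IsSmoothSection n t) :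
    IsSmoothSection n (fun x => s x - t x) := ContMDiff.sub_section hs ht

lemma IsSmoothSection.sum {ι : Type*} {T : Finset ι} {s : ι → ∀ x, E x}
    (hs : ∀ i ∈ T, IsSmoothSection n (s i)) : IsSmoothSection n (fun x => ∑ i ∈ T, s i x) :=
  ContMDiff.sum_section hs

lemma IsSmoothSection.real_smul {f : S → ℝ} (hf : ContMDiff 𝓘(ℝ, ℂ) 𝓘(ℝ, ℝ) ∞ f) {s : ∀ x, E x}
    (hs : IsSmoothSection n s) : IsSmoothSection n (fun x => f x • s x) :=
  ContMDiff.smul_section hf hs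

lemma IsSmoothSection.const_smul (a : ℂ) {s : ∀ x, E x} (hs : IsSmoothSection n s) :
    IsSmoothSection n (fun x => a • s x) := by
  intro x₀
  have h := (Bundle.contMDiffAt_section x₀).1 (hs x₀)
  refine (Bundle.contMDiffAt_section x₀).2 ?_
  have h2 : ContMDiffAt 𝓘(ℝ, ℂ) 𝓘(ℝ, Fin n → ℂ) ∞
      (fun x => a • (trivializationAt (Fin n → ℂ) E x₀ ⟨x, s x⟩).2) x₀ :=
    ContMDiffAt.comp x₀ (I' := 𝓘(ℝ, Fin n → ℂ))
      (g := fun v : Fin n → ℂ => a • v) (contDiff_const_smul a).contMDiff.contMDiffAt h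
  refine h2.congr_of_eventuallyEq ?_
  filter_upwards [(trivializationAt (Fin n → ℂ) E x₀).open_baseSet.mem_nhds
    (FiberBundle.mem_baseSet_trivializationAt' x₀)] with x hx
  exact ((trivializationAt (Fin n → ℂ) E x₀).linear ℂ hx).2 a (s x)

lemma IsSmoothSection.smul {f : S → ℂ} (hf : IsSmoothFun f) {s : ∀ x, E x}
    (hs : IsSmoothSection n s) : IsSmoothSection n (fun x => f x • s x) := by
  have hre : ContMDiff 𝓘(ℝ, ℂ) 𝓘(ℝ, ℝ) ∞ (fun x => (f x).re) :=
    Complex.reCLM.contDiff.contMDiff.comp hf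
  have him : ContMDiff 𝓘(ℝ, ℂ) 𝓘(ℝ, ℝ) ∞ (fun x => (f x).im) :=
    Complex.imCLM.contDiff.contMDiff.comp hf
  have h := (hs.real_smul hre).add ((hs.const_smul Complex.I).real_smul him)
  convert h using 2 with x
  conv_lhs => rw [← Complex.re_add_im (f x)]
  rw [add_smul, mul_smul]
  rfl

lemma exists_isSmoothSection [T2Space S] [ContMDiffVectorBundle ∞ (Fin n → ℂ) E 𝓘(ℝ, ℂ)] {x₀ : S}
    (v : E x₀) : ∃ s : ∀ x, E x, IsSmoothSection n s ∧ s x₀ = v := by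
  obtain ⟨u, hu, hs⟩ := FiberBundle.exists_contMDiffOn_extend (k := ∞) 𝓘(ℝ, ℂ) (Fin n → ℂ) v
  obtain ⟨s, hs, hse⟩ := exists_contMDiff_eventually_eq hu hs
  exact ⟨s, hs, by rw [hse.self_of_nhds, FiberBundle.extend_apply_self]⟩

lemma finrank_fiber (x : S) : Module.finrank ℂ (E x) = n := by
  rw [(VectorBundle.continuousLinearEquivAt ℂ (Fin n → ℂ) E x).toLinearEquiv.finrank_eq]
  simp

end Sections

/-! ### Adapted frames -/

section Frames

lemma linearIndependent_pow_apply {V : Type*} [AddCommGroup V] [Module ℂ V] {n : ℕ}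
    {T : Module.End ℂ V} {v : V} (h0 : (T ^ n) v = 0) (h1 : (T ^ (n - 1)) v ≠ 0) :
    LinearIndependent ℂ (fun j : Fin n => (T ^ (j : ℕ)) v) := by
  rw [Fintype.linearIndependent_iff]
  intro a ha
  have hz : ∀ m, n ≤ m → (T ^ m) v = 0 := fun m hm => by
    rw [← Nat.sub_add_cancel hm, pow_add, Module.End.mul_apply, h0, map_zero]
  -- Apply `T ^ (n - 1 - k)` to isolate the `k`-th coefficient once the previous ones vanish.
  have key : ∀ k : ℕ, ∀ hk : k < n, a ⟨k, hk⟩ = 0 := by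
    intro k
    induction k using Nat.strong_induction_on with
    | _ k ih =>
      intro hk
      have h2 := congrArg (T ^ (n - 1 - k)) ha
      rw [map_sum, map_zero, Finset.sum_eq_single ⟨k, hk⟩] at h2
      · rw [map_smul, ← Module.End.mul_apply, ← pow_add,
          show n - 1 - k + k = n - 1 by omega] at h2
        exact (smul_eq_zero.1 h2).resolve_right h1
      · intro b _ hb
        rcases lt_or_gt_of_ne (fun h => hb (Fin.ext h) : (b : ℕ) ≠ k) with h | h
        · rw [ih b h b.2, zero_smul, map_zero]
        · rw [map_smul, ← Module.End.mul_apply, ← pow_add, hz _ (by omega), smul_zero]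
      · simp
  exact fun i => key i i.2

variable {S : Type*} [TopologicalSpace S] [ChartedSpace ℂ S] [IsManifold 𝓘(ℝ, ℂ) ∞ S]
  {n : ℕ} {E : S → Type*} [TopologicalSpace (Bundle.TotalSpace (Fin n → ℂ) E)]
  [∀ x, AddCommGroup (E x)] [∀ x, Module ℂ (E x)] [∀ x, TopologicalSpace (E x)]
  [FiberBundle (Fin n → ℂ) E]

/-- A frame of `E` over the open subset `W` of the target of the chart `c`, in which `Φ₁` is the
Jordan block. The frame and the coordinate functionals `coord` are globally defined and smooth, but
they are dual to each other only over `W`. -/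
structure AdaptedFrame (P : FockBundle n E) (c : OpenPartialHomeomorph S ℂ) (W : Set ℂ) where
  e : Fin n → ∀ x, E x
  coord : ∀ x, E x →ₗ[ℂ] (Fin n → ℂ)
  smooth_e : ∀ i, IsSmoothSection n (e i)
  smooth_coord : ∀ s : ∀ x, E x, IsSmoothSection n s → ∀ i, IsSmoothFun fun x => coord x (s x) i
  mem_atlas : c ∈ atlas ℂ S
  isOpen : IsOpen W
  subset : W ⊆ c.target
  coord_e : ∀ z ∈ W, ∀ i, coord (c.symm z) (e i (c.symm z)) = Pi.single i 1
  sum_coord : ∀ z ∈ W, ∀ v : E (c.symm z), ∑ i, coord _ v i • e i (c.symm z) = v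
  vol_ne_zero : ∀ z ∈ W, P.vol (c.symm z) (fun i => e i (c.symm z)) ≠ 0
  field_e : ∀ z ∈ W, ∀ j, P.field.dzCoeff c z (e j (c.symm z)) =
    ∑ i, shift n i j • e i (c.symm z)

variable [VectorBundle ℂ (Fin n → ℂ) E] [VectorBundle ℝ (Fin n → ℂ) E]

/-- Cyclic vectors of `Φ₁` generate adapted frames. -/
lemma exists_adaptedFrame [T2Space S] [ContMDiffVectorBundle ∞ (Fin n → ℂ) E 𝓘(ℝ, ℂ)] (hn : 0 < n)
    {P : FockBundle n E} {J : HigherComplexStructure S n} (hJ : P.Induces J)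
    {c : OpenPartialHomeomorph S ℂ} (hc : c ∈ atlas ℂ S) {z₀ : ℂ} (hz₀ : z₀ ∈ c.target) :
    ∃ W : Set ℂ, z₀ ∈ W ∧ Nonempty (AdaptedFrame P c W) := by
  classical
  obtain ⟨X, hX, hXe⟩ := exists_field_eq_coordVec hc hz₀ 1
  obtain ⟨Y, hY, hYe⟩ := exists_field_eq_coordVec hc hz₀ Complex.I
  let T : ∀ x, Module.End ℂ (E x) := fun x =>
    (1 / 2 : ℂ) • (P.field x (X x) - Complex.I • P.field x (Y x))
  have hT : ∀ s : ∀ x, E x, IsSmoothSection n s → IsSmoothSection n (fun x => T x (s x)) :=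
    fun s hs => ((P.field_smooth X s hX hs).sub
      ((P.field_smooth Y s hY hs).const_smul Complex.I)).const_smul (1 / 2)
  have hTΦ : ∀ᶠ z in 𝓝 z₀, T (c.symm z) = P.field.dzCoeff c z := by
    filter_upwards [hXe, hYe] with z h1 h2
    simp only [T, EndForm.dzCoeff, h1, h2]
  obtain ⟨v, hv⟩ : ∃ v, (P.field.dzCoeff c z₀ ^ (n - 1)) v ≠ 0 := by
    by_contra! h
    exact hJ.dzCoeff_pow_ne_zero hc hz₀ (k := n - 1) (by omega) (LinearMap.ext h)
  obtain ⟨s, hs, hsv⟩ := exists_isSmoothSection (n := n) v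
  let e : Fin n → ∀ x, E x := fun j x => (T x ^ (j : ℕ)) (s x)
  have he : ∀ j, IsSmoothSection n (e j) := by
    have : ∀ k : ℕ, IsSmoothSection n (fun x => (T x ^ k) (s x)) := by
      intro k
      induction k with
      | zero => simpa using hs
      | succ k ih => simpa only [pow_succ', Module.End.mul_apply] using hT _ ih
    exact fun j => this j
  let d : S → ℂ := fun x => P.vol x (fun i => e i x)
  have hd : IsSmoothFun d := P.vol_smooth e he
  have basis_of : ∀ x, LinearIndependent ℂ (fun j => e j x) →
      ∃ b : Module.Basis (Fin n) ℂ (E x), ∀ j, b j = e j x := fun x hx => by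
    have : Nonempty (Fin n) := ⟨⟨0, hn⟩⟩
    exact ⟨basisOfLinearIndependentOfCardEqFinrank hx
      ((Fintype.card_fin n).trans (finrank_fiber x).symm),
      fun j => by simp⟩
  have hd0 : d (c.symm z₀) ≠ 0 := by
    obtain ⟨b, hb⟩ := basis_of (c.symm z₀) (by
      refine linearIndependent_pow_apply ?_ ?_
      · rw [hTΦ.self_of_nhds, hJ.dzCoeff_pow_eq_zero hc hz₀]; rfl
      · rw [hTΦ.self_of_nhds, hsv]; exact hv)
    have := ((P.vol (c.symm z₀)).map_basis_ne_zero_iff b).2 (P.vol_ne_zero _)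
    rwa [show ⇑b = fun i => e i (c.symm z₀) from funext hb] at this
  have hopen : {x | d x ≠ 0} ∈ 𝓝 (c.symm z₀) :=
    hd.continuous.continuousAt.eventually_ne hd0
  obtain ⟨ψ, hψ, hψe⟩ := exists_isSmoothFun_eventually_eq (f := fun x => (d x)⁻¹) hopen
    (fun x hx => (ContMDiffAt.comp x (I' := 𝓘(ℝ, ℂ)) (contDiffAt_inv ℝ hx).contMDiffAt
      (hd x)).contMDiffWithinAt)
  have hcont := c.continuousAt_symm hz₀
  have hgood := (hcont.eventually hψe).and ((hcont.eventually hopen).and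
    (hTΦ.and (c.open_target.mem_nhds hz₀)))
  obtain ⟨W, hW, hWo, hzW⟩ := eventually_nhds_iff.1 hgood
  have hce : ∀ z ∈ W, ∀ i j, ψ (c.symm z) * P.vol (c.symm z) (Function.update
      (fun k => e k (c.symm z)) j (e i (c.symm z))) = (Pi.single i 1 : Fin n → ℂ) j := by
    intro z hz i j
    obtain ⟨h1, h2, -, -⟩ := hW z hz
    have h2' : d (c.symm z) ≠ 0 := h2
    rcases eq_or_ne i j with rfl | hij
    · rw [Function.update_eq_self, h1, Pi.single_eq_same]
      exact inv_mul_cancel₀ h2'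
    · rw [(P.vol (c.symm z)).map_update_self _ hij.symm, mul_zero, Pi.single_eq_of_ne hij.symm]
  have hbasis : ∀ z ∈ W, ∃ b : Module.Basis (Fin n) ℂ (E (c.symm z)),
      ∀ j, b j = e j (c.symm z) := fun z hz => basis_of _ (by
    by_contra hli
    exact (hW z hz).2.1 ((P.vol (c.symm z)).map_linearDependent _ hli))
  have hcoord : ∀ z ∈ W, ∀ i, (fun j => ψ (c.symm z) * P.vol (c.symm z) (Function.update
      (fun k => e k (c.symm z)) j (e i (c.symm z)))) = (Pi.single i 1 : Fin n → ℂ) :=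
    fun z hz i => funext (hce z hz i)
  refine ⟨W, hzW, ⟨⟨e, fun x => LinearMap.pi fun i => ψ x •
    (P.vol x).toMultilinearMap.toLinearMap (fun k => e k x) i, he, ?_, hc, hWo, fun z hz =>
    (hW z hz).2.2.2, hcoord, ?_, fun z hz => (hW z hz).2.1, ?_⟩⟩⟩
  · intro t ht i
    refine hψ.mul (P.vol_smooth (fun k => Function.update e i t k) ?_) |>.congr ?_
    · intro k
      rcases eq_or_ne k i with rfl | hk
      · simpa using ht
      · simpa [Function.update_of_ne hk] using he k
    · intro x
      refine congrArg (fun w => ψ x * P.vol x w) (funext fun k => ?_)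
      rcases eq_or_ne k i with rfl | hk
      · simp
      · simp [Function.update_of_ne hk]
  · intro z hz v
    obtain ⟨b, hb⟩ := hbasis z hz
    have hlin : (∑ i, ((LinearMap.proj i).comp (LinearMap.pi fun i => ψ (c.symm z) •
        (P.vol (c.symm z)).toMultilinearMap.toLinearMap (fun k => e k (c.symm z)) i)).smulRight
          (e i (c.symm z))) = LinearMap.id := by
      refine b.ext fun j => ?_
      rw [hb, LinearMap.sum_apply]
      simp only [LinearMap.smulRight_apply, LinearMap.comp_apply]
      have := hcoord z hz j
      refine (Finset.sum_congr rfl fun i _ => congrArg (· • e i (c.symm z))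
        (congrFun this i)).trans ?_
      simp [Pi.single_apply]
    have := LinearMap.congr_fun hlin v
    rw [LinearMap.sum_apply] at this
    exact this
  · intro z hz j
    obtain ⟨-, -, h3, h4⟩ := hW z hz
    rw [← h3]
    have e1 : T (c.symm z) (e j (c.symm z)) = (T (c.symm z) ^ ((j : ℕ) + 1)) (s (c.symm z)) := by
      rw [pow_succ']; rfl
    rw [e1]
    by_cases hj : (j : ℕ) + 1 < n
    · rw [Finset.sum_eq_single ⟨j + 1, hj⟩]
      · simp [shift, e]
      · intro b _ hb
        rw [shift, if_neg (fun h => hb (Fin.ext h)), zero_smul]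
      · simp
    · rw [Finset.sum_eq_zero]
      · rw [show (j : ℕ) + 1 = n by omega, h3, hJ.dzCoeff_pow_eq_zero hc h4]; rfl
      · intro b _
        rw [shift, if_neg (by omega), zero_smul]

end Frames

/-! ### Calculus rules for connections -/

section ConnectionRules

variable {S : Type*} [TopologicalSpace S] [ChartedSpace ℂ S] [IsManifold 𝓘(ℝ, ℂ) ∞ S]
  {n : ℕ} {E : S → Type*} [TopologicalSpace (Bundle.TotalSpace (Fin n → ℂ) E)]
  [∀ x, AddCommGroup (E x)] [∀ x, Module ℂ (E x)] [∀ x, TopologicalSpace (E x)]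
  [∀ x, IsTopologicalAddGroup (E x)] [∀ x, ContinuousSMul ℝ (E x)]
  [FiberBundle (Fin n → ℂ) E] [VectorBundle ℂ (Fin n → ℂ) E] [VectorBundle ℝ (Fin n → ℂ) E]
  {P : FockBundle n E}

lemma mvfderiv_clm_comp {f : S → ℂ} (hf : IsSmoothFun f) (L : ℂ →L[ℝ] ℝ)
    (x : S) (v : TangentSpace 𝓘(ℝ, ℂ) x) :
    mvfderiv 𝓘(ℝ, ℂ) (fun y => L (f y)) x v = L (mvfderiv 𝓘(ℝ, ℂ) f x v) := by
  have h := mfderiv_comp x (g := L) (f := f) (I := 𝓘(ℝ, ℂ)) (I' := 𝓘(ℝ, ℂ)) (I'' := 𝓘(ℝ, ℝ))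
    ((L.contMDiff (n := ∞)).mdifferentiableAt (by simp)) ((hf x).mdifferentiableAt (by simp))
  have h2 : mfderiv 𝓘(ℝ, ℂ) 𝓘(ℝ, ℝ) L (f x) = L := by
    rw [mfderiv_eq_fderiv]; exact L.fderiv
  exact (congrArg (fun L' => L' v) h).trans (congrArg (fun L' : ℂ →L[ℝ] ℝ =>
    L' (mvfderiv 𝓘(ℝ, ℂ) f x v)) h2)

namespace SLConnection

variable (A : SLConnection P)

lemma cov_congr {s t : ∀ x, E x} (hs : IsSmoothSection n s) (ht : IsSmoothSection n t) {x : S}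
    (h : ∀ᶠ y in 𝓝 x, s y = t y) : A.cov s x = A.cov t x :=
  A.cov.isCovariantDerivativeOnUniv.congr_of_eventuallyEq ((hs x).mdifferentiableAt (by simp))
    ((ht x).mdifferentiableAt (by simp)) univ_mem h

lemma cov_add {s t : ∀ x, E x} (hs : IsSmoothSection n s) (ht : IsSmoothSection n t) (x : S) :
    A.cov (fun y => s y + t y) x = A.cov s x + A.cov t x :=
  A.cov.isCovariantDerivativeOnUniv.add ((hs x).mdifferentiableAt (by simp))
    ((ht x).mdifferentiableAt (by simp))

lemma cov_real_smul {f : S → ℝ} (hf : ContMDiff 𝓘(ℝ, ℂ) 𝓘(ℝ, ℝ) ∞ f) {s : ∀ x, E x}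
    (hs : IsSmoothSection n s) (x : S) (v : TangentSpace 𝓘(ℝ, ℂ) x) :
    A.cov (fun y => f y • s y) x v = f x • A.cov s x v + mvfderiv 𝓘(ℝ, ℂ) f x v • s x :=
  congrArg (fun L => L v)
    (A.cov.isCovariantDerivativeOnUniv.leibniz (g := f) ((hs x).mdifferentiableAt (by simp))
      ((hf x).mdifferentiableAt (by simp)))

/-- The Leibniz rule for complex-valued functions follows from the real one and complex
linearity. -/
lemma cov_smul {f : S → ℂ} (hf : IsSmoothFun f) {s : ∀ x, E x}
    (hs : IsSmoothSection n s) (x : S) (v : TangentSpace 𝓘(ℝ, ℂ) x) :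
    A.cov (fun y => f y • s y) x v = f x • A.cov s x v + mvfderiv 𝓘(ℝ, ℂ) f x v • s x := by
  have hre : ContMDiff 𝓘(ℝ, ℂ) 𝓘(ℝ, ℝ) ∞ (fun x => (f x).re) :=
    Complex.reCLM.contDiff.contMDiff.comp hf
  have him : ContMDiff 𝓘(ℝ, ℂ) 𝓘(ℝ, ℝ) ∞ (fun x => (f x).im) :=
    Complex.imCLM.contDiff.contMDiff.comp hf
  have key : ∀ (z : ℂ) (y : S) (w : E y), z • w = z.re • w + z.im • Complex.I • w := by
    intro z y w
    conv_lhs => rw [← Complex.re_add_im z]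
    rw [add_smul, mul_smul]
    rfl
  have e : (fun y => f y • s y) = fun y => (f y).re • s y + (f y).im • Complex.I • s y :=
    funext fun y => key _ _ _
  have hre' := mvfderiv_clm_comp hf Complex.reCLM x v
  have him' := mvfderiv_clm_comp hf Complex.imCLM x v
  simp only [Complex.reCLM_apply, Complex.imCLM_apply] at hre' him'
  rw [e, A.cov_add (hs.real_smul hre) ((hs.const_smul Complex.I).real_smul him),
    add_apply, A.cov_real_smul hre hs, A.cov_real_smul him (hs.const_smul Complex.I),
    A.map_smul _ _ hs, hre', him', key (f x), key (mvfderiv 𝓘(ℝ, ℂ) f x v)]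
  abel

lemma cov_sum {ι : Type*} {T : Finset ι} {s : ι → ∀ x, E x} (hs : ∀ i, IsSmoothSection n (s i))
    (x : S) : A.cov (fun y => ∑ i ∈ T, s i y) x = ∑ i ∈ T, A.cov (s i) x := by
  classical
  induction T using Finset.induction_on with
  | empty =>
    simp only [Finset.sum_empty]
    exact congrFun A.cov.zero x
  | insert i T hi ih =>
    simp only [Finset.sum_insert hi]
    rw [A.cov_add (hs i) (IsSmoothSection.sum fun i _ => hs i), ih]

end SLConnection

end ConnectionRules

/-! ### Matrices in an adapted frame -/

/-- The matrix `∑ μ_m N ^ (m - 1)`, with `N` the Jordan block, of `Φ₂` in an adapted frame. -/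
def beltrami {S : Type*} [TopologicalSpace S] [ChartedSpace ℂ S] {n : ℕ}
    (J : HigherComplexStructure S n) (c : OpenPartialHomeomorph S ℂ) (z : ℂ) :
    Matrix (Fin n) (Fin n) ℂ :=
  ∑ m ∈ Finset.Icc 2 n, J.μ c m z • shift n ^ (m - 1)

namespace AdaptedFrame

section Matrices

variable {S : Type*} [TopologicalSpace S] [ChartedSpace ℂ S] [IsManifold 𝓘(ℝ, ℂ) ∞ S]
  {n : ℕ} {E : S → Type*} [TopologicalSpace (Bundle.TotalSpace (Fin n → ℂ) E)]
  [∀ x, AddCommGroup (E x)] [∀ x, Module ℂ (E x)] [∀ x, TopologicalSpace (E x)]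
  [FiberBundle (Fin n → ℂ) E] {P : FockBundle n E} {c : OpenPartialHomeomorph S ℂ} {W : Set ℂ}
  (F : AdaptedFrame P c W) {z : ℂ}

/-- The frame as a basis of a fibre over `W`. -/
def basis (hz : z ∈ W) : Module.Basis (Fin n) ℂ (E (c.symm z)) :=
  .ofEquivFun
    { F.coord (c.symm z) with
      invFun := fun a => ∑ i, a i • F.e i (c.symm z)
      left_inv := fun v => F.sum_coord z hz v
      right_inv := fun a => by
        change F.coord (c.symm z) (∑ i, a i • F.e i (c.symm z)) = a
        rw [map_sum]
        simp_rw [map_smul, F.coord_e z hz]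
        ext j
        simp [Finset.sum_apply, Pi.single_apply] }

lemma basis_apply (hz : z ∈ W) (i : Fin n) : F.basis hz i = F.e i (c.symm z) := by
  simp [basis, Module.Basis.coe_ofEquivFun, Pi.single_apply]

lemma basis_repr (hz : z ∈ W) (v : E (c.symm z)) (i : Fin n) :
    (F.basis hz).repr v i = F.coord _ v i := rfl

/-- The matrix of an endomorphism of the fibre over `z` with respect to the frame. -/
def mat (z : ℂ) (T : Module.End ℂ (E (c.symm z))) : Matrix (Fin n) (Fin n) ℂ :=
  fun i j => F.coord _ (T (F.e j _)) i

lemma mat_eq_toMatrix (hz : z ∈ W) (T : Module.End ℂ (E (c.symm z))) :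
    F.mat z T = LinearMap.toMatrix (F.basis hz) (F.basis hz) T := by
  ext i j
  rw [LinearMap.toMatrix_apply, F.basis_repr, F.basis_apply]
  rfl

lemma coord_apply (hz : z ∈ W) (T : Module.End ℂ (E (c.symm z))) (v : E (c.symm z)) (i : Fin n) :
    F.coord _ (T v) i = ∑ j, F.mat z T i j * F.coord _ v j := by
  conv_lhs => rw [← F.sum_coord z hz v]
  simp [mat, mul_comm]

lemma coord_injective (hz : z ∈ W) {v w : E (c.symm z)} (h : F.coord _ v = F.coord _ w) :
    v = w := by
  rw [← F.sum_coord z hz v, h, F.sum_coord z hz]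

lemma mat_injective (hz : z ∈ W) {T T' : Module.End ℂ (E (c.symm z))}
    (h : F.mat z T = F.mat z T') : T = T' := by
  rw [F.mat_eq_toMatrix hz, F.mat_eq_toMatrix hz] at h
  exact (LinearMap.toMatrix (F.basis hz) (F.basis hz)).injective h

/-- The endomorphism of a fibre with a given matrix. It is defined for all fibres, but `M` is its
matrix only over `W`. -/
def ofMat (x : S) (M : Matrix (Fin n) (Fin n) ℂ) : Module.End ℂ (E x) :=
  ∑ i, ((LinearMap.proj i).comp ((Matrix.mulVecLin M).comp (F.coord _))).smulRight (F.e i _)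

lemma ofMat_apply (x : S) (M : Matrix (Fin n) (Fin n) ℂ) (v : E x) :
    F.ofMat x M v = ∑ i, (∑ j, M i j * F.coord _ v j) • F.e i _ := by
  simp [ofMat, Matrix.mulVec, dotProduct]

lemma coord_sum (hz : z ∈ W) (a : Fin n → ℂ) : F.coord _ (∑ i, a i • F.e i (c.symm z)) = a := by
  rw [map_sum]
  simp_rw [map_smul, F.coord_e z hz]
  ext j
  simp [Finset.sum_apply, Pi.single_apply]

lemma mat_ofMat (hz : z ∈ W) (M : Matrix (Fin n) (Fin n) ℂ) : F.mat z (F.ofMat _ M) = M := by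
  ext i j
  rw [mat, F.ofMat_apply, F.coord_sum hz, F.coord_e z hz]
  simp [Pi.single_apply]

lemma mat_add (T T' : Module.End ℂ (E (c.symm z))) : F.mat z (T + T') = F.mat z T + F.mat z T' := by
  ext i j; simp [mat]

lemma mat_sub (T T' : Module.End ℂ (E (c.symm z))) : F.mat z (T - T') = F.mat z T - F.mat z T' := by
  ext i j; simp [mat]

lemma mat_smul (a : ℂ) (T : Module.End ℂ (E (c.symm z))) : F.mat z (a • T) = a • F.mat z T := by
  ext i j; simp [mat]

lemma mat_sum {ι : Type*} (s : Finset ι) (T : ι → Module.End ℂ (E (c.symm z))) :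
    F.mat z (∑ k ∈ s, T k) = ∑ k ∈ s, F.mat z (T k) := by
  ext i j; simp [mat, Matrix.sum_apply]

lemma mat_mul (hz : z ∈ W) (T T' : Module.End ℂ (E (c.symm z))) :
    F.mat z (T * T') = F.mat z T * F.mat z T' := by
  simp only [F.mat_eq_toMatrix hz]; exact LinearMap.toMatrix_mul _ _ _

lemma mat_pow (hz : z ∈ W) (T : Module.End ℂ (E (c.symm z))) (k : ℕ) :
    F.mat z (T ^ k) = F.mat z T ^ k := by
  induction k with
  | zero => rw [pow_zero, pow_zero, F.mat_eq_toMatrix hz, LinearMap.toMatrix_one]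
  | succ k ih => rw [pow_succ, pow_succ, F.mat_mul hz, ih]

lemma mat_lie (hz : z ∈ W) (T T' : Module.End ℂ (E (c.symm z))) :
    F.mat z ⁅T, T'⁆ = F.mat z T * F.mat z T' - F.mat z T' * F.mat z T := by
  rw [Ring.lie_def, F.mat_sub, F.mat_mul hz, F.mat_mul hz]

lemma trace_mat (hz : z ∈ W) (T : Module.End ℂ (E (c.symm z))) :
    (F.mat z T).trace = LinearMap.trace ℂ _ T := by
  rw [F.mat_eq_toMatrix hz, LinearMap.trace_eq_matrix_trace ℂ (F.basis hz)]

lemma mat_dzCoeff (hz : z ∈ W) : F.mat z (P.field.dzCoeff c z) = shift n := by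
  ext i j
  rw [mat, F.field_e z hz, F.coord_sum hz]

lemma mat_dzbarCoeff {J : HigherComplexStructure S n} (hJ : P.Induces J) (hz : z ∈ W) :
    F.mat z (P.field.dzbarCoeff c z) = beltrami J c z := by
  rw [hJ.dzbarCoeff_eq F.mem_atlas (F.subset hz), F.mat_sum]
  simp only [F.mat_smul, F.mat_pow hz, F.mat_dzCoeff hz, beltrami]

end Matrices

end AdaptedFrame

/-! ### The connection form in an adapted frame -/

namespace AdaptedFrame

section ConnectionMatrix

variable {S : Type*} [TopologicalSpace S] [T2Space S] [ChartedSpace ℂ S] [IsManifold 𝓘(ℝ, ℂ) ∞ S]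
  {n : ℕ} {E : S → Type*} [TopologicalSpace (Bundle.TotalSpace (Fin n → ℂ) E)]
  [∀ x, AddCommGroup (E x)] [∀ x, Module ℂ (E x)] [∀ x, TopologicalSpace (E x)]
  [∀ x, IsTopologicalAddGroup (E x)] [∀ x, ContinuousSMul ℝ (E x)]
  [FiberBundle (Fin n → ℂ) E] [VectorBundle ℂ (Fin n → ℂ) E] [VectorBundle ℝ (Fin n → ℂ) E]
  {P : FockBundle n E} {c : OpenPartialHomeomorph S ℂ} {W : Set ℂ}
  (F : AdaptedFrame P c W) (A : SLConnection P) {z : ℂ}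

/-- The connection form of `A` in the frame, as a matrix of real-linear forms on `ℂ`. -/
def conn (w : ℂ) (i j : Fin n) : ℂ →L[ℝ] ℂ :=
  Complex.reCLM.smulRight (F.coord _ (A.cov (F.e j) (c.symm w) (coordVec c w 1)) i) +
    Complex.imCLM.smulRight (F.coord _ (A.cov (F.e j) (c.symm w) (coordVec c w Complex.I)) i)

lemma coord_real_smul (x : S) (r : ℝ) (v : E x) : F.coord x (r • v) = r • F.coord x v :=
  (F.coord x).map_smul (r : ℂ) v

lemma conn_apply (w u : ℂ) (i j : Fin n) :
    F.conn A w i j u = F.coord _ (A.cov (F.e j) (c.symm w) (coordVec c w u)) i := by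
  have h : A.cov (F.e j) (c.symm w) (coordVec c w u) =
      u.re • A.cov (F.e j) (c.symm w) (coordVec c w 1) +
        u.im • A.cov (F.e j) (c.symm w) (coordVec c w Complex.I) :=
    (congrArg (A.cov (F.e j) (c.symm w)) (coordVec_eq w u)).trans
      ((map_add _ _ _).trans (congrArg₂ (· + ·) (map_smul _ _ _) (map_smul _ _ _)))
  rw [h, map_add, F.coord_real_smul, F.coord_real_smul]
  rfl

lemma isSmoothFun_conn {X : ∀ x : S, TangentSpace 𝓘(ℝ, ℂ) x} (hX : IsSmoothField X)
    (i j : Fin n) : IsSmoothFun (fun x => F.coord x (A.cov (F.e j) x (X x)) i) :=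
  F.smooth_coord _ (A.smooth X _ hX (F.smooth_e j)) i

lemma contDiffAt_conn_apply (hz : z ∈ W) (i j : Fin n) (u : ℂ) :
    ContDiffAt ℝ ∞ (fun w => F.conn A w i j u) z := by
  obtain ⟨X, hX, hXe⟩ := exists_field_eq_coordVec F.mem_atlas (F.subset hz) u
  refine ((F.isSmoothFun_conn A hX i j).contDiffAt_comp_symm F.mem_atlas
    (F.subset hz)).congr_of_eventuallyEq ?_
  filter_upwards [hXe] with w hw
  rw [F.conn_apply, hw]

lemma contDiffAt_conn (hz : z ∈ W) (i j : Fin n) :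
    ContDiffAt ℝ ∞ (fun w => F.conn A w i j) z := by
  have key : ∀ (l : ℂ →L[ℝ] ℝ) (u : ℂ),
      ContDiffAt ℝ ∞ (fun w => l.smulRight (F.conn A w i j u)) z := fun l u =>
    (ContinuousLinearMap.smulRightL ℝ ℂ ℂ l).contDiff.contDiffAt.comp z
      (F.contDiffAt_conn_apply A hz i j u)
  refine ((key Complex.reCLM 1).add (key Complex.imCLM Complex.I)).congr_of_eventuallyEq ?_
  refine Eventually.of_forall fun w => ?_
  simp only [F.conn_apply]
  rfl

lemma eventually_mem (F : AdaptedFrame P c W) (hz : z ∈ W) :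
    ∀ᶠ x in 𝓝 (c.symm z), x ∈ c.source ∧ c x ∈ W := by
  have hzt := F.subset hz
  have h1 : ∀ᶠ x in 𝓝 (c.symm z), x ∈ c.source := c.open_source.mem_nhds (c.map_target hzt)
  refine h1.and ((c.continuousAt (c.map_target hzt)).eventually ?_)
  rw [c.right_inv hzt]
  exact F.isOpen.mem_nhds hz

lemma sum_coord_of_mem {x : S} (hx : x ∈ c.source) (hxW : c x ∈ W) (v : E x) :
    ∑ i, F.coord x v i • F.e i x = v := by
  have h := F.sum_coord (c x) hxW
  rw [c.left_inv hx] at h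
  exact h v

/-- A section in the coordinates of the frame. -/
def rep (s : ∀ x, E x) (i : Fin n) (w : ℂ) : ℂ := F.coord (c.symm w) (s (c.symm w)) i

lemma contDiffAt_rep (hz : z ∈ W) {s : ∀ x, E x} (hs : IsSmoothSection n s) (i : Fin n) :
    ContDiffAt ℝ ∞ (F.rep s i) z :=
  (F.smooth_coord s hs i).contDiffAt_comp_symm F.mem_atlas (F.subset hz)

/-- In the frame, `∇ = d + A` with `A` the connection form. -/
lemma coord_cov (hz : z ∈ W) {s : ∀ x, E x} (hs : IsSmoothSection n s) (u : ℂ) (i : Fin n) :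
    F.coord _ (A.cov s (c.symm z) (coordVec c z u)) i =
      fderiv ℝ (F.rep s i) z u + ∑ j, F.conn A z i j u * F.rep s j z := by
  have hf : ∀ j, IsSmoothFun (fun x => F.coord x (s x) j) := F.smooth_coord s hs
  have hsm : ∀ j, IsSmoothSection n (fun x => F.coord x (s x) j • F.e j x) :=
    fun j => (F.smooth_e j).smul (hf j)
  have h1 : A.cov s (c.symm z) = A.cov (fun x => ∑ j, F.coord x (s x) j • F.e j x) (c.symm z) := by
    refine A.cov_congr hs (IsSmoothSection.sum fun j _ => hsm j) ?_
    filter_upwards [F.eventually_mem hz] with x hx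
    exact (F.sum_coord_of_mem hx.1 hx.2 _).symm
  rw [h1, A.cov_sum hsm, sum_apply, map_sum, Finset.sum_apply]
  have h2 : ∀ j, F.coord _ (A.cov (fun x => F.coord x (s x) j • F.e j x) (c.symm z)
      (coordVec c z u)) i =
      F.conn A z i j u * F.rep s j z +
        fderiv ℝ (F.rep s j) z u * (Pi.single j 1 : Fin n → ℂ) i := by
    intro j
    rw [A.cov_smul (hf j) (F.smooth_e j), mvfderiv_coordVec (hf j) F.mem_atlas (F.subset hz),
      map_add, _root_.map_smul, _root_.map_smul, F.coord_e z hz, Pi.add_apply, Pi.smul_apply,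
      Pi.smul_apply, ← F.conn_apply, smul_eq_mul, smul_eq_mul, mul_comm (F.conn A z i j u)]
    rfl
  rw [Finset.sum_congr rfl fun j _ => h2 j, Finset.sum_add_distrib, add_comm]
  simp [Pi.single_apply]

/-- The matrix of the connection form in the direction `u`. -/
def connMat (w u : ℂ) : Matrix (Fin n) (Fin n) ℂ := fun i j => F.conn A w i j u

/-- The `dz`-coefficient of the connection form. -/
def connDz (w : ℂ) : Matrix (Fin n) (Fin n) ℂ :=
  (1 / 2 : ℂ) • (F.connMat A w 1 - Complex.I • F.connMat A w Complex.I)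

/-- The `dz̄`-coefficient of the connection form. -/
def connDzbar (w : ℂ) : Matrix (Fin n) (Fin n) ℂ :=
  (1 / 2 : ℂ) • (F.connMat A w 1 + Complex.I • F.connMat A w Complex.I)


end ConnectionMatrix

end AdaptedFrame

/-! ### Curvature of a connection on a plane domain -/

section Calculus

/-- The curvature `∇_p ∇_q f - ∇_q ∇_p f - ∇_[p, q] f` of the connection `∇ = d + G` on a trivial
bundle over a plane domain, for two vector fields `p`, `q`: all derivatives of `f` cancel. -/
lemma curvature_calculus {ι : Type*} [Fintype ι] {f : ι → ℂ → ℂ} {G : ι → ι → ℂ → (ℂ →L[ℝ] ℂ)}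
    {p q : ℂ → ℂ} {z : ℂ} (hf : ∀ i, ContDiffAt ℝ ∞ (f i) z)
    (hG : ∀ i j, ContDiffAt ℝ ∞ (G i j) z) (hp : ContDiffAt ℝ ∞ p z) (hq : ContDiffAt ℝ ∞ q z)
    (i : ι) :
    (fderiv ℝ (fun w => fderiv ℝ (f i) w (q w) + ∑ j, G i j w (q w) * f j w) z (p z)
        + ∑ j, G i j z (p z) * (fderiv ℝ (f j) z (q z) + ∑ k, G j k z (q z) * f k z))
      - (fderiv ℝ (fun w => fderiv ℝ (f i) w (p w) + ∑ j, G i j w (p w) * f j w) z (q z)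
        + ∑ j, G i j z (q z) * (fderiv ℝ (f j) z (p z) + ∑ k, G j k z (p z) * f k z))
      - (fderiv ℝ (f i) z (fderiv ℝ q z (p z) - fderiv ℝ p z (q z))
        + ∑ j, G i j z (fderiv ℝ q z (p z) - fderiv ℝ p z (q z)) * f j z) =
    ∑ j, (fderiv ℝ (G i j) z (p z) (q z) - fderiv ℝ (G i j) z (q z) (p z)
      + ∑ k, (G i k z (p z) * G k j z (q z) - G i k z (q z) * G k j z (p z))) * f j z := by
  have hd : ∀ (p q : ℂ → ℂ), ContDiffAt ℝ ∞ p z → ContDiffAt ℝ ∞ q z →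
      fderiv ℝ (fun w => fderiv ℝ (f i) w (q w) + ∑ j, G i j w (q w) * f j w) z (p z) =
        (fderiv ℝ (fderiv ℝ (f i)) z (p z) (q z) + fderiv ℝ (f i) z (fderiv ℝ q z (p z)))
        + ∑ j, (G i j z (q z) * fderiv ℝ (f j) z (p z)
          + (fderiv ℝ (G i j) z (p z) (q z) + G i j z (fderiv ℝ q z (p z))) * f j z) := by
    intro p q hp hq
    have hq' := (hq.differentiableAt (by simp)).hasFDerivAt
    have h1 : HasFDerivAt (fderiv ℝ (f i)) (fderiv ℝ (fderiv ℝ (f i)) z) z :=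
      (((hf i).fderiv_right (m := ∞) le_rfl).differentiableAt (by simp)).hasFDerivAt
    have h2 := fun j => ((hG i j).differentiableAt (by simp)).hasFDerivAt
    have h3 := fun j => ((hf j).differentiableAt (by simp)).hasFDerivAt
    have h4 := (h1.clm_apply hq').add
      (HasFDerivAt.fun_sum fun j (_ : j ∈ Finset.univ) => ((h2 j).clm_apply hq').mul (h3 j))
    refine (congrArg (fun L => L (p z)) h4.fderiv).trans ?_
    simp only [add_apply, sum_apply, smul_apply, smul_eq_mul, ContinuousLinearMap.comp_apply,
      ContinuousLinearMap.flip_apply]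
    congr 1
    · ring
    · exact Finset.sum_congr rfl fun j _ => by ring
  have hsymm : fderiv ℝ (fderiv ℝ (f i)) z (p z) (q z) = fderiv ℝ (fderiv ℝ (f i)) z (q z) (p z) :=
    ((hf i).isSymmSndFDerivAt (by
      rw [minSmoothness_of_isRCLikeNormedField]; norm_cast)).eq _ _
  rw [hd p q hp hq, hd q p hq hp, hsymm]
  have hc : ∀ a b : ℂ, ∑ j, ∑ k, G i j z a * (G j k z b * f k z) =
      ∑ j, ∑ k, G i k z a * G k j z b * f j z := fun a b => by
    rw [Finset.sum_comm]
    simp only [mul_assoc]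
  simp only [mul_add, add_mul, sub_mul, map_sub, Finset.sum_mul, Finset.mul_sum,
    Finset.sum_add_distrib, Finset.sum_sub_distrib, hc]
  ring

end Calculus

/-! ### Compatibility with the Fock field -/


lemma EndForm.apply_coordVec {S : Type*} [TopologicalSpace S] [ChartedSpace ℂ S] {E : S → Type*}
    [∀ x, AddCommGroup (E x)] [∀ x, Module ℂ (E x)] (α : EndForm E)
    (c : OpenPartialHomeomorph S ℂ) (z u : ℂ) :
    α (c.symm z) (coordVec c z u) = u • α.dzCoeff c z + conj u • α.dzbarCoeff c z := by
  have h : α (c.symm z) (coordVec c z u) = (u.re : ℂ) • α (c.symm z) (coordVec c z 1) +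
      (u.im : ℂ) • α (c.symm z) (coordVec c z Complex.I) :=
    (congrArg (α (c.symm z)) (coordVec_eq z u)).trans
      ((map_add _ _ _).trans (congrArg₂ (· + ·) (map_smul _ _ _) (map_smul _ _ _)))
  have h1 : u = u.re + u.im * Complex.I := (Complex.re_add_im u).symm
  have h2 : conj u = u.re - u.im * Complex.I := by
    apply Complex.ext <;> simp
  have hI := Complex.I_mul_I
  rw [h, h2]
  nth_rewrite 3 [h1]
  simp only [EndForm.dzCoeff, EndForm.dzbarCoeff]
  match_scalars
  · ring
  · linear_combination (u.im : ℂ) * hI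

namespace AdaptedFrame

section Structure

variable {S : Type*} [TopologicalSpace S] [T2Space S] [ChartedSpace ℂ S] [IsManifold 𝓘(ℝ, ℂ) ∞ S]
  {n : ℕ} {E : S → Type*} [TopologicalSpace (Bundle.TotalSpace (Fin n → ℂ) E)]
  [∀ x, AddCommGroup (E x)] [∀ x, Module ℂ (E x)] [∀ x, TopologicalSpace (E x)]
  [∀ x, IsTopologicalAddGroup (E x)] [∀ x, ContinuousSMul ℝ (E x)]
  [FiberBundle (Fin n → ℂ) E] [VectorBundle ℂ (Fin n → ℂ) E] [VectorBundle ℝ (Fin n → ℂ) E]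
  {P : FockBundle n E} {c : OpenPartialHomeomorph S ℂ} {W : Set ℂ}
  (F : AdaptedFrame P c W) (A : SLConnection P) {z : ℂ}

lemma vecCoord_eventually (F : AdaptedFrame P c W) (hz : z ∈ W)
    {X : ∀ x : S, TangentSpace 𝓘(ℝ, ℂ) x} {u : ℂ} (h : ∀ᶠ w in 𝓝 z, X (c.symm w) = coordVec c w u) :
    ∀ᶠ w in 𝓝 z, vecCoord c w (X (c.symm w)) = u := by
  filter_upwards [h, F.isOpen.mem_nhds hz] with w hw hwW
  rw [hw, vecCoord_coordVec F.mem_atlas (F.subset hwW)]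

lemma mlieBracket_coordinate_fields (F : AdaptedFrame P c W) (hz : z ∈ W)
    {X Y : ∀ x : S, TangentSpace 𝓘(ℝ, ℂ) x}
    (hX : IsSmoothField X) (hY : IsSmoothField Y) {u v : ℂ}
    (hXe : ∀ᶠ w in 𝓝 z, X (c.symm w) = coordVec c w u)
    (hYe : ∀ᶠ w in 𝓝 z, Y (c.symm w) = coordVec c w v) :
    VectorField.mlieBracket 𝓘(ℝ, ℂ) X Y (c.symm z) = 0 := by
  have h1 : fderiv ℝ (fun w => vecCoord c w (X (c.symm w))) z = 0 :=
    (EventuallyEq.fderiv_eq (F.vecCoord_eventually hz hXe)).trans (by simp)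
  have h2 : fderiv ℝ (fun w => vecCoord c w (Y (c.symm w))) z = 0 :=
    (EventuallyEq.fderiv_eq (F.vecCoord_eventually hz hYe)).trans (by simp)
  rw [mlieBracket_eq_coordVec F.mem_atlas (F.subset hz) hX hY, h1, h2]
  have := coordVec_smul (c := c) z 0 0
  simpa using this

lemma contDiffAt_mu {J : HigherComplexStructure S n} (F : AdaptedFrame P c W) (hz : z ∈ W) {m : ℕ}
    (hm : m ∈ Finset.Icc 2 n) : ContDiffAt ℝ ∞ (J.μ c m) z :=
  (J.smooth c F.mem_atlas m hm).contDiffAt (c.open_target.mem_nhds (F.subset hz))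

/-- The equation `d_A Φ = 0` in the frame: `[A₂, Φ₁] = ∂Φ₂ + [A₁, Φ₂]`, as `Φ₁` is constant. -/
lemma compatible_matrix {J : HigherComplexStructure S n} (hJ : P.Induces J) (hA : A.IsCompatible)
    (hz : z ∈ W) :
    F.connDzbar A z * shift n - shift n * F.connDzbar A z =
      (∑ m ∈ Finset.Icc 2 n, dz (J.μ c m) z • shift n ^ (m - 1)) +
        (F.connDz A z * beltrami J c z - beltrami J c z * F.connDz A z) := by
  obtain ⟨X, hX, hXe⟩ := exists_field_eq_coordVec F.mem_atlas (F.subset hz) 1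
  obtain ⟨Y, hY, hYe⟩ := exists_field_eq_coordVec F.mem_atlas (F.subset hz) Complex.I
  have hμ : ∀ m ∈ Finset.Icc 2 n, HasFDerivAt (J.μ c m) (fderiv ℝ (J.μ c m) z) z := fun m hm =>
    ((F.contDiffAt_mu hz hm).differentiableAt (by simp)).hasFDerivAt
  have hQ : ∀ i j, HasFDerivAt (fun w => beltrami J c w i j)
      (∑ m ∈ Finset.Icc 2 n, (shift n ^ (m - 1)) i j • fderiv ℝ (J.μ c m) z) z := by
    intro i j
    have := HasFDerivAt.fun_sum fun m hm => (hμ m hm).const_mul ((shift n ^ (m - 1)) i j)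
    refine this.congr_of_eventuallyEq (Eventually.of_forall fun w => ?_)
    simp [beltrami, Matrix.sum_apply, mul_comm]
  have hM : ∀ w ∈ W, ∀ u, F.mat w (P.field (c.symm w) (coordVec c w u)) =
      u • shift n + conj u • beltrami J c w := by
    intro w hw u
    rw [EndForm.apply_coordVec, F.mat_add, F.mat_smul, F.mat_smul, F.mat_dzCoeff hw,
      F.mat_dzbarCoeff hJ hw]
  -- The covariant derivative of `Φ(v)` in the direction `u`.
  have key : ∀ {u v : ℂ} {X Y : ∀ x : S, TangentSpace 𝓘(ℝ, ℂ) x}, IsSmoothField X →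
      IsSmoothField Y → (∀ᶠ w in 𝓝 z, X (c.symm w) = coordVec c w u) →
      (∀ᶠ w in 𝓝 z, Y (c.symm w) = coordVec c w v) → ∀ i j,
      F.coord _ (A.cov (fun y => P.field y (Y y) (F.e j y)) (c.symm z) (X (c.symm z))
        - P.field _ (Y (c.symm z)) (A.cov (F.e j) (c.symm z) (X (c.symm z)))) i =
      (conj v * (∑ m ∈ Finset.Icc 2 n, (shift n ^ (m - 1)) i j * fderiv ℝ (J.μ c m) z u)) +
        (F.connMat A z u * (v • shift n + conj v • beltrami J c z)
          - (v • shift n + conj v • beltrami J c z) * F.connMat A z u) i j := by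
    intro u v X Y hX hY hXe hYe i j
    have hs := P.field_smooth Y (F.e j) hY (F.smooth_e j)
    have hrep : ∀ k, F.rep (fun y => P.field y (Y y) (F.e j y)) k =ᶠ[𝓝 z]
        fun w => v * shift n k j + conj v * beltrami J c w k j := by
      intro k
      filter_upwards [hYe, F.isOpen.mem_nhds hz] with w hw hwW
      have := congrFun (congrFun (hM w hwW v) k) j
      simp only [rep, hw]
      exact this
    rw [hXe.self_of_nhds, hYe.self_of_nhds, map_sub, Pi.sub_apply, F.coord_cov A hz hs,
      F.coord_apply hz, hM z hz, (hrep i).fderiv_eq,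
      ((hQ i j).const_mul (conj v)).const_add _ |>.fderiv]
    simp only [(hrep _).self_of_nhds, Matrix.sub_apply, Matrix.mul_apply, add_sub_assoc,
      ← F.conn_apply]
    simp [connMat, Matrix.add_apply]
  have h0 : ∀ i j, _ := fun i j => congrArg (fun v => F.coord _ v i)
    (hA X Y (F.e j) hX hY (F.smooth_e j) (c.symm z))
  ext i j
  have h1 := h0 i j
  simp only [SLConnection.dForm] at h1
  rw [F.mlieBracket_coordinate_fields hz hX hY hXe hYe, map_zero, LinearMap.zero_apply, sub_zero,
    map_sub, Pi.sub_apply, key hX hY hXe hYe, key hY hX hYe hXe, map_zero, Pi.zero_apply] at h1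
  simp only [Matrix.mul_add, Matrix.add_mul, Matrix.mul_smul, Matrix.smul_mul, Matrix.sub_apply,
    Matrix.add_apply, Matrix.smul_apply, smul_eq_mul, map_one, Complex.conj_I] at h1
  simp only [connDz, connDzbar, Matrix.add_mul, Matrix.sub_mul, Matrix.mul_add, Matrix.mul_sub,
    Matrix.mul_smul, Matrix.smul_mul, Matrix.sub_apply,
    Matrix.add_apply, Matrix.smul_apply, smul_eq_mul, Matrix.sum_apply]
  have hsum : ∑ m ∈ Finset.Icc 2 n, dz (J.μ c m) z * (shift n ^ (m - 1)) i j =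
      1 / 2 * ((∑ m ∈ Finset.Icc 2 n, (shift n ^ (m - 1)) i j * fderiv ℝ (J.μ c m) z 1) -
        Complex.I * ∑ m ∈ Finset.Icc 2 n, (shift n ^ (m - 1)) i j *
          fderiv ℝ (J.μ c m) z Complex.I) := by
    rw [Finset.mul_sum, ← Finset.sum_sub_distrib, Finset.mul_sum]
    refine Finset.sum_congr rfl fun m _ => ?_
    rw [dz]; ring
  rw [hsum]
  have hI := Complex.I_mul_I
  linear_combination (-Complex.I / 2) * h1 + (1 / 2 : ℂ) *
    ((F.connMat A z 1 * shift n) i j - (shift n * F.connMat A z 1) i j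
      - (∑ m ∈ Finset.Icc 2 n, (shift n ^ (m - 1)) i j * fderiv ℝ (J.μ c m) z 1)
      - (F.connMat A z 1 * beltrami J c z) i j + (beltrami J c z * F.connMat A z 1) i j) * hI

end Structure

end AdaptedFrame

/-! ### Volume form, pairing and curvature in an adapted frame -/

lemma clm_apply_eq_re_im (L : ℂ →L[ℝ] ℂ) (p : ℂ) : L p = p.re * L 1 + p.im * L Complex.I := by
  have h : p = p.re • (1 : ℂ) + p.im • Complex.I := by apply Complex.ext <;> simp
  conv_lhs => rw [h]
  rw [map_add, _root_.map_smul, _root_.map_smul, Complex.real_smul, Complex.real_smul]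

namespace AdaptedFrame

section Structure

variable {S : Type*} [TopologicalSpace S] [T2Space S] [ChartedSpace ℂ S] [IsManifold 𝓘(ℝ, ℂ) ∞ S]
  {n : ℕ} {E : S → Type*} [TopologicalSpace (Bundle.TotalSpace (Fin n → ℂ) E)]
  [∀ x, AddCommGroup (E x)] [∀ x, Module ℂ (E x)] [∀ x, TopologicalSpace (E x)]
  [∀ x, IsTopologicalAddGroup (E x)] [∀ x, ContinuousSMul ℝ (E x)]
  [FiberBundle (Fin n → ℂ) E] [VectorBundle ℂ (Fin n → ℂ) E] [VectorBundle ℝ (Fin n → ℂ) E]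
  {P : FockBundle n E} {c : OpenPartialHomeomorph S ℂ} {W : Set ℂ}
  (F : AdaptedFrame P c W) (A : SLConnection P) {z : ℂ}

lemma vol_update (hz : z ∈ W) (i : Fin n) (v : E (c.symm z)) :
    P.vol (c.symm z) (Function.update (fun j => F.e j (c.symm z)) i v) =
      F.coord _ v i * P.vol (c.symm z) (fun j => F.e j (c.symm z)) := by
  conv_lhs => rw [← F.sum_coord z hz v]
  rw [(P.vol (c.symm z)).map_update_sum]
  rw [Finset.sum_eq_single i]
  · rw [(P.vol (c.symm z)).map_update_smul, Function.update_eq_self, smul_eq_mul]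
  · intro j _ hj
    rw [(P.vol (c.symm z)).map_update_smul, (P.vol (c.symm z)).map_update_self _ hj.symm,
      smul_zero]
  · simp

/-- The volume of the frame. -/
def volFun (w : ℂ) : ℂ := P.vol (c.symm w) (fun j => F.e j (c.symm w))

lemma contDiffAt_volFun (hz : z ∈ W) : ContDiffAt ℝ ∞ F.volFun z :=
  (P.vol_smooth F.e F.smooth_e).contDiffAt_comp_symm F.mem_atlas (F.subset hz)

/-- As the volume form is parallel, the trace of the connection form is the logarithmic derivative
of the volume of the frame. -/
lemma fderiv_volFun (hz : z ∈ W) (u : ℂ) :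
    fderiv ℝ F.volFun z u = (∑ i, F.conn A z i i u) * F.volFun z := by
  have h := A.vol_parallel F.e F.smooth_e (c.symm z) (coordVec c z u)
  rw [mvfderiv_coordVec (P.vol_smooth F.e F.smooth_e) F.mem_atlas (F.subset hz)] at h
  refine h.trans ?_
  rw [Finset.sum_mul]
  refine Finset.sum_congr rfl fun i _ => ?_
  rw [F.vol_update hz, F.conn_apply]
  rfl

/-- The Gram matrix of the frame. -/
def gram (w : ℂ) : Matrix (Fin n) (Fin n) ℂ :=
  fun i j => P.pairing (c.symm w) (F.e i (c.symm w)) (F.e j (c.symm w))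

lemma differentiableAt_gram (hz : z ∈ W) (i j : Fin n) :
    DifferentiableAt ℝ (fun w => F.gram w i j) z :=
  ((P.pairing_smooth _ _ (F.smooth_e i) (F.smooth_e j)).contDiffAt_comp_symm F.mem_atlas
    (F.subset hz)).differentiableAt (by simp)

lemma pairing_left (hz : z ∈ W) (v : E (c.symm z)) (j : Fin n) :
    P.pairing _ v (F.e j _) = ∑ k, F.coord _ v k * F.gram z k j := by
  conv_lhs => rw [← F.sum_coord z hz v]
  simp [gram]

lemma pairing_right (hz : z ∈ W) (v : E (c.symm z)) (i : Fin n) :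
    P.pairing _ (F.e i _) v = ∑ k, F.gram z i k * F.coord _ v k := by
  conv_lhs => rw [← F.sum_coord z hz v]
  simp [gram, mul_comm]

lemma isUnit_det_gram (hz : z ∈ W) : IsUnit (F.gram z).det := by
  have h := (LinearMap.BilinForm.nondegenerate_iff_det_ne_zero (F.basis hz)).1
    (P.pairing_nondegenerate (c.symm z))
  rw [isUnit_iff_ne_zero]
  convert h using 2
  ext i j
  simp [gram, F.basis_apply]

lemma gram_mul_shift (hz : z ∈ W) : F.gram z * shift n = (shift n).transpose * F.gram z := by
  have hΦ : ∀ a b, P.pairing (c.symm z) (P.field.dzCoeff c z a) b =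
      P.pairing (c.symm z) a (P.field.dzCoeff c z b) := by
    intro a b
    simp [EndForm.dzCoeff, P.field_selfAdjoint]
  ext i j
  have h := hΦ (F.e i _) (F.e j _)
  rw [F.pairing_left hz, F.pairing_right hz] at h
  have hN : ∀ a b, F.coord _ (P.field.dzCoeff c z (F.e b _)) a = shift n a b := fun a b =>
    congrFun (congrFun (F.mat_dzCoeff hz) a) b
  simp only [hN] at h
  simp only [Matrix.mul_apply, Matrix.transpose_apply]
  exact h.symm

/-- The traces of `A^{-σ}` against powers of `Φ₁` are those of the connection form, since `Φ₁` is
`g`-symmetric and constant in the frame. -/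
lemma trace_antiInvariantPart {B : EndForm E} (hB : A.IsAntiInvariantPart B) (hz : z ∈ W) (u : ℂ)
    {k : ℕ} (hk : 1 ≤ k) :
    (shift n ^ k * F.mat z (B _ (coordVec c z u))).trace =
      (shift n ^ k * F.connMat A z u).trace := by
  refine trace_pow_mul_antiInvariant isNilpotent_shift (F.isUnit_det_gram hz)
    (G' := Matrix.of fun i j => fderiv ℝ (fun w => F.gram w i j) z u) (F.gram_mul_shift hz) ?_ ?_ hk
  · ext i j
    have h : (fun w => ∑ l, F.gram w i l * shift n l j) =ᶠ[𝓝 z]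
        fun w => ∑ l, shift n l i * F.gram w l j := by
      filter_upwards [F.isOpen.mem_nhds hz] with w hw
      have := congrFun (congrFun (F.gram_mul_shift hw) i) j
      simpa only [Matrix.mul_apply, Matrix.transpose_apply] using this
    have h1 := h.fderiv_eq (𝕜 := ℝ)
    rw [fderiv_fun_sum fun l _ => (F.differentiableAt_gram hz i l).mul_const _,
      fderiv_fun_sum fun l _ => (F.differentiableAt_gram hz l j).const_mul _] at h1
    have h2 := congrArg (fun L => L u) h1
    simp only [sum_apply, fderiv_mul_const (F.differentiableAt_gram hz _ _),
      fderiv_const_mul (F.differentiableAt_gram hz _ _), smul_apply, smul_eq_mul] at h2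
    simp only [Matrix.mul_apply, Matrix.transpose_apply, Matrix.of_apply]
    rw [← h2]
    exact Finset.sum_congr rfl fun l _ => mul_comm _ _
  · ext i j
    have h := hB (F.e i) (F.e j) (F.smooth_e i) (F.smooth_e j) (c.symm z) (coordVec c z u)
    rw [mvfderiv_coordVec (P.pairing_smooth _ _ (F.smooth_e i) (F.smooth_e j)) F.mem_atlas
      (F.subset hz), F.pairing_left hz, F.pairing_left hz, F.pairing_right hz] at h
    simp only [Matrix.smul_apply, Matrix.sub_apply, Matrix.mul_apply, Matrix.transpose_apply,
      Matrix.of_apply, smul_eq_mul, connMat, F.conn_apply]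
    exact h

lemma covectorData_eq {B : EndForm E} (hB : A.IsAntiInvariantPart B) (hz : z ∈ W) {k : ℕ}
    (hk : 2 ≤ k) : P.covectorData B c k z = (shift n ^ (k - 1) * F.connDz A z).trace := by
  rw [FockBundle.covectorData, ← F.trace_mat hz, F.mat_mul hz, F.mat_pow hz, F.mat_dzCoeff hz,
    EndForm.dzCoeff, F.mat_smul, F.mat_sub, F.mat_smul, connDz]
  simp only [Matrix.mul_smul, Matrix.mul_sub, Matrix.trace_smul, Matrix.trace_sub]
  rw [F.trace_antiInvariantPart A hB hz _ (by omega),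
    F.trace_antiInvariantPart A hB hz _ (by omega)]

/-- The matrix of the curvature `F(A)(∂_x, ∂_y)`. -/
def curv (w : ℂ) : Matrix (Fin n) (Fin n) ℂ := fun i j =>
  fderiv ℝ (fun v => F.conn A v i j) w 1 Complex.I
    - fderiv ℝ (fun v => F.conn A v i j) w Complex.I 1
    + (F.connMat A w 1 * F.connMat A w Complex.I - F.connMat A w Complex.I * F.connMat A w 1) i j

/-- The curvature is tensorial: in the frame it is given by the matrix `curv` and the area form. -/
lemma coord_curvature (hz : z ∈ W) {X Y : ∀ x : S, TangentSpace 𝓘(ℝ, ℂ) x}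
    (hX : IsSmoothField X) (hY : IsSmoothField Y) {s : ∀ x, E x} (hs : IsSmoothSection n s)
    (i : Fin n) {p q : ℂ} (hp : vecCoord c z (X (c.symm z)) = p)
    (hq : vecCoord c z (Y (c.symm z)) = q) :
    F.coord _ (A.curvature X Y s (c.symm z)) i =
      ((p.re * q.im - p.im * q.re : ℝ) : ℂ) * ∑ j, F.curv A z i j * F.coord _ (s (c.symm z)) j := by
  have hcov : ∀ {X Y : ∀ x : S, TangentSpace 𝓘(ℝ, ℂ) x}, IsSmoothField X → IsSmoothField Y →
      F.coord _ (A.cov (fun y => A.cov s y (Y y)) (c.symm z) (X (c.symm z))) i =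
      fderiv ℝ (fun w => fderiv ℝ (F.rep s i) w (vecCoord c w (Y (c.symm w)))
        + ∑ j, F.conn A w i j (vecCoord c w (Y (c.symm w))) * F.rep s j w) z
          (vecCoord c z (X (c.symm z)))
        + ∑ j, F.conn A z i j (vecCoord c z (X (c.symm z))) *
          (fderiv ℝ (F.rep s j) z (vecCoord c z (Y (c.symm z)))
            + ∑ k, F.conn A z j k (vecCoord c z (Y (c.symm z))) * F.rep s k z) := by
    intro X Y hX hY
    have hr : ∀ w ∈ W, ∀ j, F.rep (fun y => A.cov s y (Y y)) j w =
        fderiv ℝ (F.rep s j) w (vecCoord c w (Y (c.symm w)))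
        + ∑ k, F.conn A w j k (vecCoord c w (Y (c.symm w))) * F.rep s k w := by
      intro w hw j
      rw [← F.coord_cov A hw hs, coordVec_vecCoord F.mem_atlas (F.subset hw)]
      rfl
    have hr' : F.rep (fun y => A.cov s y (Y y)) i =ᶠ[𝓝 z] fun w =>
        fderiv ℝ (F.rep s i) w (vecCoord c w (Y (c.symm w)))
        + ∑ k, F.conn A w i k (vecCoord c w (Y (c.symm w))) * F.rep s k w := by
      filter_upwards [F.isOpen.mem_nhds hz] with w hw using hr w hw i
    conv_lhs => rw [← coordVec_vecCoord F.mem_atlas (F.subset hz) (X (c.symm z))]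
    rw [F.coord_cov A hz (A.smooth Y s hY hs), hr'.fderiv_eq]
    simp only [hr z hz]
  rw [SLConnection.curvature, map_sub, map_sub, Pi.sub_apply, Pi.sub_apply, hcov hX hY, hcov hY hX,
    mlieBracket_eq_coordVec F.mem_atlas (F.subset hz) hX hY, F.coord_cov A hz hs]
  rw [curvature_calculus (fun j => F.contDiffAt_rep hz hs j) (fun i j => F.contDiffAt_conn A hz i j)
    (contDiffAt_vecCoord F.mem_atlas (F.subset hz) hX)
    (contDiffAt_vecCoord F.mem_atlas (F.subset hz) hY), hp, hq, Finset.mul_sum]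
  refine Finset.sum_congr rfl fun j _ => ?_
  rw [← mul_assoc]
  refine congrArg (· * F.coord _ (s (c.symm z)) j) ?_
  have h1 : ∀ k, F.conn A z i k p * F.conn A z k j q - F.conn A z i k q * F.conn A z k j p =
      ((p.re * q.im - p.im * q.re : ℝ) : ℂ) * (F.conn A z i k 1 * F.conn A z k j Complex.I -
        F.conn A z i k Complex.I * F.conn A z k j 1) := by
    intro k
    simp only [clm_apply_eq_re_im _ p, clm_apply_eq_re_im _ q]
    push_cast
    ring
  have h2 : fderiv ℝ (fun v => F.conn A v i j) z p q - fderiv ℝ (fun v => F.conn A v i j) z q p =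
      ((p.re * q.im - p.im * q.re : ℝ) : ℂ) * (fderiv ℝ (fun v => F.conn A v i j) z 1 Complex.I -
        fderiv ℝ (fun v => F.conn A v i j) z Complex.I 1) := by
    have h3 : ∀ (L : ℂ →L[ℝ] ℂ →L[ℝ] ℂ) (p q : ℂ), L p q = p.re * L 1 q + p.im * L Complex.I q :=
      fun L p q => clm_apply_eq_re_im (L.flip q) p
    rw [h3 _ p, h3 _ q, clm_apply_eq_re_im _ q, clm_apply_eq_re_im _ p,
      clm_apply_eq_re_im (_ : ℂ →L[ℝ] ℂ) q, clm_apply_eq_re_im (_ : ℂ →L[ℝ] ℂ) p]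
    push_cast
    ring
  rw [Finset.sum_congr rfl fun k _ => h1 k, h2, ← Finset.mul_sum, ← mul_add, curv]
  simp [Matrix.mul_apply, connMat]

/-- The curvature is trace-free, as the trace of the connection form is closed. -/
lemma trace_curv (hz : z ∈ W) : (F.curv A z).trace = 0 := by
  have hd : ContDiffAt ℝ ∞ F.volFun z := F.contDiffAt_volFun hz
  have hd0 : ∀ w ∈ W, F.volFun w ≠ 0 := F.vol_ne_zero
  have hconn := fun i => ((F.contDiffAt_conn A hz i i).differentiableAt (by simp)).hasFDerivAt
  have hsum := HasFDerivAt.fun_sum fun i (_ : i ∈ Finset.univ) => hconn i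
  have hev : (fun w => F.volFun w • ∑ i, F.conn A w i i) =ᶠ[𝓝 z] fderiv ℝ F.volFun := by
    filter_upwards [F.isOpen.mem_nhds hz] with w hw
    ext1 u
    rw [F.fderiv_volFun A hw, smul_apply, sum_apply, smul_eq_mul, mul_comm]
  have h1 := (hd.differentiableAt (by simp)).hasFDerivAt.smul hsum
  have h2 := hev.fderiv_eq (𝕜 := ℝ)
  have h3 : fderiv ℝ (fderiv ℝ F.volFun) z 1 Complex.I =
      fderiv ℝ (fderiv ℝ F.volFun) z Complex.I 1 :=
    (hd.isSymmSndFDerivAt (by rw [minSmoothness_of_isRCLikeNormedField]; norm_cast)).eq _ _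
  rw [← h2, show fderiv ℝ (fun w => F.volFun w • ∑ i, F.conn A w i i) z = _ from h1.fderiv] at h3
  have h4 : (F.curv A z).trace = ∑ i, (fderiv ℝ (fun v => F.conn A v i i) z 1 Complex.I -
      fderiv ℝ (fun v => F.conn A v i i) z Complex.I 1) := by
    have : (F.connMat A z 1 * F.connMat A z Complex.I -
        F.connMat A z Complex.I * F.connMat A z 1).trace = 0 := by
      rw [Matrix.trace_sub, Matrix.trace_mul_comm, sub_self]
    rw [Matrix.trace] at this ⊢
    simp only [Matrix.diag, curv] at this ⊢
    rw [Finset.sum_add_distrib, this, add_zero]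
  simp [F.fderiv_volFun A hz] at h3
  rw [h4, Finset.sum_sub_distrib]
  exact mul_left_cancel₀ (hd0 z hz) (by linear_combination h3)

end Structure

end AdaptedFrame

/-! ### `μ`-holomorphicity and curvature -/

lemma dz_congr {f g : ℂ → ℂ} {z : ℂ} (h : f =ᶠ[𝓝 z] g) : dz f z = dz g z := by
  rw [dz, dz, h.fderiv_eq]

lemma dzbar_congr {f g : ℂ → ℂ} {z : ℂ} (h : f =ᶠ[𝓝 z] g) : dzbar f z = dzbar g z := by
  rw [dzbar, dzbar, h.fderiv_eq]

lemma dz_sum {ι : Type*} {s : Finset ι} {f : ι → ℂ → ℂ} {z : ℂ}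
    (hf : ∀ i ∈ s, DifferentiableAt ℝ (f i) z) :
    dz (fun w => ∑ i ∈ s, f i w) z = ∑ i ∈ s, dz (f i) z := by
  simp only [dz, fderiv_fun_sum hf, sum_apply]
  rw [Finset.mul_sum, ← Finset.sum_sub_distrib, Finset.mul_sum]

lemma dz_mul {f g : ℂ → ℂ} {z : ℂ} (hf : DifferentiableAt ℝ f z) (hg : DifferentiableAt ℝ g z) :
    dz (fun w => f w * g w) z = f z * dz g z + dz f z * g z := by
  simp only [dz, fderiv_fun_mul hf hg, add_apply, smul_apply, smul_eq_mul]
  ring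

namespace AdaptedFrame

section Structure

variable {S : Type*} [TopologicalSpace S] [T2Space S] [ChartedSpace ℂ S] [IsManifold 𝓘(ℝ, ℂ) ∞ S]
  {n : ℕ} {E : S → Type*} [TopologicalSpace (Bundle.TotalSpace (Fin n → ℂ) E)]
  [∀ x, AddCommGroup (E x)] [∀ x, Module ℂ (E x)] [∀ x, TopologicalSpace (E x)]
  [∀ x, IsTopologicalAddGroup (E x)] [∀ x, ContinuousSMul ℝ (E x)]
  [FiberBundle (Fin n → ℂ) E] [VectorBundle ℂ (Fin n → ℂ) E] [VectorBundle ℝ (Fin n → ℂ) E]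
  {P : FockBundle n E} {c : OpenPartialHomeomorph S ℂ} {W : Set ℂ}
  (F : AdaptedFrame P c W) (A : SLConnection P) {z : ℂ}

lemma trace_mul_connMat (M : Matrix (Fin n) (Fin n) ℂ) (w u : ℂ) :
    (M * F.connMat A w u).trace = (∑ i, ∑ j, M i j • F.conn A w j i) u := by
  simp [Matrix.trace, Matrix.mul_apply, connMat]

lemma hasFDerivAt_trace (hz : z ∈ W) (M : Matrix (Fin n) (Fin n) ℂ) (u : ℂ) :
    HasFDerivAt (fun w => (M * F.connMat A w u).trace)
      ((∑ i, ∑ j, M i j • fderiv ℝ (fun w => F.conn A w j i) z).flip u) z := by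
  have h1 := fun j i => ((F.contDiffAt_conn A hz j i).differentiableAt (by simp)).hasFDerivAt
  have h2 := HasFDerivAt.fun_sum fun i (_ : i ∈ (Finset.univ : Finset (Fin n))) =>
    HasFDerivAt.fun_sum fun j (_ : j ∈ (Finset.univ : Finset (Fin n))) =>
      (h1 j i).const_smul (M i j)
  have h3 := h2.clm_apply (hasFDerivAt_const u z)
  refine (h3.congr_of_eventuallyEq (Eventually.of_forall fun w =>
    F.trace_mul_connMat A M w u)).congr_fderiv ?_
  ext1 v
  simp

lemma trace_mul_connDz (M : Matrix (Fin n) (Fin n) ℂ) (w : ℂ) :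
    (M * F.connDz A w).trace = (1 / 2 : ℂ) * ((M * F.connMat A w 1).trace
      - Complex.I * (M * F.connMat A w Complex.I).trace) := by
  simp [connDz, Matrix.mul_sub, Matrix.trace_sub]

lemma trace_mul_connDzbar (M : Matrix (Fin n) (Fin n) ℂ) (w : ℂ) :
    (M * F.connDzbar A w).trace = (1 / 2 : ℂ) * ((M * F.connMat A w 1).trace
      + Complex.I * (M * F.connMat A w Complex.I).trace) := by
  simp [connDzbar, Matrix.mul_add, Matrix.trace_add]
  ring

lemma differentiableAt_trace_connDz (hz : z ∈ W) (M : Matrix (Fin n) (Fin n) ℂ) :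
    DifferentiableAt ℝ (fun w => (M * F.connDz A w).trace) z := by
  simp only [F.trace_mul_connDz]
  exact ((F.hasFDerivAt_trace A hz M 1).differentiableAt.sub
    ((F.hasFDerivAt_trace A hz M Complex.I).differentiableAt.const_mul _)).const_mul _

/-- The component of the curvature along a constant matrix: the `dz ∧ dz̄`-coefficient of
`dA + A ∧ A` is `∂A₂ - ∂̄A₁ + [A₁, A₂]`. The factor `i / 2` appears because `dz ∧ dz̄` has the value
`-2i` on `(∂_x, ∂_y)`. -/
lemma trace_mul_curv (hz : z ∈ W) (M : Matrix (Fin n) (Fin n) ℂ) :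
    Complex.I / 2 * (M * F.curv A z).trace =
      dz (fun w => (M * F.connDzbar A w).trace) z - dzbar (fun w => (M * F.connDz A w).trace) z
        + (M * (F.connDz A z * F.connDzbar A z - F.connDzbar A z * F.connDz A z)).trace := by
  have h1 := F.hasFDerivAt_trace A hz M 1
  have hI := F.hasFDerivAt_trace A hz M Complex.I
  have e1 := ((h1.sub (hI.const_mul Complex.I)).const_mul (1 / 2 : ℂ)).fderiv
  have e2 := ((h1.add (hI.const_mul Complex.I)).const_mul (1 / 2 : ℂ)).fderiv
  have e1' : fderiv ℝ (fun w => (M * F.connDz A w).trace) z = _ :=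
    (congrArg (fun f => fderiv ℝ f z) (funext fun w => F.trace_mul_connDz A M w)).trans e1
  have e2' : fderiv ℝ (fun w => (M * F.connDzbar A w).trace) z = _ :=
    (congrArg (fun f => fderiv ℝ f z) (funext fun w => F.trace_mul_connDzbar A M w)).trans e2
  have e3 : (F.connDz A z * F.connDzbar A z - F.connDzbar A z * F.connDz A z) = (Complex.I / 2) •
      (F.connMat A z 1 * F.connMat A z Complex.I - F.connMat A z Complex.I * F.connMat A z 1) := by
    simp only [connDz, connDzbar, Matrix.smul_mul, Matrix.mul_smul, Matrix.mul_add, Matrix.mul_sub,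
      Matrix.add_mul, Matrix.sub_mul, smul_add, smul_sub, smul_smul]
    match_scalars <;> ring
  have e4 : (M * F.curv A z).trace =
      ((∑ i, ∑ j, M i j • fderiv ℝ (fun w => F.conn A w j i) z) 1 Complex.I -
        (∑ i, ∑ j, M i j • fderiv ℝ (fun w => F.conn A w j i) z) Complex.I 1) +
      (M * (F.connMat A z 1 * F.connMat A z Complex.I -
        F.connMat A z Complex.I * F.connMat A z 1)).trace := by
    have : F.curv A z = (Matrix.of fun i j => fderiv ℝ (fun v => F.conn A v i j) z 1 Complex.I -
        fderiv ℝ (fun v => F.conn A v i j) z Complex.I 1) +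
        (F.connMat A z 1 * F.connMat A z Complex.I -
          F.connMat A z Complex.I * F.connMat A z 1) := rfl
    rw [this, Matrix.mul_add, Matrix.trace_add]
    congr 1
    simp [Matrix.trace, Matrix.mul_apply, mul_sub]
  rw [dz, dzbar, e1', e2', e3, e4, Matrix.mul_smul, Matrix.trace_smul]
  simp only [smul_apply, sub_apply, add_apply, smul_eq_mul, ContinuousLinearMap.flip_apply]
  ring_nf

/-- The trace of the curvature against `Φ₁^k` in terms of the functions `tr (Φ₁^j A₁)`: the traces
of `A₂` and of `[A₁, A₂]` are eliminated with the compatibility of `A` with `Φ`. -/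
lemma trace_shift_pow_mul_curv {J : HigherComplexStructure S n} (hJ : P.Induces J)
    (hA : A.IsCompatible) (hz : z ∈ W) {k : ℕ} (hk : 1 ≤ k) :
    Complex.I / 2 * (shift n ^ k * F.curv A z).trace =
      - dzbar (fun w => (shift n ^ k * F.connDz A w).trace) z +
      ∑ m ∈ Finset.Icc 2 n,
        (((k : ℂ) + m - 1) * dz (J.μ c m) z * (shift n ^ (k + (m - 2)) * F.connDz A z).trace
          + ((m : ℂ) - 1) * J.μ c m z *
            dz (fun w => (shift n ^ (k + (m - 2)) * F.connDz A w).trace) z) := by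
  have hid := fun w (hw : w ∈ W) => trace_identities (s := Finset.Icc 2 n)
    (fun m hm => (Finset.mem_Icc.1 hm).1) (F.compatible_matrix A hJ hA hw) hk
  have hμ : ∀ m ∈ Finset.Icc 2 n, DifferentiableAt ℝ (J.μ c m) z := fun m hm =>
    (F.contDiffAt_mu hz hm).differentiableAt (by simp)
  have h1 : (fun w => (shift n ^ k * F.connDzbar A w).trace) =ᶠ[𝓝 z] fun w =>
      ∑ m ∈ Finset.Icc 2 n, (((m : ℂ) - 1) * J.μ c m w) *
        (shift n ^ (k + (m - 2)) * F.connDz A w).trace := by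
    filter_upwards [F.isOpen.mem_nhds hz] with w hw using (hid w hw).1
  rw [F.trace_mul_curv A hz, (hid z hz).2, dz_congr h1,
    dz_sum (f := fun (m : ℕ) w => (((m : ℂ) - 1) * J.μ c m w) *
      (shift n ^ (k + (m - 2)) * F.connDz A w).trace) fun m hm =>
    ((hμ m hm).const_mul _).mul (F.differentiableAt_trace_connDz A hz _), sub_add_eq_add_sub,
    ← Finset.sum_add_distrib, sub_eq_neg_add]
  congr 1
  refine Finset.sum_congr rfl fun m hm => ?_
  have h2 : dz (fun w => ((m : ℂ) - 1) * J.μ c m w) z = ((m : ℂ) - 1) * dz (J.μ c m) z := by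
    rw [dz_mul (differentiableAt_const _) (hμ m hm)]
    simp [dz]
  rw [dz_mul ((hμ m hm).const_mul _) (F.differentiableAt_trace_connDz A hz _), h2]
  ring

/-- The `μ`-holomorphicity expression is the trace of the curvature against `Φ₁^{k-1}`. -/
lemma muHolomorphic_expression_eq {J : HigherComplexStructure S n} (hJ : P.Induces J)
    (hA : A.IsCompatible) {B : EndForm E} (hB : A.IsAntiInvariantPart B) (hz : z ∈ W) {k : ℕ}
    (hk : k ∈ Finset.Icc 2 n) :
    (-dzbar (P.covectorData B c k) z + J.μ c 2 z * dz (P.covectorData B c k) z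
        + k * dz (J.μ c 2) z * P.covectorData B c k z)
      + ∑ l ∈ Finset.Icc 1 (n - k),
        (((l : ℂ) + k) * dz (J.μ c (l + 2)) z * P.covectorData B c (k + l) z
          + ((l : ℂ) + 1) * J.μ c (l + 2) z * dz (P.covectorData B c (k + l)) z) =
      Complex.I / 2 * (shift n ^ (k - 1) * F.curv A z).trace := by
  obtain ⟨hk2, hkn⟩ := Finset.mem_Icc.1 hk
  have ht : ∀ j, 2 ≤ j → P.covectorData B c j =ᶠ[𝓝 z]
      fun w => (shift n ^ (j - 1) * F.connDz A w).trace := fun j hj => by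
    filter_upwards [F.isOpen.mem_nhds hz] with w hw using F.covectorData_eq A hB hw hj
  rw [F.trace_shift_pow_mul_curv A hJ hA hz (by omega : 1 ≤ k - 1),
    dzbar_congr (ht k hk2), dz_congr (ht k hk2), (ht k hk2).self_of_nhds]
  let G : ℕ → ℂ := fun l =>
    ((l : ℂ) + k) * dz (J.μ c (l + 2)) z * (shift n ^ (k + l - 1) * F.connDz A z).trace
      + ((l : ℂ) + 1) * J.μ c (l + 2) z *
        dz (fun w => (shift n ^ (k + l - 1) * F.connDz A w).trace) z
  have h1 : ∑ l ∈ Finset.Icc 1 (n - k),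
        (((l : ℂ) + k) * dz (J.μ c (l + 2)) z * P.covectorData B c (k + l) z
          + ((l : ℂ) + 1) * J.μ c (l + 2) z * dz (P.covectorData B c (k + l)) z) =
      ∑ l ∈ Finset.Icc 1 (n - k), G l := by
    refine Finset.sum_congr rfl fun l _ => ?_
    rw [dz_congr (ht (k + l) (by omega)), (ht (k + l) (by omega)).self_of_nhds]
  -- The terms beyond `l = n - k` vanish because `Φ₁ ^ n = 0`.
  have h2 : ∀ l, n - k < l → G l = 0 := by
    intro l hl
    simp only [G]
    rw [shift_pow_eq_zero (show n ≤ k + l - 1 by omega)]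
    simp [dz]
  have h3 : ∑ m ∈ Finset.Icc 2 n, (((↑(k - 1) : ℂ) + m - 1) * dz (J.μ c m) z *
        (shift n ^ (k - 1 + (m - 2)) * F.connDz A z).trace
          + ((m : ℂ) - 1) * J.μ c m z *
            dz (fun w => (shift n ^ (k - 1 + (m - 2)) * F.connDz A w).trace) z) =
      ∑ l ∈ Finset.range (n - 1), G l := by
    rw [← Finset.Ico_add_one_right_eq_Icc, Finset.sum_Ico_eq_sum_range,
      show n + 1 - 2 = n - 1 by omega]
    refine Finset.sum_congr rfl fun l _ => ?_
    have e : k - 1 + (l + 2 - 2) = k + l - 1 := by omega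
    simp only [G, add_comm 2 l, e]
    push_cast [Nat.cast_sub (show 1 ≤ k by omega)]
    ring
  have h4 : ∑ l ∈ Finset.range (n - 1), G l = ∑ l ∈ Finset.range (n - k + 1), G l := by
    symm
    refine Finset.sum_subset (fun l hl => ?_) fun l _ hl => h2 l ?_
    · simp only [Finset.mem_range] at hl ⊢; omega
    · simp only [Finset.mem_range] at hl; omega
  have h5 : ∑ l ∈ Finset.range (n - k + 1), G l = G 0 + ∑ l ∈ Finset.Icc 1 (n - k), G l := by
    rw [Finset.sum_range_succ', add_comm, ← Finset.Ico_add_one_right_eq_Icc,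
      Finset.sum_Ico_eq_sum_range]
    simp only [Nat.add_sub_cancel, add_comm 1]
  rw [h1, h3, h4, h5]
  simp only [G, Nat.cast_zero, zero_add, add_zero, one_mul]
  ring

end Structure

end AdaptedFrame

section Equivalence

variable {S : Type*} [TopologicalSpace S] [T2Space S] [ChartedSpace ℂ S] [IsManifold 𝓘(ℝ, ℂ) ∞ S]
  {n : ℕ} {E : S → Type*} [TopologicalSpace (Bundle.TotalSpace (Fin n → ℂ) E)]
  [∀ x, AddCommGroup (E x)] [∀ x, Module ℂ (E x)] [∀ x, TopologicalSpace (E x)]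
  [∀ x, IsTopologicalAddGroup (E x)] [∀ x, ContinuousSMul ℝ (E x)]
  [FiberBundle (Fin n → ℂ) E] [VectorBundle ℂ (Fin n → ℂ) E] [VectorBundle ℝ (Fin n → ℂ) E]
  {P : FockBundle n E}

lemma trace_mul_lie_of_commute {V : Type*} [AddCommGroup V] [Module ℂ V] {T M H : Module.End ℂ V}
    (h : Commute T M) : LinearMap.trace ℂ V (T * ⁅M, H⁆) = 0 := by
  rw [Ring.lie_def, mul_sub, map_sub, ← mul_assoc, h.eq, mul_assoc, LinearMap.trace_mul_comm ℂ M,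
    ← mul_assoc, sub_self]

lemma commute_dzCoeff (P : FockBundle n E) (c : OpenPartialHomeomorph S ℂ) (z : ℂ)
    (v : TangentSpace 𝓘(ℝ, ℂ) (c.symm z)) :
    Commute (P.field.dzCoeff c z) (P.field (c.symm z) v) := by
  have h := fun w => P.field_commute (c.symm z) w v
  rw [EndForm.dzCoeff]
  exact ((show Commute _ _ from h _).sub_left ((show Commute _ _ from h _).smul_left _)).smul_left _

/-- Curvature in the image of `ad_Φ` is orthogonal to the powers of `Φ₁`. -/
lemma AdaptedFrame.trace_curv_of_mem_image {c : OpenPartialHomeomorph S ℂ} {W : Set ℂ}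
    (F : AdaptedFrame P c W) {A : SLConnection P} (hA : A.CurvatureInImage) {z : ℂ} (hz : z ∈ W)
    (k : ℕ) : (shift n ^ k * F.curv A z).trace = 0 := by
  obtain ⟨η, -, -, hη⟩ := hA
  obtain ⟨X, hX, hXe⟩ := exists_field_eq_coordVec F.mem_atlas (F.subset hz) 1
  obtain ⟨Y, hY, hYe⟩ := exists_field_eq_coordVec F.mem_atlas (F.subset hz) Complex.I
  have h : F.curv A z = F.mat z (P.field.bracketWedge η _ (X (c.symm z)) (Y (c.symm z))) := by
    ext i j
    have h1 := F.coord_curvature A hz hX hY (F.smooth_e j) i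
      (F.vecCoord_eventually hz hXe).self_of_nhds (F.vecCoord_eventually hz hYe).self_of_nhds
    rw [hη X Y _ hX hY (F.smooth_e j), F.coord_e z hz] at h1
    simpa [AdaptedFrame.mat, Pi.single_apply] using h1.symm
  rw [h, ← F.mat_dzCoeff hz, ← F.mat_pow hz, ← F.mat_mul hz, F.trace_mat hz,
    EndForm.bracketWedge, mul_sub, map_sub, trace_mul_lie_of_commute, trace_mul_lie_of_commute,
    sub_self]
  · exact (commute_dzCoeff P c z _).pow_left k
  · exact (commute_dzCoeff P c z _).pow_left k

/-- The `μ`-holomorphicity condition says that the curvature is orthogonal to all powers of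
`Φ₁`. -/
lemma AdaptedFrame.trace_curv_of_muHolomorphic {c : OpenPartialHomeomorph S ℂ} {W : Set ℂ}
    (F : AdaptedFrame P c W) {J : HigherComplexStructure S n} (hJ : P.Induces J)
    {A : SLConnection P} (hA : A.IsCompatible) {B : EndForm E} (hB : A.IsAntiInvariantPart B)
    (h : J.IsMuHolomorphic (P.covectorData B)) {z : ℂ} (hz : z ∈ W) (k : ℕ) :
    (shift n ^ k * F.curv A z).trace = 0 := by
  rcases Nat.eq_zero_or_pos k with rfl | hk
  · rw [pow_zero, one_mul, F.trace_curv A hz]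
  by_cases hkn : n ≤ k
  · rw [shift_pow_eq_zero hkn, zero_mul, Matrix.trace_zero]
  · have hk' : k + 1 ∈ Finset.Icc 2 n := Finset.mem_Icc.2 ⟨by omega, by omega⟩
    have h1 := F.muHolomorphic_expression_eq A hJ hA hB hz hk'
    rw [h c F.mem_atlas z (F.subset hz) (k + 1) hk', Nat.add_sub_cancel] at h1
    exact (mul_eq_zero.1 h1.symm).resolve_left (by simp)

lemma isSmoothFun_linearMap {M : S → Matrix (Fin n) (Fin n) ℂ}
    (hM : ∀ i j, IsSmoothFun (fun x => M x i j)) (L : Matrix (Fin n) (Fin n) ℂ →ₗ[ℂ] ℂ) :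
    IsSmoothFun (fun x => L (M x)) := by
  have h : ∀ x, L (M x) = ∑ i, ∑ j, M x i j * L (Matrix.single i j 1) := by
    intro x
    conv_lhs => rw [Matrix.matrix_eq_sum_single (M x)]
    simp only [map_sum]
    refine Finset.sum_congr rfl fun i _ => Finset.sum_congr rfl fun j _ => ?_
    rw [← smul_eq_mul, ← map_smul, Matrix.smul_single, smul_eq_mul, mul_one]
  simp only [h]
  exact IsSmoothFun.sum fun i _ => IsSmoothFun.sum fun j _ => (hM i j).mul (isSmoothFun_const _)

/-- Curvature orthogonal to all powers of `Φ₁` is locally of the form `[Φ ∧ ξ dz̄]`: since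
`dz̄ ∧ dz̄ = 0`, this only requires solving `[Φ₁, ξ] = (i / 2) F(∂_x, ∂_y)` for `ξ`, which is
done by a fixed linear map in an adapted frame. -/
lemma exists_local_primitive [ContMDiffVectorBundle ∞ (Fin n → ℂ) E 𝓘(ℝ, ℂ)] (hn : 0 < n)
    {J : HigherComplexStructure S n} (hJ : P.Induces J)
    {A : SLConnection P} (hA : A.IsCompatible) {B : EndForm E} (hB : A.IsAntiInvariantPart B)
    (h : J.IsMuHolomorphic (P.covectorData B)) (x₀ : S) :
    ∃ η : EndForm E, η.IsSmooth n ∧ ∀ᶠ x in 𝓝 x₀, (∀ v, LinearMap.trace ℂ _ (η x v) = 0) ∧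
      ∀ (X Y : ∀ x : S, TangentSpace 𝓘(ℝ, ℂ) x) (s : ∀ x, E x), IsSmoothField X →
        IsSmoothField Y → IsSmoothSection n s →
        A.curvature X Y s x = P.field.bracketWedge η x (X x) (Y x) (s x) := by
  obtain ⟨c, hc, hcx⟩ : ∃ c, c ∈ atlas ℂ S ∧ x₀ ∈ c.source :=
    ⟨chartAt ℂ x₀, chart_mem_atlas ℂ x₀, mem_chart_source ℂ x₀⟩
  have hz := c.map_source hcx
  obtain ⟨W, hzW, ⟨F⟩⟩ := exists_adaptedFrame hn hJ hc hz
  obtain ⟨R, hR0, hR⟩ := exists_adShift_inverse n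
  obtain ⟨X₀, hX₀, hX₀e⟩ := exists_field_eq_coordVec hc hz 1
  obtain ⟨Y₀, hY₀, hY₀e⟩ := exists_field_eq_coordVec hc hz Complex.I
  obtain ⟨f, hf, hfe⟩ := exists_isSmoothFun_conj_coord hc hz
  -- The curvature matrix, extended smoothly from a neighbourhood of `x₀`; there `[X₀, Y₀] = 0`.
  let K : S → Matrix (Fin n) (Fin n) ℂ := fun x => Matrix.of fun i j =>
    F.coord x (A.cov (fun y => A.cov (F.e j) y (Y₀ y)) x (X₀ x)
      - A.cov (fun y => A.cov (F.e j) y (X₀ y)) x (Y₀ x)) i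
  have hK : ∀ i j, IsSmoothFun (fun x => K x i j) := fun i j =>
    F.smooth_coord _ ((A.smooth _ _ hX₀ (A.smooth _ _ hY₀ (F.smooth_e j))).sub
      (A.smooth _ _ hY₀ (A.smooth _ _ hX₀ (F.smooth_e j)))) i
  have hKe : ∀ᶠ w in 𝓝 (c x₀), K (c.symm w) = F.curv A w := by
    filter_upwards [hX₀e.eventually_nhds, hY₀e.eventually_nhds, F.isOpen.mem_nhds hzW]
      with w h1 h2 hw
    ext i j
    have h3 := F.coord_curvature A hw hX₀ hY₀ (F.smooth_e j) i
      (F.vecCoord_eventually hw h1).self_of_nhds (F.vecCoord_eventually hw h2).self_of_nhds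
    rw [SLConnection.curvature, F.mlieBracket_coordinate_fields hw hX₀ hY₀ h1 h2, map_zero,
      sub_zero, F.coord_e w hw] at h3
    simpa [K, Pi.single_apply] using h3
  let T : S → Matrix (Fin n) (Fin n) ℂ := fun x => R ((Complex.I / 2) • K x)
  have hT : ∀ i j, IsSmoothFun (fun x => T x i j) := fun i j => by
    simpa [T] using isSmoothFun_linearMap hK
      ((Matrix.entryLinearMap ℂ ℂ i j).comp ((Complex.I / 2) • R))
  let ξ : ∀ x, Module.End ℂ (E x) := fun x => F.ofMat x (T x)
  -- `f` is the function `z̄`, extended from a neighbourhood of `x₀`, so `η = ξ dz̄` there.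
  let η : EndForm E := fun x =>
    (mvfderiv 𝓘(ℝ, ℂ) f x : TangentSpace 𝓘(ℝ, ℂ) x →ₗ[ℝ] ℂ).smulRight (ξ x)
  have hη : ∀ x v, η x v = mvfderiv 𝓘(ℝ, ℂ) f x v • ξ x := fun x v => rfl
  refine ⟨η, ?_, ?_⟩
  · intro X s hX hs
    simp only [hη, LinearMap.smul_apply, ξ, F.ofMat_apply]
    refine IsSmoothSection.smul (isSmoothFun_mvfderiv hf hX) (IsSmoothSection.sum fun i _ =>
      (F.smooth_e i).smul (IsSmoothFun.sum fun j _ => (hT i j).mul (F.smooth_coord s hs j)))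
  have hloc : ∀ᶠ w in 𝓝 (c x₀), (∀ v, LinearMap.trace ℂ _ (η (c.symm w) v) = 0) ∧
      ∀ (X Y : ∀ x : S, TangentSpace 𝓘(ℝ, ℂ) x) (s : ∀ x, E x), IsSmoothField X →
        IsSmoothField Y → IsSmoothSection n s → A.curvature X Y s (c.symm w) =
          P.field.bracketWedge η (c.symm w) (X (c.symm w)) (Y (c.symm w)) (s (c.symm w)) := by
    filter_upwards [hKe, hfe, F.isOpen.mem_nhds hzW] with w hKw hfw hw
    have hmat : F.mat w (ξ (c.symm w)) = T (c.symm w) := F.mat_ofMat hw _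
    have hcomm : F.mat w ⁅P.field.dzCoeff c w, ξ (c.symm w)⁆ = (Complex.I / 2) • F.curv A w := by
      rw [F.mat_lie hw, hmat, F.mat_dzCoeff hw]
      simp only [T, hKw]
      refine hR _ fun k => ?_
      rw [Matrix.mul_smul, Matrix.trace_smul, F.trace_curv_of_muHolomorphic hJ hA hB h hw,
        smul_zero]
    refine ⟨fun v => ?_, fun X Y s hX hY hs => F.coord_injective hw (funext fun i => ?_)⟩
    · rw [hη, map_smul, ← F.trace_mat hw, hmat, hR0, smul_zero]
    · have hbr : P.field.bracketWedge η (c.symm w) (X (c.symm w)) (Y (c.symm w)) =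
          (vecCoord c w (X (c.symm w)) * conj (vecCoord c w (Y (c.symm w)))
            - vecCoord c w (Y (c.symm w)) * conj (vecCoord c w (X (c.symm w)))) •
          ⁅P.field.dzCoeff c w, ξ (c.symm w)⁆ := by
        have e : ∀ X : TangentSpace 𝓘(ℝ, ℂ) (c.symm w),
            η (c.symm w) X = conj (vecCoord c w X) • ξ (c.symm w) ∧
            P.field (c.symm w) X = vecCoord c w X • P.field.dzCoeff c w +
              conj (vecCoord c w X) • P.field.dzbarCoeff c w := by
          intro X
          have hX := coordVec_vecCoord hc (F.subset hw) X
          refine ⟨?_, ?_⟩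
          · rw [hη, ← hfw, hX]
          · rw [← EndForm.apply_coordVec, hX]
        rw [EndForm.bracketWedge, (e _).1, (e _).1, (e _).2, (e _).2]
        simp only [Ring.lie_def, add_mul, mul_add, smul_mul_assoc, mul_smul_comm, smul_smul,
          smul_sub, smul_add]
        match_scalars <;> ring
      have hbr' : F.mat w (P.field.bracketWedge η (c.symm w) (X (c.symm w)) (Y (c.symm w))) = 
          _ := congrArg (F.mat w) hbr
      rw [F.coord_curvature A hw hX hY hs i rfl rfl, F.coord_apply hw, hbr', F.mat_smul, hcomm,
        Finset.mul_sum]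
      refine Finset.sum_congr rfl fun j _ => ?_
      rw [← mul_assoc]
      refine congrArg (· * F.coord _ (s (c.symm w)) j) ?_
      simp only [Matrix.smul_apply, smul_eq_mul]
      rw [← mul_assoc]
      refine congrArg (· * F.curv A w i j) ?_
      apply Complex.ext <;> simp <;> ring
  have hloc' := (c.continuousAt hcx).eventually hloc
  filter_upwards [hloc', c.open_source.mem_nhds hcx] with x hx hxs
  rw [c.left_inv hxs] at hx
  exact hx

/-- The local primitives of the curvature are glued with a partition of unity, which is possible
because `[Φ ∧ η]` is `C^∞`-linear in `η`. -/
lemma curvatureInImage_of_muHolomorphic [CompactSpace S]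
    [ContMDiffVectorBundle ∞ (Fin n → ℂ) E 𝓘(ℝ, ℂ)] (hn : 0 < n)
    {J : HigherComplexStructure S n} (hJ : P.Induces J)
    {A : SLConnection P} (hA : A.IsCompatible) {B : EndForm E} (hB : A.IsAntiInvariantPart B)
    (h : J.IsMuHolomorphic (P.covectorData B)) : A.CurvatureInImage := by
  choose η hη hloc using exists_local_primitive hn hJ hA hB h
  choose U hU hUo hxU using fun x => eventually_nhds_iff.1 (hloc x)
  obtain ⟨t, ht⟩ := CompactSpace.elim_nhds_subcover U fun x => (hUo x).mem_nhds (hxU x)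
  obtain ⟨ρ, hρ⟩ := SmoothPartitionOfUnity.exists_isSubordinate 𝓘(ℝ, ℂ) (s := Set.univ)
    isClosed_univ (fun i : t => U i) (fun i => hUo i) (by
      intro x _
      have hx : x ∈ ⋃ y ∈ t, U y := ht ▸ Set.mem_univ x
      simpa using hx)
  have hsum : ∀ x, ∑ i, ρ i x = 1 := fun x => by
    rw [← finsum_eq_sum_of_fintype, ρ.sum_eq_one (Set.mem_univ x)]
  have hmem : ∀ i x, ρ i x ≠ 0 → x ∈ U i := fun i x hx => hρ i (subset_tsupport _ hx)
  have hsmul : ∀ (x : S) (r : ℝ) (T : Module.End ℂ (E x)), r • T = (r : ℂ) • T := fun _ _ _ => rfl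
  refine ⟨fun x => ∑ i, ρ i x • η i x, ?_, ?_, ?_⟩
  · intro X s hX hs
    have := IsSmoothSection.sum (T := Finset.univ) fun (i : t) _ =>
      (hη i X s hX hs).real_smul (ρ i).contMDiff
    convert this using 2 with x
    simp only [LinearMap.sum_apply, LinearMap.smul_apply]
  · intro x v
    simp only [LinearMap.sum_apply, LinearMap.smul_apply, map_sum]
    refine Finset.sum_eq_zero fun i _ => ?_
    by_cases hi : ρ i x = 0
    · rw [hi, zero_smul, map_zero]
    · rw [hsmul, map_smul, (hU i x (hmem i x hi)).1 v, smul_zero]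
  · intro X Y s hX hY hs x
    have e : P.field.bracketWedge (fun x => ∑ i, ρ i x • η i x) x (X x) (Y x) (s x) =
        ∑ i, ρ i x • P.field.bracketWedge (η i) x (X x) (Y x) (s x) := by
      simp only [EndForm.bracketWedge, Ring.lie_def, LinearMap.sum_apply, LinearMap.smul_apply,
        LinearMap.sub_apply, Module.End.mul_apply, map_sum, smul_sub, Finset.sum_sub_distrib, hsmul,
        map_smul]
      rfl
    rw [e]
    have e2 : ∀ i, ρ i x • P.field.bracketWedge (η i) x (X x) (Y x) (s x) =
        ρ i x • A.curvature X Y s x := fun i => by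
      by_cases hi : ρ i x = 0
      · rw [hi, zero_smul, zero_smul]
      · rw [(hU i x (hmem i x hi)).2 X Y s hX hY hs]
    rw [Finset.sum_congr rfl fun i _ => e2 i, ← Finset.sum_smul, hsum, one_smul]

lemma muHolomorphic_iff_curvatureInImage [CompactSpace S]
    [ContMDiffVectorBundle ∞ (Fin n → ℂ) E 𝓘(ℝ, ℂ)] (hn : 0 < n)
    {J : HigherComplexStructure S n} (hJ : P.Induces J)
    {A : SLConnection P} (hA : A.IsCompatible) {B : EndForm E} (hB : A.IsAntiInvariantPart B) :
    J.IsMuHolomorphic (P.covectorData B) ↔ A.CurvatureInImage := by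
  refine ⟨curvatureInImage_of_muHolomorphic hn hJ hA hB, fun h c hc z hz k hk => ?_⟩
  obtain ⟨W, hzW, ⟨F⟩⟩ := exists_adaptedFrame hn hJ hc hz
  rw [F.muHolomorphic_expression_eq A hJ hA hB hzW hk, F.trace_curv_of_mem_image h hzW, mul_zero]

end Equivalence

/-! ### Uniqueness of the connection -/

section Uniqueness

variable {S : Type*} [TopologicalSpace S] [T2Space S] [ChartedSpace ℂ S] [IsManifold 𝓘(ℝ, ℂ) ∞ S]
  {n : ℕ} {E : S → Type*} [TopologicalSpace (Bundle.TotalSpace (Fin n → ℂ) E)]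
  [∀ x, AddCommGroup (E x)] [∀ x, Module ℂ (E x)] [∀ x, TopologicalSpace (E x)]
  [∀ x, IsTopologicalAddGroup (E x)] [∀ x, ContinuousSMul ℝ (E x)]
  [FiberBundle (Fin n → ℂ) E] [VectorBundle ℂ (Fin n → ℂ) E] [VectorBundle ℝ (Fin n → ℂ) E]
  {P : FockBundle n E} {c : OpenPartialHomeomorph S ℂ} {W : Set ℂ} {z : ℂ}

namespace AdaptedFrame

variable (F : AdaptedFrame P c W)

lemma connMat_eq (A : SLConnection P) (w u : ℂ) :
    F.connMat A w u = u • F.connDz A w + conj u • F.connDzbar A w := by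
  have h : F.connMat A w u =
      (u.re : ℂ) • F.connMat A w 1 + (u.im : ℂ) • F.connMat A w Complex.I := by
    ext i j
    exact clm_apply_eq_re_im _ u
  have h1 : u = u.re + u.im * Complex.I := (Complex.re_add_im u).symm
  have h2 : conj u = u.re - u.im * Complex.I := by apply Complex.ext <;> simp
  have hI := Complex.I_mul_I
  rw [h, h2, connDz, connDzbar]
  nth_rewrite 3 [h1]
  match_scalars
  · ring
  · linear_combination (u.im : ℂ) * hI

lemma cov_sub_cov (A A' : SLConnection P) (hz : z ∈ W) {s : ∀ x, E x} (hs : IsSmoothSection n s)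
    (u : ℂ) :
    A'.cov s (c.symm z) (coordVec c z u) - A.cov s (c.symm z) (coordVec c z u) =
      (u • F.ofMat (c.symm z) (F.connDz A' z - F.connDz A z)
        + conj u • F.ofMat (c.symm z) (F.connDzbar A' z - F.connDzbar A z)) (s (c.symm z)) := by
  refine F.coord_injective hz (funext fun i => ?_)
  rw [map_sub, Pi.sub_apply, F.coord_cov A' hz hs, F.coord_cov A hz hs, F.coord_apply hz,
    F.mat_add, F.mat_smul, F.mat_smul, F.mat_ofMat hz, F.mat_ofMat hz, add_sub_add_left_eq_sub,
    ← Finset.sum_sub_distrib]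
  refine Finset.sum_congr rfl fun j _ => ?_
  have h1 := congrFun (congrFun (F.connMat_eq A' z u) i) j
  have h2 := congrFun (congrFun (F.connMat_eq A z u) i) j
  simp only [connMat] at h1 h2
  rw [h1, h2, ← sub_mul]
  refine congrArg (· * F.coord _ (s (c.symm z)) j) ?_
  simp only [Matrix.add_apply, Matrix.smul_apply, Matrix.sub_apply, smul_eq_mul]
  ring

lemma trace_connMat_eq (A A' : SLConnection P) (hz : z ∈ W) (u : ℂ) :
    (F.connMat A' z u).trace = (F.connMat A z u).trace := by
  have h := (F.fderiv_volFun A' hz u).symm.trans (F.fderiv_volFun A hz u)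
  exact mul_right_cancel₀ (F.vol_ne_zero z hz) h

lemma trace_shift_pow_mul_sub {A A' : SLConnection P} {B B' : EndForm E}
    (hB : A.IsAntiInvariantPart B) (hB' : A'.IsAntiInvariantPart B')
    (h : ∀ k ∈ Finset.Icc 2 n, P.covectorData B' c k z = P.covectorData B c k z) (hz : z ∈ W)
    (k : ℕ) : (shift n ^ k * (F.connDz A' z - F.connDz A z)).trace = 0 := by
  rcases Nat.eq_zero_or_pos k with rfl | hk
  · rw [pow_zero, one_mul, connDz, connDz, ← smul_sub, Matrix.trace_smul]
    simp [F.trace_connMat_eq A A' hz]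
  by_cases hkn : n ≤ k
  · rw [shift_pow_eq_zero hkn, zero_mul, Matrix.trace_zero]
  · have h1 := h (k + 1) (Finset.mem_Icc.2 ⟨by omega, by omega⟩)
    rw [F.covectorData_eq A' hB' hz (by omega), F.covectorData_eq A hB hz (by omega),
      Nat.add_sub_cancel] at h1
    rw [mul_sub, Matrix.trace_sub, h1, sub_self]

end AdaptedFrame

/-- The difference `β` of two compatible unitary connections with the same covector data satisfies
`β₁ ∈ Im(ad_{Φ₁})`, so positivity of `Φ` forces it to vanish. -/
lemma cov_eq_of_covectorData_eq [ContMDiffVectorBundle ∞ (Fin n → ℂ) E 𝓘(ℝ, ℂ)] (hn : 0 < n)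
    {h : HermitianMetric n E} (hpos : P.IsPositive h) {J : HigherComplexStructure S n}
    (hJ : P.Induces J) {A A' : SLConnection P} (hunit : A.IsUnitary h) (hunit' : A'.IsUnitary h)
    (hcomp : A.IsCompatible) (hcomp' : A'.IsCompatible) {B B' : EndForm E}
    (hB : A.IsAntiInvariantPart B) (hB' : A'.IsAntiInvariantPart B')
    (ht : ∀ c ∈ atlas ℂ S, ∀ k ∈ Finset.Icc 2 n, ∀ z ∈ c.target,
      P.covectorData B' c k z = P.covectorData B c k z)
    {s : ∀ x, E x} (hs : IsSmoothSection n s) : A'.cov s = A.cov s := by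
  have key : ∀ c ∈ atlas ℂ S, ∀ z ∈ c.target, ∀ u : ℂ,
      A'.cov s (c.symm z) (coordVec c z u) = A.cov s (c.symm z) (coordVec c z u) := by
    intro c hc z hz u
    obtain ⟨W, hzW, ⟨F⟩⟩ := exists_adaptedFrame hn hJ hc hz
    obtain ⟨R, hR0, hR⟩ := exists_adShift_inverse n
    set b₁ := F.connDz A' z - F.connDz A z with hb₁
    set b₂ := F.connDzbar A' z - F.connDzbar A z with hb₂
    have hsub := fun (t : ∀ x, E x) (ht : IsSmoothSection n t) (u : ℂ) =>
      F.cov_sub_cov A A' hzW ht u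
    simp only [← hb₁, ← hb₂] at hsub
    have hskew : ∀ (v w : E (c.symm z)) (u : ℂ),
        h.form _ ((u • F.ofMat (c.symm z) b₁ + conj u • F.ofMat (c.symm z) b₂) v) w
          + h.form _ v ((u • F.ofMat (c.symm z) b₁ + conj u • F.ofMat (c.symm z) b₂) w) = 0 := by
      intro v w u
      obtain ⟨s, hs, rfl⟩ := exists_isSmoothSection (n := n) v
      obtain ⟨t, ht, rfl⟩ := exists_isSmoothSection (n := n) w
      have h1 := hunit s t hs ht (c.symm z) (coordVec c z u)
      have h2 := hunit' s t hs ht (c.symm z) (coordVec c z u)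
      rw [← hsub s hs, ← hsub t ht, map_sub, map_sub, LinearMap.sub_apply]
      linear_combination h1 - h2
    have hskew' : ∀ v w, h.form _ (F.ofMat (c.symm z) b₁ v) w =
        - h.form _ v (F.ofMat (c.symm z) b₂ w) := by
      intro v w
      have h1 := hskew v w 1
      have h2 := hskew v w Complex.I
      simp only [map_one, one_smul, Complex.conj_I, LinearMap.add_apply, LinearMap.smul_apply,
        map_add, LinearMap.map_smulₛₗ, neg_smul, LinearMap.neg_apply, map_neg, smul_eq_mul] at h1 h2
      have hI := Complex.I_mul_I
      simp at h2
      linear_combination (1 / 2 : ℂ) * h1 + Complex.I / 2 * h2 + (1 / 2 : ℂ) *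
        (h.form _ (F.ofMat (c.symm z) b₁ v) w - h.form _ (F.ofMat (c.symm z) b₂ v) w
          - h.form _ v (F.ofMat (c.symm z) b₁ w) + h.form _ v (F.ofMat (c.symm z) b₂ w)) * hI
    have hcommute : ⁅F.ofMat (c.symm z) b₁, P.field.dzbarCoeff c z⁆ =
        ⁅F.ofMat (c.symm z) b₂, P.field.dzCoeff c z⁆ := by
      refine F.mat_injective hzW ?_
      rw [F.mat_lie hzW, F.mat_lie hzW, F.mat_ofMat hzW, F.mat_ofMat hzW, F.mat_dzCoeff hzW,
        F.mat_dzbarCoeff hJ hzW]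
      have h1 := F.compatible_matrix A hJ hcomp hzW
      have h2 := F.compatible_matrix A' hJ hcomp' hzW
      have h3 := congrArg₂ (· - ·) h2 h1
      simp only [add_sub_add_left_eq_sub] at h3
      rw [hb₁, hb₂, sub_mul, sub_mul, mul_sub, mul_sub]
      rw [sub_sub_sub_comm, sub_sub_sub_comm (F.connDzbar A' z * _)]
      exact h3.symm
    have hξ : ⁅P.field.dzCoeff c z, F.ofMat (c.symm z) (R b₁)⁆ = F.ofMat (c.symm z) b₁ := by
      refine F.mat_injective hzW ?_
      rw [F.mat_lie hzW, F.mat_ofMat hzW, F.mat_ofMat hzW, F.mat_dzCoeff hzW]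
      exact hR _ (F.trace_shift_pow_mul_sub hB hB' (fun k hk => ht c hc k hk z hz) hzW)
    have hfin : FiniteDimensional ℂ (E (c.symm z)) := .of_basis (F.basis hzW)
    have hφ : Commute (P.field.dzCoeff c z) (P.field.dzbarCoeff c z) :=
      ((commute_dzCoeff P c z _).add_right ((commute_dzCoeff P c z _).smul_right _)).smul_right _
    obtain ⟨e1, e2⟩ := eq_zero_of_skew_of_positive (h.conj_symm _) (h.pos _)
      hφ.eq hξ hskew' hcommute
      (hpos c hc z hz _ (by rw [← F.trace_mat hzW, F.mat_ofMat hzW, hR0]))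
    have h4 := hsub s hs u
    rw [e1, e2, smul_zero, smul_zero, add_zero, LinearMap.zero_apply] at h4
    exact sub_eq_zero.1 h4
  funext x
  have hc := chart_mem_atlas ℂ x
  have hx := mem_chart_source ℂ x
  have hz := mem_chart_target ℂ x
  have h2 : A'.cov s ((chartAt ℂ x).symm (chartAt ℂ x x)) =
      A.cov s ((chartAt ℂ x).symm (chartAt ℂ x x)) := by
    ext v
    rw [← coordVec_vecCoord hc hz v]
    exact key _ hc _ hz _
  rwa [(chartAt ℂ x).left_inv hx] at h2

end Uniqueness

end FockBundles

end

theorem theorem6p12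
    {S : Type*} [TopologicalSpace S] [T2Space S] [CompactSpace S] [ConnectedSpace S]
    [ChartedSpace ℂ S] [IsManifold 𝓘(ℝ, ℂ) ∞ S] [IsManifold 𝓘(ℂ) ω S]
    {n : ℕ} (hn : 2 ≤ n)
    {E : S → Type*} [TopologicalSpace (Bundle.TotalSpace (Fin n → ℂ) E)]
    [∀ x, AddCommGroup (E x)] [∀ x, Module ℂ (E x)] [∀ x, TopologicalSpace (E x)]
    [∀ x, IsTopologicalAddGroup (E x)] [∀ x, ContinuousSMul ℝ (E x)]
    [FiberBundle (Fin n → ℂ) E] [VectorBundle ℂ (Fin n → ℂ) E] [VectorBundle ℝ (Fin n → ℂ) E]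
    [ContMDiffVectorBundle ∞ (Fin n → ℂ) E 𝓘(ℝ, ℂ)]
    (P : FockBundles.FockBundle n E) (h : FockBundles.HermitianMetric n E)
    (hpos : P.IsPositive h)
    (J : FockBundles.HigherComplexStructure S n) (hJ : P.Induces J)
    (A : FockBundles.SLConnection P) (hunit : A.IsUnitary h) (hcomp : A.IsCompatible)
    (B : FockBundles.EndForm E) (hB : A.IsAntiInvariantPart B) :
    (∀ (A' : FockBundles.SLConnection P) (B' : FockBundles.EndForm E),
        A'.IsUnitary h → A'.IsCompatible → A'.IsAntiInvariantPart B' →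
        (∀ c ∈ atlas ℂ S, ∀ k ∈ Finset.Icc 2 n, ∀ z ∈ c.target,
          P.covectorData B' c k z = P.covectorData B c k z) →
        ∀ s : ∀ x, E x, FockBundles.IsSmoothSection n s → A'.cov s = A.cov s) ∧
    (J.IsMuHolomorphic (P.covectorData B) ↔ A.CurvatureInImage) :=
  ⟨fun _ _ hunit' hcomp' hB' ht _ hs =>
    FockBundles.cov_eq_of_covectorData_eq (by omega) hpos hJ hunit hunit' hcomp hcomp' hB hB' ht hs,
    FockBundles.muHolomorphic_iff_curvatureInImage (by omega) hJ hcomp hB⟩
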